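/- Homology is singular homology with coefficients in $\mathbb{Z}_2$, and $\beta_i$ denotes the $i$-th non-reduced Betti number. Let $C$ be a finite simplicial complex, linearly embedded in $\mathbb{R}^3$ (faces go to simplices, and two simplices meet exactly in the simplex spanned by their common vertices) with image $|C|$. Let $\pi\in\mathbb{R}^3\setminus\{0\}$ be in general position with respect to $C$, i.e. no two distinct vertices of $C$ have the same value of $\langle\pi,-\rangle$. Suppose that $|C|$ is $\pi$-tight: for every $t\in\mathbb{R}$ and every $i\ge 0$ the map $$H_i\big(\{x\in|C| : \langle\pi,x\rangle>t\}\big)\longrightarrow H_i(|C|)$$ induced by inclusion is injective. Then: 1. $C$ admits a perfect discrete Morse function, i.e. a map $f$ from the set of nonempty faces of $C$ to $\mathbb{Z}$ that is weakly increasing with respect to inclusion and at most $2$-to-$1$, such that for every $i\ge0$ exactly $\beta_i(C)$ of the $i$-dimensional faces are critical. Here a face $\sigma$ is critical if $f(\tau)<f(\sigma)$ for all faces $\tau\subsetneq\sigma$ and $f(\sigma)<f(\tau)$ for all faces $\tau\supsetneq\sigma$. 2. If in addition $C$ has trivial homology ($\beta_0(C)=1$ and $H_i(C)=0$ for all $i>0$),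 then $C$ is non-evasive. Here non-evasiveness is defined recursively: a single vertex is non-evasive, and a complex of positive dimension is non-evasive if and only if it has a vertex whose link and whose deletion are both non-evasive. -/

import Mathlib

open CategoryTheory

noncomputable section

/-! ### Singular homology with coefficients in the field with two elements -/

/-- The `i`-th singular homology functor with coefficients in `ZMod 2`. -/
abbrev homologyZ2 (i : ℕ) : TopCat.{0} ⥤ ModuleCat.{0} (ZMod 2) :=
  (AlgebraicTopology.singularHomologyFunctor (ModuleCat.{0} (ZMod 2)) i).obj
    (ModuleCat.of (ZMod 2) (ZMod 2))

/-- The map `H_i(A; ℤ/2) → H_i(X; ℤ/2)` induced by an inclusion `A ⊆ X` of subspaces. -/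
def homologyInclusion {E : Type} [TopologicalSpace E] {A X : Set E} (h : A ⊆ X) (i : ℕ) :
    (homologyZ2 i).obj (TopCat.of A) ⟶ (homologyZ2 i).obj (TopCat.of X) :=
  (homologyZ2 i).map (TopCat.ofHom ⟨Set.inclusion h, continuous_inclusion h⟩)

/-- `X` is `π`-tight: for every affine hyperplane `{x | ⟪π, x⟫ = t}` orthogonal to `π`, the part of
`X` in the open halfspace on the side of `π` includes into `X` injectively on homology. -/
def IsPiTight {E : Type} [NormedAddCommGroup E] [InnerProductSpace ℝ E] (π : E) (X : Set E) :
    Prop :=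
  ∀ (t : ℝ) (i : ℕ), Function.Injective
    (homologyInclusion (Set.inter_subset_right : {x : E | t < inner ℝ π x} ∩ X ⊆ X) i)

namespace PreAbstractSimplicialComplex

variable {V : Type}

/-! ### Linear embeddings and polyhedra -/

/-- The union of the convex hulls of the images of the faces under a map on the vertices. -/
def polyhedron {E : Type} [AddCommGroup E] [Module ℝ E]
    (C : PreAbstractSimplicialComplex V) (φ : V → E) : Set E :=
  ⋃ s ∈ C.faces, convexHull ℝ (φ '' (s : Set V))

/-- The map `φ` on the vertices defines a linear embedding (geometric realization) of `C`: each face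
spans a genuine simplex, and two simplices meet exactly in the simplex spanned by their common
vertices. -/
structure IsLinearEmbedding {E : Type} [AddCommGroup E] [Module ℝ E]
    (C : PreAbstractSimplicialComplex V) (φ : V → E) : Prop where
  affineIndependent : ∀ s ∈ C.faces, AffineIndependent ℝ (fun v : s => φ v)
  inter_eq : ∀ s ∈ C.faces, ∀ t ∈ C.faces,
    convexHull ℝ (φ '' (s : Set V)) ∩ convexHull ℝ (φ '' (t : Set V)) =
      convexHull ℝ (φ '' ((s : Set V) ∩ (t : Set V)))

/-- The standard geometric realization, in the space of barycentric coordinates `V → ℝ`. -/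
def realization [DecidableEq V] (C : PreAbstractSimplicialComplex V) : Set (V → ℝ) :=
  C.polyhedron (fun v => Pi.single v (1 : ℝ))

/-- The `i`-th homology of a complex over `ZMod 2`. -/
abbrev homology [DecidableEq V] (C : PreAbstractSimplicialComplex V) (i : ℕ) :
    ModuleCat.{0} (ZMod 2) :=
  (homologyZ2 i).obj (TopCat.of C.realization)

/-- The `i`-th (non-reduced) Betti number over `ZMod 2`. -/
def betti [DecidableEq V] (C : PreAbstractSimplicialComplex V) (i : ℕ) : ℕ :=
  Module.finrank (ZMod 2) (C.homology i)

/-- `C` has the homology of a point over `ZMod 2`, i.e. its reduced homology vanishes. -/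
def HasTrivialHomology [DecidableEq V] (C : PreAbstractSimplicialComplex V) : Prop :=
  C.betti 0 = 1 ∧ ∀ i : ℕ, 0 < i → Subsingleton (C.homology i)

/-! ### Discrete Morse functions -/

/-- A discrete Morse function: a weakly increasing and at most 2-to-1 map from the poset of
(nonempty) faces to the integers. -/
structure IsDiscreteMorse (C : PreAbstractSimplicialComplex V) (f : C.faces → ℤ) : Prop where
  mono : ∀ σ τ : C.faces, (σ : Finset V) ⊆ τ → f σ ≤ f τ
  two_to_one : ∀ a : ℤ, (f ⁻¹' {a}).encard ≤ 2

/-- A face is critical if `f` is strictly increasing at it. -/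
def IsCritical (C : PreAbstractSimplicialComplex V) (f : C.faces → ℤ) (σ : C.faces) : Prop :=
  (∀ τ : C.faces, (τ : Finset V) ⊂ σ → f τ < f σ) ∧
    (∀ τ : C.faces, (σ : Finset V) ⊂ τ → f σ < f τ)

/-- A discrete Morse function with, for every `i`, exactly as many critical `i`-dimensional faces
as the `i`-th Betti number over `ZMod 2`. -/
def IsPerfectMorse [DecidableEq V] (C : PreAbstractSimplicialComplex V) (f : C.faces → ℤ) : Prop :=
  C.IsDiscreteMorse f ∧
    ∀ i : ℕ, {σ : C.faces | (σ : Finset V).card = i + 1 ∧ C.IsCritical f σ}.encard = C.betti i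

/-! ### Non-evasive complexes -/

/-- The deletion of a vertex: all faces not containing it. -/
def deletion (C : PreAbstractSimplicialComplex V) (v : V) : PreAbstractSimplicialComplex V where
  faces := {s | s ∈ C.faces ∧ v ∉ s}
  isRelLowerSet_faces := fun _ hs =>
    ⟨(C.isRelLowerSet_faces hs.1).1, fun _ hts ht =>
      ⟨(C.isRelLowerSet_faces hs.1).2 hts ht, fun hv => hs.2 (hts hv)⟩⟩

/-- The link of a vertex `v`: all nonempty `s` not containing `v` such that `s ∪ {v}` is a face. -/
def link [DecidableEq V] (C : PreAbstractSimplicialComplex V) (v : V) :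
    PreAbstractSimplicialComplex V where
  faces := {s | s.Nonempty ∧ v ∉ s ∧ insert v s ∈ C.faces}
  isRelLowerSet_faces := fun _ hs =>
    ⟨hs.1, fun _ hts ht => ⟨ht, fun hv => hs.2.1 (hts hv),
      (C.isRelLowerSet_faces hs.2.2).2 (Finset.insert_subset_insert v hts)
        (Finset.insert_nonempty _ _)⟩⟩

/-- Non-evasive complexes: a point is non-evasive, and a complex is non-evasive if some vertex has
non-evasive link and non-evasive deletion. (The empty complex is not non-evasive, so the second
clause never applies to a `0`-dimensional complex, in which all links are empty.) -/
inductive NonEvasive [DecidableEq V] : PreAbstractSimplicialComplex V → Prop where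
  | point (C : PreAbstractSimplicialComplex V) (v : V) (h : C.faces = {{v}}) : NonEvasive C
  | step (C : PreAbstractSimplicialComplex V) (v : V) (hv : {v} ∈ C.faces)
      (hlink : NonEvasive (C.link v)) (hdel : NonEvasive (C.deletion v)) : NonEvasive C

end PreAbstractSimplicialComplex

end

/-! The complex is assembled from the top down along π, one vertex at a time. Let v be the lowest
vertex, D its deletion and L its link. D is the full subcomplex on the vertices above the level of
v, and the open superlevel set of |C| retracts onto its image; so tightness makes H_*(D) → H_*(C)
injective (`injective_of_isPiTight`, `IsTight.delMap_injective`), and D is again tight. Since C is D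
with a cone over L attached, the Mayer–Vietoris sequence of the open star of v and the complement of
v splits: for L nonempty, β_0(C) = β_0(D) and β_{i+1}(C) = β_{i+1}(D) + (reduced β_i of L); see
`betti_zero_eq`, `betti_one_add_one`, `betti_succ_eq`.

Dimension three enters through L. All neighbours of v lie strictly on one side of a plane through v,
so central projection from v embeds L linearly in a plane (`emb_link`). A planar complex has a
perfect build-up: its triangles are removed through free edges (`Emb.exists_free`), and the
remaining graph has a spanning forest with one critical vertex per component. The number of critical
edges is then forced by the Euler characteristic, because planar complexes satisfy β_0 − β_1 = χ and
have no higher homology (`Emb.betti_of_two`).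

Coning a build-up of L from v raises each critical face by one dimension, except that the first
critical vertex of L cancels against v (`Build.cone`). This is exactly the passage from β_0 to
reduced β_0, so the counts of critical faces obey the recursion of the Betti numbers. Giving the
faces increasing integers in the order of attachment, with the same integer for the two faces of a
pair, produces the discrete Morse function.

For non-evasiveness, trivial homology of C forces D to have trivial homology and L to be connected
with χ(L) = 1. By induction it remains to treat such planar complexes. There the key is a vertex
whose link is again connected with χ = 1, found by splitting at cut vertices (`IsConn.exists_link`).

The Betti numbers are those of singular homology throughout. They are controlled by Mayer–Vietoris
alone, together with the count of path components in degree 0; the sequence itself is derived from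
barycentric subdivision of singular chains modulo two. -/

set_option linter.unusedSectionVars false

open CategoryTheory

noncomputable section

/-! ### Formal simplices with vertices in a set, modulo two -/

namespace TupleChain

variable {K K' : Type}

/-- The boundary of formal simplices; there is also an empty simplex, so this is augmented. -/
def bdry (K : Type) (n : ℕ) :
    ((Fin (n + 1) → K) →₀ ZMod 2) →ₗ[ZMod 2] ((Fin n → K) →₀ ZMod 2) :=
  Finsupp.linearCombination (ZMod 2) fun w => ∑ i : Fin (n + 1), Finsupp.single (i.removeNth w) 1

/-- Adding a new first vertex to formal simplices. -/
def cone (a : K) (n : ℕ) :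
    ((Fin n → K) →₀ ZMod 2) →ₗ[ZMod 2] ((Fin (n + 1) → K) →₀ ZMod 2) :=
  Finsupp.lmapDomain _ _ (fun w : Fin n → K => (Fin.cons a w : Fin (n + 1) → K))

/-- The map on formal simplices induced by a map on vertices. -/
def map (f : K → K') (n : ℕ) :
    ((Fin n → K) →₀ ZMod 2) →ₗ[ZMod 2] ((Fin n → K') →₀ ZMod 2) :=
  Finsupp.lmapDomain _ _ (fun w => f ∘ w)

lemma bdry_single {n : ℕ} (w : Fin (n + 1) → K) :
    bdry K n (Finsupp.single w 1) = ∑ i : Fin (n + 1), Finsupp.single (i.removeNth w) 1 := by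
  simp [bdry]

lemma cone_single (a : K) {n : ℕ} (w : Fin n → K) :
    cone a n (Finsupp.single w 1) = Finsupp.single (Fin.cons a w : Fin (n + 1) → K) 1 := by
  simp [cone]

lemma map_single (f : K → K') {n : ℕ} (w : Fin n → K) :
    map f n (Finsupp.single w 1) = Finsupp.single (f ∘ w) 1 := by
  simp [map]

/-- Induction principle for linear identities on free modules. -/
lemma linear_ext {α M : Type*} [AddCommGroup M] [Module (ZMod 2) M]
    {f g : (α →₀ ZMod 2) →ₗ[ZMod 2] M}
    (h : ∀ a, f (Finsupp.single a 1) = g (Finsupp.single a 1)) : f = g := by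
  apply Finsupp.lhom_ext
  intro a b
  have : (Finsupp.single a b : α →₀ ZMod 2) = b • Finsupp.single a 1 := by simp
  rw [this, map_smul, map_smul, h]

lemma add_self_zero {M : Type*} [AddCommGroup M] [Module (ZMod 2) M] (x : M) : x + x = 0 := by
  rw [← two_smul (ZMod 2) x, show (2 : ZMod 2) = 0 from rfl, zero_smul]

lemma add_add_add_cancel_self {M : Type*} [AddCommGroup M] [Module (ZMod 2) M] (x y z : M) :
    x + y + (y + z) = x + z := by
  rw [add_assoc, ← add_assoc y, add_self_zero, zero_add]

/-- Dropping the new first vertex returns c, and dropping any other vertex commutes with coning.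
Modulo two there are no signs. -/
lemma bdry_cone_succ (a : K) (n : ℕ) (c : (Fin (n + 1) → K) →₀ ZMod 2) :
    bdry K (n + 1) (cone a (n + 1) c) = c + cone a n (bdry K n c) := by
  have : (bdry K (n + 1)).comp (cone a (n + 1)) = LinearMap.id + (cone a n).comp (bdry K n) := by
    apply linear_ext
    intro w
    simp only [LinearMap.comp_apply, LinearMap.add_apply, LinearMap.id_apply, cone_single,
      bdry_single, map_sum]
    rw [Fin.sum_univ_succ]
    congr 1
    refine Finset.sum_congr rfl fun i _ => ?_
    congr 1
    funext j
    refine Fin.cases ?_ (fun j => ?_) j <;> simp [Fin.removeNth]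
  exact LinearMap.congr_fun this c

lemma bdry_cone_zero (a : K) (c : (Fin 0 → K) →₀ ZMod 2) :
    bdry K 0 (cone a 0 c) = c := by
  have : (bdry K 0).comp (cone a 0) = LinearMap.id := by
    apply linear_ext
    intro w
    simp only [LinearMap.comp_apply, LinearMap.id_apply, cone_single, bdry_single]
    rw [Fin.sum_univ_succ, Fin.sum_univ_zero, add_zero]
    congr 1
  exact LinearMap.congr_fun this c

/-- Every nonempty tuple is the cone from its head over its tail, so induction with the cone formula
replaces the usual cancellation in a double sum. -/
lemma bdry_bdry (n : ℕ) (c : (Fin (n + 2) → K) →₀ ZMod 2) :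
    bdry K n (bdry K (n + 1) c) = 0 := by
  have : (bdry K n).comp (bdry K (n + 1)) = 0 := by
    clear c
    induction n with
    | zero =>
      apply linear_ext
      intro w
      rw [← Fin.cons_self_tail w, ← cone_single, LinearMap.comp_apply, bdry_cone_succ, map_add,
        bdry_cone_zero, add_self_zero, LinearMap.zero_apply]
    | succ n ih =>
      apply linear_ext
      intro w
      rw [← Fin.cons_self_tail w, ← cone_single, LinearMap.comp_apply, bdry_cone_succ, map_add,
        bdry_cone_succ, ← LinearMap.comp_apply (bdry K n), ih, LinearMap.zero_apply,
        map_zero, add_zero, add_self_zero, LinearMap.zero_apply]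
  exact LinearMap.congr_fun this c

lemma bdry_map (f : K → K') (n : ℕ) (c : (Fin (n + 1) → K) →₀ ZMod 2) :
    bdry K' n (map f (n + 1) c) = map f n (bdry K n c) := by
  have : (bdry K' n).comp (map f (n + 1)) = (map f n).comp (bdry K n) := by
    apply linear_ext
    intro w
    simp only [LinearMap.comp_apply, map_single, bdry_single, map_sum]
    rfl
  exact LinearMap.congr_fun this c

lemma map_cone (f : K → K') (a : K) (n : ℕ) (c : (Fin n → K) →₀ ZMod 2) :
    map f (n + 1) (cone a n c) = cone (f a) n (map f n c) := by
  have : (map f (n + 1)).comp (cone a n) = (cone (f a) n).comp (map f n) := by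
    apply linear_ext
    intro w
    simp only [LinearMap.comp_apply, map_single, cone_single]
    congr 1
    funext j
    refine Fin.cases ?_ (fun j => ?_) j <;> simp
  exact LinearMap.congr_fun this c

/-- Subdivision of formal simplices, with respect to a choice `b` of barycenters. -/
def sd (b : ∀ n : ℕ, (Fin (n + 1) → K) → K) :
    ∀ n : ℕ, ((Fin n → K) →₀ ZMod 2) →ₗ[ZMod 2] ((Fin n → K) →₀ ZMod 2)
  | 0 => LinearMap.id
  | n + 1 => Finsupp.linearCombination (ZMod 2) fun w =>
      cone (b n w) n (sd b n (bdry K n (Finsupp.single w 1)))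

/-- The chain homotopy between subdivision and the identity. -/
def homot (b : ∀ n : ℕ, (Fin (n + 1) → K) → K) :
    ∀ n : ℕ, ((Fin n → K) →₀ ZMod 2) →ₗ[ZMod 2] ((Fin (n + 1) → K) →₀ ZMod 2)
  | 0 => 0
  | n + 1 => Finsupp.linearCombination (ZMod 2) fun w =>
      cone (b n w) (n + 1) (Finsupp.single w 1 + homot b n (bdry K n (Finsupp.single w 1)))

variable (b : ∀ n : ℕ, (Fin (n + 1) → K) → K)

lemma sd_single (n : ℕ) (w : Fin (n + 1) → K) :
    sd b (n + 1) (Finsupp.single w 1) =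
      cone (b n w) n (sd b n (bdry K n (Finsupp.single w 1))) := by
  simp [sd]

lemma homot_single (n : ℕ) (w : Fin (n + 1) → K) :
    homot b (n + 1) (Finsupp.single w 1) = cone (b n w) (n + 1)
      (Finsupp.single w 1 + homot b n (bdry K n (Finsupp.single w 1))) := by
  simp [homot]

lemma bdry_sd (n : ℕ) (c : (Fin (n + 1) → K) →₀ ZMod 2) :
    bdry K n (sd b (n + 1) c) = sd b n (bdry K n c) := by
  have : (bdry K n).comp (sd b (n + 1)) = (sd b n).comp (bdry K n) := by
    clear c
    induction n with
    | zero =>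
      apply linear_ext
      intro w
      rw [LinearMap.comp_apply, LinearMap.comp_apply, sd_single, bdry_cone_zero]
    | succ n ih =>
      apply linear_ext
      intro w
      rw [LinearMap.comp_apply, LinearMap.comp_apply, sd_single, bdry_cone_succ,
        ← LinearMap.comp_apply (bdry K n), ih, LinearMap.comp_apply, bdry_bdry, map_zero,
        map_zero, add_zero]
  exact LinearMap.congr_fun this c

/-- Apply the cone formula to the definition of the homotopy; the correction term is the inductive
hypothesis for the boundary of the simplex, whose own boundary vanishes. -/
lemma bdry_homot (n : ℕ) (c : (Fin (n + 1) → K) →₀ ZMod 2) :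
    bdry K (n + 1) (homot b (n + 1) c) + homot b n (bdry K n c) = c + sd b (n + 1) c := by
  have : (bdry K (n + 1)).comp (homot b (n + 1)) + (homot b n).comp (bdry K n) =
      LinearMap.id + sd b (n + 1) := by
    clear c
    induction n with
    | zero =>
      apply linear_ext
      intro w
      simp only [LinearMap.comp_apply, LinearMap.add_apply, LinearMap.id_apply]
      rw [homot_single, bdry_cone_succ, sd_single]
      simp [homot, sd]
    | succ n ih =>
      apply linear_ext
      intro w
      simp only [LinearMap.comp_apply, LinearMap.add_apply, LinearMap.id_apply]
      rw [homot_single, bdry_cone_succ, sd_single]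
      have h := LinearMap.congr_fun ih (bdry K (n + 1) (Finsupp.single w 1))
      simp only [LinearMap.comp_apply, LinearMap.add_apply, LinearMap.id_apply, bdry_bdry,
        map_zero, add_zero] at h
      rw [map_add, h, ← add_assoc (bdry K (n + 1) _), add_self_zero, zero_add,
        add_right_comm _ (cone _ _ _), add_assoc _ (homot b _ _)]
      exact add_add_add_cancel_self _ _ _
  exact LinearMap.congr_fun this c

/-- The hypothesis says that f preserves barycenters, as affine maps do. This naturality is what
transports subdivision from affine simplices to arbitrary singular simplices. -/
lemma map_sd {b' : ∀ n : ℕ, (Fin (n + 1) → K') → K'} (f : K → K')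
    (hf : ∀ n w, f (b n w) = b' n (f ∘ w)) (n : ℕ) (c : (Fin n → K) →₀ ZMod 2) :
    map f n (sd b n c) = sd b' n (map f n c) := by
  have : (map f n).comp (sd b n) = (sd b' n).comp (map f n) := by
    clear c
    induction n with
    | zero => rfl
    | succ n ih =>
      apply linear_ext
      intro w
      rw [LinearMap.comp_apply, LinearMap.comp_apply, sd_single, map_single, sd_single, map_cone,
        hf, ← LinearMap.comp_apply (map f n), ih, LinearMap.comp_apply, ← bdry_map, map_single]
  exact LinearMap.congr_fun this c

lemma map_homot {b' : ∀ n : ℕ, (Fin (n + 1) → K') → K'} (f : K → K')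
    (hf : ∀ n w, f (b n w) = b' n (f ∘ w)) (n : ℕ) (c : (Fin n → K) →₀ ZMod 2) :
    map f (n + 1) (homot b n c) = homot b' n (map f n c) := by
  have : (map f (n + 1)).comp (homot b n) = (homot b' n).comp (map f n) := by
    clear c
    induction n with
    | zero => simp [homot]
    | succ n ih =>
      apply linear_ext
      intro w
      rw [LinearMap.comp_apply, LinearMap.comp_apply, homot_single, map_single, homot_single,
        map_cone, hf, map_add, ← LinearMap.comp_apply (map f (n + 1)), ih, LinearMap.comp_apply,
        ← bdry_map, map_single]
  exact LinearMap.congr_fun this c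

/-- A linear map carries chains supported on `S` into `N` if it does so on the simplices in `S`. -/
lemma map_supported_le {α M : Type*} [AddCommGroup M] [Module (ZMod 2) M]
    (f : (α →₀ ZMod 2) →ₗ[ZMod 2] M) (S : Set α) (N : Submodule (ZMod 2) M)
    (h : ∀ a ∈ S, f (Finsupp.single a 1) ∈ N) {c : α →₀ ZMod 2}
    (hc : c ∈ Finsupp.supported (ZMod 2) (ZMod 2) S) : f c ∈ N := by
  rw [Finsupp.supported_eq_span_single] at hc
  have : Submodule.span (ZMod 2) ((fun i => Finsupp.single i (1 : ZMod 2)) '' S) ≤ N.comap f := by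
    rw [Submodule.span_le]
    rintro _ ⟨a, ha, rfl⟩
    exact h a ha
  exact this hc

section Mesh

variable {E : Type} [NormedAddCommGroup E] [NormedSpace ℝ E] {P : Set E}

/-- The subdivision shrinks simplices by a constant factor. -/
lemma sd_mem_supported (b : ∀ n : ℕ, (Fin (n + 1) → P) → P)
    (hb : ∀ n w, (b n w : E) = ∑ i, ((n + 1 : ℝ)⁻¹) • (w i : E)) (d : ℝ) (hd : 0 ≤ d) (n : ℕ)
    (w : Fin n → P) (hw : ∀ i j, dist (w i) (w j) ≤ d) :
    sd b n (Finsupp.single w 1) ∈ Finsupp.supported (ZMod 2) (ZMod 2)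
      {w' : Fin n → P | (∀ i, (w' i : E) ∈ convexHull ℝ (Set.range fun j => (w j : E))) ∧
        ∀ i j, dist (w' i) (w' j) ≤ (1 - (n : ℝ)⁻¹) * d} := by
  induction n with
  | zero => exact Finsupp.single_mem_supported _ _ ⟨fun i => i.elim0, fun i => i.elim0⟩
  | succ n ih =>
    have hn : (0 : ℝ) < n + 1 := by positivity
    rw [sd_single, bdry_single, map_sum, map_sum]
    refine Submodule.sum_mem _ fun i _ => ?_
    refine map_supported_le (cone (b n w) n) _ _ ?_
      (ih (i.removeNth w) fun j k => hw _ _)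
    rintro w' ⟨h1, h2⟩
    rw [cone_single]
    apply Finsupp.single_mem_supported
    have hbw : (b n w : E) ∈ convexHull ℝ (Set.range fun j => (w j : E)) := by
      rw [hb]
      refine (convex_convexHull ℝ _).sum_mem (fun _ _ => by positivity) ?_
        fun j _ => subset_convexHull ℝ _ ⟨j, rfl⟩
      simp
      field_simp
    have hsub : ∀ k, (w' k : E) ∈ convexHull ℝ (Set.range fun j => (w j : E)) := fun k =>
      convexHull_mono (by rintro _ ⟨j, rfl⟩; exact ⟨i.succAbove j, rfl⟩) (h1 k)
    -- The difference between a vertex and the barycenter is the mean of n + 1 differences of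
    -- vertices, one of which is zero; hence the factor n/(n + 1).
    have hball : convexHull ℝ (Set.range fun j => (w j : E)) ⊆
        Metric.closedBall (b n w : E) ((1 - ((n + 1 : ℕ) : ℝ)⁻¹) * d) := by
      refine convexHull_min ?_ (convex_closedBall _ _)
      rintro _ ⟨j, rfl⟩
      simp only [Metric.mem_closedBall]
      rw [dist_eq_norm, hb]
      have e : (w j : E) - ∑ i, ((n + 1 : ℝ)⁻¹) • (w i : E) =
          ∑ i, ((n + 1 : ℝ)⁻¹) • ((w j : E) - w i) := by
        simp_rw [smul_sub]
        rw [Finset.sum_sub_distrib]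
        congr 1
        simp only [Finset.sum_const, Finset.card_univ, Fintype.card_fin]
        rw [← Nat.cast_smul_eq_nsmul ℝ, smul_smul]
        push_cast
        rw [mul_inv_cancel₀ hn.ne', one_smul]
      rw [e, Fin.sum_univ_succAbove _ j]
      simp only [sub_self, smul_zero, zero_add]
      refine (norm_sum_le _ _).trans ?_
      calc _ ≤ ∑ i : Fin n, (n + 1 : ℝ)⁻¹ * d := by
            refine Finset.sum_le_sum fun k _ => ?_
            rw [norm_smul, Real.norm_of_nonneg (by positivity), ← dist_eq_norm]
            gcongr
            exact hw j _
        _ = _ := by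
            simp
            field_simp
            ring
    refine ⟨fun k => ?_, fun k l => ?_⟩
    · refine Fin.cases ?_ (fun k => ?_) k
      · simpa using hbw
      · simpa using hsub k
    · have hr : 0 < n → (1 - (n : ℝ)⁻¹) * d ≤ (1 - ((n + 1 : ℕ) : ℝ)⁻¹) * d := by
        intro hn0
        gcongr
        linarith
      have h0 : 0 ≤ (1 - ((n + 1 : ℕ) : ℝ)⁻¹) * d := by
        apply mul_nonneg _ hd
        push_cast
        rw [sub_nonneg]
        apply inv_le_one_of_one_le₀
        linarith [Nat.cast_nonneg (α := ℝ) n]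
      refine Fin.cases ?_ (fun k => ?_) k <;> refine Fin.cases ?_ (fun l => ?_) l
      · simpa using h0
      · rw [dist_comm]
        simpa [Subtype.dist_eq] using hball (hsub l)
      · simpa [Subtype.dist_eq] using hball (hsub k)
      · simpa using (h2 k l).trans (hr k.pos)

end Mesh

end TupleChain

/-! ### Small singular simplices, modulo two -/

namespace SingularChain

open TupleChain

/-- The singular `n`-simplices of a space. -/
abbrev Sing (n : ℕ) (X : Type) [TopologicalSpace X] : Type :=
  C(stdSimplex ℝ (Fin (n + 1)), X)

/-- The affine simplex in a standard simplex with given vertices. -/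
def aff {m p : ℕ} (w : Fin (m + 1) → stdSimplex ℝ (Fin (p + 1))) :
    Sing m (stdSimplex ℝ (Fin (p + 1))) where
  toFun t := ⟨∑ i, t i • (w i : Fin (p + 1) → ℝ),
    (convex_stdSimplex ℝ _).sum_mem (fun i _ => t.2.1 i) t.2.2 fun i _ => (w i).2⟩
  continuous_toFun := by
    refine Continuous.subtype_mk ?_ _
    refine continuous_finsetSum _ fun i _ =>
      Continuous.smul (f := fun t : stdSimplex ℝ (Fin (m + 1)) => t i)
        (g := fun _ => (w i : Fin (p + 1) → ℝ)) ?_ continuous_const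
    exact (continuous_apply i).comp continuous_subtype_val

lemma aff_coe {m p : ℕ} (w : Fin (m + 1) → stdSimplex ℝ (Fin (p + 1)))
    (t : stdSimplex ℝ (Fin (m + 1))) :
    (aff w t : Fin (p + 1) → ℝ) = ∑ i, t i • (w i : Fin (p + 1) → ℝ) := rfl

lemma aff_val {m p : ℕ} (w : Fin (m + 1) → stdSimplex ℝ (Fin (p + 1)))
    (t : stdSimplex ℝ (Fin (m + 1))) :
    (aff w t).1 = ∑ i, t i • (w i).1 := rfl

lemma aff_comp_aff {k m p : ℕ} (w : Fin (m + 1) → stdSimplex ℝ (Fin (p + 1)))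
    (u : Fin (k + 1) → stdSimplex ℝ (Fin (m + 1))) :
    (aff w).comp (aff u) = aff (aff w ∘ u) := by
  ext t j
  change (aff w (aff u t) : Fin (p + 1) → ℝ) j = (aff (aff w ∘ u) t : Fin (p + 1) → ℝ) j
  simp only [aff_coe, Function.comp_apply, Finset.sum_apply, Pi.smul_apply, smul_eq_mul]
  simp only [Finset.sum_mul, Finset.mul_sum]
  rw [Finset.sum_comm]
  refine Finset.sum_congr rfl fun i _ => Finset.sum_congr rfl fun k _ => ?_
  ring

/-- The vertices of the standard simplex. -/
def vertices (n : ℕ) : Fin (n + 1) → stdSimplex ℝ (Fin (n + 1)) :=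
  fun i => stdSimplex.vertex i

lemma aff_vertices (n : ℕ) : aff (vertices n) = ContinuousMap.id _ := by
  ext t j
  change (aff (vertices n) t : Fin (n + 1) → ℝ) j = (t : Fin (n + 1) → ℝ) j
  simp [aff_coe, vertices, Finset.sum_apply, Pi.single_apply]

lemma aff_comp_vertices {m p : ℕ} (w : Fin (m + 1) → stdSimplex ℝ (Fin (p + 1))) :
    aff w ∘ vertices m = w := by
  funext i
  ext j
  change (aff w (vertices m i) : Fin (p + 1) → ℝ) j = (w i : Fin (p + 1) → ℝ) j
  simp only [aff_coe, Finset.sum_apply, Pi.smul_apply, smul_eq_mul]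
  change ∑ k, (stdSimplex.vertex i : stdSimplex ℝ (Fin (m + 1))) k * _ = _
  simp [Pi.single_apply]

/-- The inclusion of the `i`-th face of the standard simplex. -/
def face (n : ℕ) (i : Fin (n + 2)) : Sing n (stdSimplex ℝ (Fin (n + 2))) where
  toFun := stdSimplex.map i.succAbove
  continuous_toFun := stdSimplex.continuous_map _

lemma face_eq_aff (n : ℕ) (i : Fin (n + 2)) :
    face n i = aff (i.removeNth (vertices (n + 1))) := by
  ext t j
  change (stdSimplex.map i.succAbove t : Fin (n + 2) → ℝ) j = (aff _ t : Fin (n + 2) → ℝ) j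
  rw [aff_coe, stdSimplex.map_coe]
  simp [FunOnFinite.linearMap_apply_apply, Fin.removeNth, vertices, Finset.sum_apply,
    Pi.single_apply, Finset.sum_ite, eq_comm]

/-- The barycenter of an affine simplex. -/
def bary (p n : ℕ) (w : Fin (n + 1) → stdSimplex ℝ (Fin (p + 1))) : stdSimplex ℝ (Fin (p + 1)) :=
  aff w stdSimplex.barycenter

lemma aff_bary {m p n : ℕ} (w : Fin (m + 1) → stdSimplex ℝ (Fin (p + 1)))
    (u : Fin (n + 1) → stdSimplex ℝ (Fin (m + 1))) :
    aff w (bary m n u) = bary p n (aff w ∘ u) := by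
  rw [bary, bary, ← aff_comp_aff]
  rfl

variable {X Y : Type} [TopologicalSpace X] [TopologicalSpace Y]

/-- The boundary of singular chains. -/
def bdry (X : Type) [TopologicalSpace X] (n : ℕ) :
    (Sing (n + 1) X →₀ ZMod 2) →ₗ[ZMod 2] (Sing n X →₀ ZMod 2) :=
  Finsupp.linearCombination (ZMod 2) fun σ =>
    ∑ i : Fin (n + 2), Finsupp.single (σ.comp (face n i)) 1

lemma bdry_single {n : ℕ} (σ : Sing (n + 1) X) :
    bdry X n (Finsupp.single σ 1) =
      ∑ i : Fin (n + 2), Finsupp.single (σ.comp (face n i)) 1 := by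
  simp [bdry]

/-- The map on singular chains induced by a continuous map. -/
def map (f : C(X, Y)) (n : ℕ) : (Sing n X →₀ ZMod 2) →ₗ[ZMod 2] (Sing n Y →₀ ZMod 2) :=
  Finsupp.lmapDomain _ _ fun σ => f.comp σ

lemma map_single (f : C(X, Y)) {n : ℕ} (σ : Sing n X) :
    map f n (Finsupp.single σ 1) = Finsupp.single (f.comp σ) 1 := by
  simp [map]

/-- The singular chain defined by a formal chain in the domain of a singular simplex. -/
def ofTuple {p : ℕ} (σ : Sing p X) (m : ℕ) :
    ((Fin (m + 1) → stdSimplex ℝ (Fin (p + 1))) →₀ ZMod 2) →ₗ[ZMod 2] (Sing m X →₀ ZMod 2) :=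
  Finsupp.lmapDomain _ _ fun w => σ.comp (aff w)

lemma ofTuple_single {p : ℕ} (σ : Sing p X) {m : ℕ}
    (w : Fin (m + 1) → stdSimplex ℝ (Fin (p + 1))) :
    ofTuple σ m (Finsupp.single w 1) = Finsupp.single (σ.comp (aff w)) 1 := by
  simp [ofTuple]

lemma ofTuple_vertices {p : ℕ} (σ : Sing p X) :
    ofTuple σ p (Finsupp.single (vertices p) 1) = Finsupp.single σ 1 := by
  rw [ofTuple_single, aff_vertices, ContinuousMap.comp_id]

lemma ofTuple_comp_aff {p k : ℕ} (σ : Sing p X) (w : Fin (k + 1) → stdSimplex ℝ (Fin (p + 1)))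
    (m : ℕ) (c : (Fin (m + 1) → stdSimplex ℝ (Fin (k + 1))) →₀ ZMod 2) :
    ofTuple (σ.comp (aff w)) m c = ofTuple σ m (TupleChain.map (aff w) (m + 1) c) := by
  have : ofTuple (σ.comp (aff w)) m = (ofTuple σ m).comp (TupleChain.map (aff w) (m + 1)) := by
    apply linear_ext
    intro u
    rw [LinearMap.comp_apply, ofTuple_single, TupleChain.map_single, ofTuple_single,
      ContinuousMap.comp_assoc, aff_comp_aff]
  exact LinearMap.congr_fun this c

lemma bdry_ofTuple {p : ℕ} (σ : Sing p X) (m : ℕ)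
    (c : (Fin (m + 2) → stdSimplex ℝ (Fin (p + 1))) →₀ ZMod 2) :
    bdry X m (ofTuple σ (m + 1) c) = ofTuple σ m (TupleChain.bdry _ (m + 1) c) := by
  have : (bdry X m).comp (ofTuple σ (m + 1)) =
      (ofTuple σ m).comp (TupleChain.bdry _ (m + 1)) := by
    apply linear_ext
    intro w
    simp only [LinearMap.comp_apply, ofTuple_single, TupleChain.bdry_single, map_sum, bdry_single]
    refine Finset.sum_congr rfl fun i _ => ?_
    rw [ContinuousMap.comp_assoc, face_eq_aff, aff_comp_aff]
    congr 3
    conv_rhs => rw [← aff_comp_vertices w]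
    rfl
  exact LinearMap.congr_fun this c

/-- An operation on formal chains, transported to singular chains. -/
def lift (r : ℕ → ℕ) (F : ∀ p m : ℕ,
      ((Fin (m + 1) → stdSimplex ℝ (Fin (p + 1))) →₀ ZMod 2) →ₗ[ZMod 2]
        ((Fin (r m + 1) → stdSimplex ℝ (Fin (p + 1))) →₀ ZMod 2)) (n : ℕ) :
    (Sing n X →₀ ZMod 2) →ₗ[ZMod 2] (Sing (r n) X →₀ ZMod 2) :=
  Finsupp.linearCombination (ZMod 2) fun σ =>
    ofTuple σ (r n) (F n n (Finsupp.single (vertices n) 1))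

/-- The lift is defined by the value of F on the universal simplex alone. Naturality of F under
affine maps moves that value to every affine simplex of the domain of σ, so identities between
formal chains carry over to singular chains. -/
lemma lift_ofTuple (r : ℕ → ℕ) (F : ∀ p m : ℕ,
      ((Fin (m + 1) → stdSimplex ℝ (Fin (p + 1))) →₀ ZMod 2) →ₗ[ZMod 2]
        ((Fin (r m + 1) → stdSimplex ℝ (Fin (p + 1))) →₀ ZMod 2))
    (hF : ∀ (p k m : ℕ) (w : Fin (k + 1) → stdSimplex ℝ (Fin (p + 1))) c,
      TupleChain.map (aff w) _ (F k m c) = F p m (TupleChain.map (aff w) _ c))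
    {p : ℕ} (σ : Sing p X) (n : ℕ) (c : (Fin (n + 1) → stdSimplex ℝ (Fin (p + 1))) →₀ ZMod 2) :
    lift r F n (ofTuple σ n c) = ofTuple σ (r n) (F p n c) := by
  have : (lift r F n).comp (ofTuple σ n) = (ofTuple σ (r n)).comp (F p n) := by
    apply linear_ext
    intro w
    rw [LinearMap.comp_apply, LinearMap.comp_apply, ofTuple_single]
    simp only [lift, Finsupp.linearCombination_single, one_smul]
    rw [ofTuple_comp_aff, hF, TupleChain.map_single, aff_comp_vertices]
  exact LinearMap.congr_fun this c

/-- Barycentric subdivision of singular chains. -/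
def sd (n : ℕ) : (Sing n X →₀ ZMod 2) →ₗ[ZMod 2] (Sing n X →₀ ZMod 2) :=
  lift id (fun p m => TupleChain.sd (bary p) (m + 1)) n

/-- The chain homotopy between barycentric subdivision and the identity. -/
def homot (n : ℕ) : (Sing n X →₀ ZMod 2) →ₗ[ZMod 2] (Sing (n + 1) X →₀ ZMod 2) :=
  lift (· + 1) (fun p m => TupleChain.homot (bary p) (m + 1)) n

lemma sd_ofTuple {p : ℕ} (σ : Sing p X) (n : ℕ)
    (c : (Fin (n + 1) → stdSimplex ℝ (Fin (p + 1))) →₀ ZMod 2) :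
    sd n (ofTuple σ n c) = ofTuple σ n (TupleChain.sd (bary p) (n + 1) c) :=
  lift_ofTuple id _ (fun _ _ _ w _ => map_sd _ (aff w) (fun _ _ => aff_bary w _) _ _) σ n c

lemma homot_ofTuple {p : ℕ} (σ : Sing p X) (n : ℕ)
    (c : (Fin (n + 1) → stdSimplex ℝ (Fin (p + 1))) →₀ ZMod 2) :
    homot n (ofTuple σ n c) = ofTuple σ (n + 1) (TupleChain.homot (bary p) (n + 1) c) :=
  lift_ofTuple (· + 1) _ (fun _ _ _ w _ => map_homot _ (aff w) (fun _ _ => aff_bary w _) _ _) σ n c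

lemma bdry_sd (n : ℕ) (c : Sing (n + 1) X →₀ ZMod 2) :
    bdry X n (sd (n + 1) c) = sd n (bdry X n c) := by
  have : (bdry X n).comp (sd (n + 1)) = (sd n).comp (bdry X n) := by
    apply linear_ext
    intro σ
    rw [LinearMap.comp_apply, LinearMap.comp_apply, ← ofTuple_vertices, sd_ofTuple, bdry_ofTuple,
      bdry_ofTuple, sd_ofTuple, TupleChain.bdry_sd]
  exact LinearMap.congr_fun this c

lemma bdry_homot (n : ℕ) (c : Sing (n + 1) X →₀ ZMod 2) :
    bdry X (n + 1) (homot (n + 1) c) + homot n (bdry X n c) = c + sd (n + 1) c := by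
  have : (bdry X (n + 1)).comp (homot (n + 1)) + (homot n).comp (bdry X n) =
      LinearMap.id + sd (n + 1) := by
    apply linear_ext
    intro σ
    simp only [LinearMap.comp_apply, LinearMap.add_apply, LinearMap.id_apply]
    rw [← ofTuple_vertices, sd_ofTuple, bdry_ofTuple, homot_ofTuple, bdry_ofTuple, homot_ofTuple,
      ← map_add, TupleChain.bdry_homot, map_add]
  exact LinearMap.congr_fun this c

/-- The chains supported on simplices in a subset. -/
def inside (U : Set X) (n : ℕ) : Submodule (ZMod 2) (Sing n X →₀ ZMod 2) :=
  Finsupp.supported (ZMod 2) (ZMod 2) {σ | Set.range σ ⊆ U}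

lemma ofTuple_mem_inside {U : Set X} {p : ℕ} {σ : Sing p X} (h : Set.range σ ⊆ U) (m : ℕ) (c) :
    ofTuple σ m c ∈ inside U m := by
  refine map_supported_le (ofTuple σ m) Set.univ _ (fun w _ => ?_) (by simp)
  rw [ofTuple_single]
  apply Finsupp.single_mem_supported
  rintro _ ⟨t, rfl⟩
  exact h ⟨_, rfl⟩

lemma sd_mem_inside {U : Set X} {n : ℕ} {c : Sing n X →₀ ZMod 2} (hc : c ∈ inside U n) :
    sd n c ∈ inside U n := by
  refine map_supported_le (sd n) _ _ (fun σ hσ => ?_) hc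
  rw [← ofTuple_vertices, sd_ofTuple]
  exact ofTuple_mem_inside hσ _ _

lemma homot_mem_inside {U : Set X} {n : ℕ} {c : Sing n X →₀ ZMod 2} (hc : c ∈ inside U n) :
    homot n c ∈ inside U (n + 1) := by
  refine map_supported_le (homot n) _ _ (fun σ hσ => ?_) hc
  rw [← ofTuple_vertices, homot_ofTuple]
  exact ofTuple_mem_inside hσ _ _

/-- The affine simplices of the iterated subdivision become arbitrarily small. -/
lemma iterate_sd_mem_supported (p n m : ℕ) (d : ℝ) (hd : 0 ≤ d)
    {c : (Fin (n + 1) → stdSimplex ℝ (Fin (p + 1))) →₀ ZMod 2}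
    (hc : c ∈ Finsupp.supported (ZMod 2) (ZMod 2) {w | ∀ i j, dist (w i) (w j) ≤ d}) :
    (TupleChain.sd (bary p) (n + 1))^[m] c ∈ Finsupp.supported (ZMod 2) (ZMod 2)
      {w | ∀ i j, dist (w i) (w j) ≤ (1 - ((n + 1 : ℕ) : ℝ)⁻¹) ^ m * d} := by
  have hr : 0 ≤ 1 - ((n + 1 : ℕ) : ℝ)⁻¹ := by
    rw [sub_nonneg]
    apply inv_le_one_of_one_le₀
    push_cast
    linarith [Nat.cast_nonneg (α := ℝ) n]
  induction m with
  | zero => simpa using hc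
  | succ m ih =>
    rw [Function.iterate_succ_apply']
    refine map_supported_le (TupleChain.sd (bary p) (n + 1)) _ _ (fun w hw => ?_) ih
    refine Finsupp.supported_mono ?_ (sd_mem_supported (bary p) (fun k u => ?_) _ (by positivity)
      (n + 1) w hw)
    · rintro w' ⟨-, h⟩ i j
      rw [pow_succ', mul_assoc]
      exact h i j
    · rw [bary, aff_val]
      refine Finset.sum_congr rfl fun i _ => ?_
      rw [show (stdSimplex.barycenter : stdSimplex ℝ (Fin (k + 1))) i = _ from
        stdSimplex.barycenter_apply i, Fintype.card_fin, Nat.cast_succ]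

/-- For a single simplex, the preimages of U and W have a Lebesgue number, which the mesh of the
iterated subdivision eventually undercuts. Asking for all large m lets the bounds for two summands
be merged into their maximum. -/
lemma exists_iterate_sd_mem (U W : Set X) (hU : IsOpen U) (hW : IsOpen W) (h : U ∪ W = Set.univ)
    {n : ℕ} (c : Sing n X →₀ ZMod 2) :
    ∃ m₀, ∀ m ≥ m₀, (sd n)^[m] c ∈ inside U n ⊔ inside W n := by
  induction c using Finsupp.induction_linear with
  | zero => exact ⟨0, fun m _ => by rw [Function.iterate_fixed (map_zero _)]; exact zero_mem _⟩
  | add c c' h1 h2 =>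
    obtain ⟨m₁, h1⟩ := h1
    obtain ⟨m₂, h2⟩ := h2
    refine ⟨max m₁ m₂, fun m hm => ?_⟩
    rw [iterate_map_add]
    exact add_mem (h1 m (le_of_max_le_left hm)) (h2 m (le_of_max_le_right hm))
  | single σ a =>
    have hcov : (Set.univ : Set (stdSimplex ℝ (Fin (n + 1)))) ⊆
        ⋃ b : Bool, (cond b (σ ⁻¹' U) (σ ⁻¹' W)) := by
      intro t _
      rcases (h ▸ Set.mem_univ (σ t) : σ t ∈ U ∪ W) with ht | ht
      · exact Set.mem_iUnion.2 ⟨true, ht⟩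
      · exact Set.mem_iUnion.2 ⟨false, ht⟩
    obtain ⟨δ, hδ, hball⟩ := lebesgue_number_lemma_of_metric isCompact_univ (fun b => by
      cases b
      exacts [hW.preimage σ.continuous, hU.preimage σ.continuous]) hcov
    have hr0 : 0 ≤ 1 - ((n + 1 : ℕ) : ℝ)⁻¹ := by
      rw [sub_nonneg]
      apply inv_le_one_of_one_le₀
      push_cast
      linarith [Nat.cast_nonneg (α := ℝ) n]
    have hr1 : 1 - ((n + 1 : ℕ) : ℝ)⁻¹ < 1 := by
      have : (0 : ℝ) < ((n + 1 : ℕ) : ℝ)⁻¹ := by positivity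
      linarith
    obtain ⟨d, hd0, hd⟩ : ∃ d : ℝ, 0 ≤ d ∧ ∀ i j, dist (vertices n i) (vertices n j) ≤ d := by
      refine ⟨Metric.diam (Set.univ : Set (stdSimplex ℝ (Fin (n + 1)))), Metric.diam_nonneg,
        fun i j => Metric.dist_le_diam_of_mem isCompact_univ.isBounded trivial trivial⟩
    have hlim := (tendsto_pow_atTop_nhds_zero_of_lt_one hr0 hr1).mul_const d
    rw [zero_mul] at hlim
    obtain ⟨m₀, hm₀⟩ := Filter.eventually_atTop.1 (hlim.eventually (gt_mem_nhds hδ))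
    refine ⟨m₀, fun m hm => ?_⟩
    have e : (Finsupp.single σ a : Sing n X →₀ ZMod 2) = a • Finsupp.single σ 1 := by simp
    have hiter : ∀ (k : ℕ) (c : (Fin (n + 1) → stdSimplex ℝ (Fin (n + 1))) →₀ ZMod 2),
        (sd n)^[k] (ofTuple σ n c) = ofTuple σ n ((TupleChain.sd (bary n) (n + 1))^[k] c) := by
      intro k
      induction k with
      | zero => intro c; rfl
      | succ k ih => intro c; rw [Function.iterate_succ_apply, sd_ofTuple, ih]; rfl
    have hsmul : (sd n)^[m] (a • (Finsupp.single σ 1 : Sing n X →₀ ZMod 2)) =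
        a • (sd n)^[m] (Finsupp.single σ 1) := by
      rw [← Module.End.pow_apply, map_smul, Module.End.pow_apply]
    rw [e, hsmul, ← ofTuple_vertices, hiter]
    refine Submodule.smul_mem _ _ ?_
    refine map_supported_le (ofTuple σ n) _ _ (fun w hw => ?_)
      (iterate_sd_mem_supported n n m d hd0 (Finsupp.single_mem_supported _ _ hd))
    rw [ofTuple_single]
    obtain ⟨b, hb⟩ := hball (w 0) trivial
    have hsub : Set.range (aff w) ⊆ Metric.ball (w 0) δ := by
      rintro _ ⟨t, rfl⟩
      rw [Metric.mem_ball, Subtype.dist_eq, aff_val, ← Metric.mem_ball]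
      refine (convex_ball _ _).sum_mem (fun i _ => t.2.1 i) t.2.2 fun i _ => ?_
      rw [Metric.mem_ball, ← Subtype.dist_eq]
      exact (hw i 0).trans_lt (hm₀ m hm)
    have hrange : Set.range (σ.comp (aff w)) ⊆ cond b U W := by
      rintro _ ⟨t, rfl⟩
      have := hb (hsub ⟨t, rfl⟩)
      cases b <;> exact this
    cases b
    · exact Submodule.mem_sup_right (Finsupp.single_mem_supported _ _ hrange)
    · exact Submodule.mem_sup_left (Finsupp.single_mem_supported _ _ hrange)

lemma mem_sup_map {α β : Type*} (f : (α →₀ ZMod 2) →ₗ[ZMod 2] (β →₀ ZMod 2))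
    {A B : Submodule (ZMod 2) (α →₀ ZMod 2)} {A' B' : Submodule (ZMod 2) (β →₀ ZMod 2)}
    (hA : ∀ c ∈ A, f c ∈ A') (hB : ∀ c ∈ B, f c ∈ B') {c : α →₀ ZMod 2} (hc : c ∈ A ⊔ B) :
    f c ∈ A' ⊔ B' := by
  obtain ⟨a, ha, b, hb, rfl⟩ := Submodule.mem_sup.1 hc
  rw [map_add]
  exact add_mem (Submodule.mem_sup_left (hA a ha)) (Submodule.mem_sup_right (hB b hb))

/-- A 0-simplex has a single point as its image, so it needs no subdivision. -/
lemma mem_small_zero (U W : Set X) (h : U ∪ W = Set.univ) (c : Sing 0 X →₀ ZMod 2) :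
    c ∈ inside U 0 ⊔ inside W 0 := by
  refine map_supported_le (LinearMap.id : (Sing 0 X →₀ ZMod 2) →ₗ[ZMod 2] _) Set.univ _
    (fun σ _ => ?_) (by simp)
  have key : Set.range σ ⊆ {σ default} := by
    rintro _ ⟨t, rfl⟩
    rw [Subsingleton.elim t default]
    rfl
  rcases (h ▸ Set.mem_univ (σ default) : σ default ∈ U ∪ W) with ht | ht
  · exact Submodule.mem_sup_left (Finsupp.single_mem_supported _ _
      (key.trans (Set.singleton_subset_iff.2 ht)))
  · exact Submodule.mem_sup_right (Finsupp.single_mem_supported _ _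
      (key.trans (Set.singleton_subset_iff.2 ht)))

/-- The theorem of small simplices: a chain with small boundary is small modulo boundaries. -/
theorem exists_add_bdry_mem (U W : Set X) (hU : IsOpen U) (hW : IsOpen W) (h : U ∪ W = Set.univ)
    {n : ℕ} (c : Sing (n + 1) X →₀ ZMod 2) (hc : bdry X n c ∈ inside U n ⊔ inside W n) :
    ∃ e, c + bdry X (n + 1) e ∈ inside U (n + 1) ⊔ inside W (n + 1) := by
  obtain ⟨m, hm⟩ := exists_iterate_sd_mem U W hU hW h c
  replace hm := hm m le_rfl
  -- Induction on the number of subdivisions needed. One subdivision changes c by ∂Tc + T∂c, where T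
  -- is the homotopy; T∂c is already small, because ∂c is and T preserves the chains inside each
  -- open set.
  induction m generalizing c with
  | zero => exact ⟨0, by simpa using hm⟩
  | succ m ih =>
    rw [Function.iterate_succ_apply] at hm
    obtain ⟨e, he⟩ := ih (sd (n + 1) c) (by
      rw [bdry_sd]
      exact mem_sup_map _ (fun _ => sd_mem_inside) (fun _ => sd_mem_inside) hc) hm
    refine ⟨homot (n + 1) c + e, ?_⟩
    have h1 := bdry_homot n c
    have h2 : homot n (bdry X n c) ∈ inside U (n + 1) ⊔ inside W (n + 1) :=
      mem_sup_map _ (fun _ => homot_mem_inside) (fun _ => homot_mem_inside) hc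
    have h3 : c + bdry X (n + 1) (homot (n + 1) c + e) =
        (sd (n + 1) c + bdry X (n + 1) e) + homot n (bdry X n c) := by
      have h4 : c + sd (n + 1) c + (bdry X (n + 1) (homot (n + 1) c) +
          homot n (bdry X n c)) = 0 := by rw [h1, add_self_zero]
      rw [map_add, ← sub_eq_zero, ← h4]
      have h5 := add_self_zero (sd (n + 1) c)
      have h6 := add_self_zero (homot n (bdry X n c))
      rw [← sub_eq_zero]
      calc _ = -((sd (n + 1) c + sd (n + 1) c) +
            (homot n (bdry X n c) + homot n (bdry X n c))) := by abel
        _ = 0 := by rw [h5, h6, add_zero, neg_zero]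
    rw [h3]
    exact add_mem he h2

end SingularChain

/-! ### The Mayer–Vietoris sequence -/

namespace SingularChain

open AlgebraicTopology Limits Simplicial

/-- The singular chain complex over the field with two elements. -/
abbrev sc : TopCat.{0} ⥤ ChainComplex (ModuleCat.{0} (ZMod 2)) ℕ :=
  (singularChainComplexFunctor (ModuleCat.{0} (ZMod 2))).obj (ModuleCat.of (ZMod 2) (ZMod 2))

/-- The generator of the singular chain complex given by a singular simplex. -/
def gen {n : ℕ} {X : TopCat.{0}} (σ : Sing n X) : (sc.obj X).X n :=
  ((TopCat.toSSet.obj X).ιChainComplex (R := ModuleCat.of (ZMod 2) (ZMod 2))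
    ((TopCat.toSSetObjEquiv X (.op ⦋n⦌)).symm σ)).hom (1 : ZMod 2)

/-- The identification of explicit chains with the chains of the singular chain complex. -/
def toSc (n : ℕ) (X : TopCat.{0}) : (Sing n X →₀ ZMod 2) →ₗ[ZMod 2] (sc.obj X).X n :=
  Finsupp.linearCombination (ZMod 2) gen

/-- The inverse of `toSc`. -/
def ofSc (n : ℕ) (X : TopCat.{0}) : (sc.obj X).X n ⟶ ModuleCat.of (ZMod 2) (Sing n X →₀ ZMod 2) :=
  ((TopCat.toSSet.obj X).isColimitChainComplexXCofan (ModuleCat.of (ZMod 2) (ZMod 2)) n).desc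
    (Cofan.mk (ModuleCat.of (ZMod 2) (Sing n X →₀ ZMod 2)) fun x =>
      ModuleCat.ofHom (Finsupp.lsingle (TopCat.toSSetObjEquiv X (.op ⦋n⦌) x)))

lemma toSc_single {n : ℕ} {X : TopCat.{0}} (σ : Sing n X) :
    toSc n X (Finsupp.single σ 1) = gen σ := by
  simp [toSc]

lemma ι_ofSc {n : ℕ} {X : TopCat.{0}} (x : (TopCat.toSSet.obj X) _⦋n⦌) :
    (TopCat.toSSet.obj X).ιChainComplex x ≫ ofSc n X =
      ModuleCat.ofHom (Finsupp.lsingle (TopCat.toSSetObjEquiv X (.op ⦋n⦌) x)) :=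
  ((TopCat.toSSet.obj X).isColimitChainComplexXCofan (ModuleCat.of (ZMod 2) (ZMod 2)) n).fac _ ⟨x⟩

lemma ofSc_gen {n : ℕ} {X : TopCat.{0}} (σ : Sing n X) :
    (ofSc n X).hom (gen σ) = Finsupp.single σ 1 := by
  have := congrArg (fun f => f.hom (1 : ZMod 2))
    (ι_ofSc ((TopCat.toSSetObjEquiv X (.op ⦋n⦌)).symm σ))
  refine this.trans ?_
  simp

lemma ofSc_toSc {n : ℕ} {X : TopCat.{0}} (c : Sing n X →₀ ZMod 2) :
    (ofSc n X).hom (toSc n X c) = c := by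
  have : (ofSc n X).hom.comp (toSc n X) = LinearMap.id := by
    apply TupleChain.linear_ext
    intro σ
    rw [LinearMap.comp_apply, toSc_single, ofSc_gen]
    rfl
  exact LinearMap.congr_fun this c

lemma toSc_ofSc {n : ℕ} {X : TopCat.{0}} (c : (sc.obj X).X n) :
    toSc n X ((ofSc n X).hom c) = c := by
  have : ofSc n X ≫ ModuleCat.ofHom (toSc n X) = 𝟙 _ := by
    apply SSet.chainComplex_hom_ext
    intro x
    refine (Category.assoc _ _ _).symm.trans ((congrArg (· ≫ _) (ι_ofSc x)).trans ?_)
    ext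
    refine (toSc_single _).trans ?_
    rw [gen, Equiv.symm_apply_apply]
    rfl
  exact LinearMap.congr_fun (congrArg ModuleCat.Hom.hom this) c

lemma toSc_injective (n : ℕ) (X : TopCat.{0}) : Function.Injective (toSc n X) :=
  Function.LeftInverse.injective ofSc_toSc

lemma toSc_surjective (n : ℕ) (X : TopCat.{0}) : Function.Surjective (toSc n X) :=
  Function.RightInverse.surjective toSc_ofSc

lemma d_toSc {n : ℕ} {X : TopCat.{0}} (c : Sing (n + 1) X →₀ ZMod 2) :
    ((sc.obj X).d (n + 1) n).hom (toSc (n + 1) X c) = toSc n X (bdry X n c) := by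
  have : ((sc.obj X).d (n + 1) n).hom.comp (toSc (n + 1) X) = (toSc n X).comp (bdry X n) := by
    apply TupleChain.linear_ext
    intro σ
    rw [LinearMap.comp_apply, LinearMap.comp_apply, toSc_single, bdry_single, map_sum]
    have := congrArg (fun f => f.hom (1 : ZMod 2))
      (SSet.ιChainComplex_d (TopCat.toSSet.obj X) (R := ModuleCat.of (ZMod 2) (ZMod 2))
        ((TopCat.toSSetObjEquiv X (.op ⦋n + 1⦌)).symm σ))
    refine this.trans ?_
    simp only [ModuleCat.hom_sum, LinearMap.sum_apply]
    refine Finset.sum_congr rfl fun i _ => ?_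
    rw [toSc_single]
    -- The signs of the alternating sum of faces are invisible modulo two.
    have hsign : ∀ (k : ℕ) (y : (sc.obj X).X n), ((-1 : ℤ) ^ k) • y = y := by
      intro k y
      rcases neg_one_pow_eq_or ℤ k with h | h <;> rw [h]
      · rw [one_smul]
      · rw [neg_smul, one_smul]
        exact neg_eq_of_add_eq_zero_left (TupleChain.add_self_zero y)
    exact hsign _ _
  exact LinearMap.congr_fun this c

lemma map_toSc {n : ℕ} {X Y : TopCat.{0}} (f : X ⟶ Y) (c : Sing n X →₀ ZMod 2) :
    ((sc.map f).f n).hom (toSc n X c) = toSc n Y (map f.hom n c) := by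
  have : ((sc.map f).f n).hom.comp (toSc n X) = (toSc n Y).comp (map f.hom n) := by
    apply TupleChain.linear_ext
    intro σ
    rw [LinearMap.comp_apply, LinearMap.comp_apply, toSc_single, map_single, toSc_single]
    exact congrArg (fun f => ModuleCat.Hom.hom f (1 : ZMod 2))
      (SSet.ι_chainComplexMap_f (X := TopCat.toSSet.obj X) (Y := TopCat.toSSet.obj Y)
        (f := TopCat.toSSet.map f) (R := ModuleCat.of (ZMod 2) (ZMod 2))
        (x := (TopCat.toSSetObjEquiv X (.op ⦋n⦌)).symm σ))
  exact LinearMap.congr_fun this c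

end SingularChain

namespace SingularChain

open AlgebraicTopology Limits
open TupleChain (map_supported_le)

lemma eq_of_add_eq_zero {M : Type*} [AddCommGroup M] [Module (ZMod 2) M] {x y : M}
    (h : x + y = 0) : x = y := by
  rw [← add_zero x, ← TupleChain.add_self_zero y, ← add_assoc, h, zero_add]

lemma map_injective {X Y : Type} [TopologicalSpace X] [TopologicalSpace Y] (f : C(X, Y))
    (hf : Function.Injective f) (n : ℕ) : Function.Injective (map f n) :=
  Finsupp.mapDomain_injective fun σ τ h => by
    ext t
    exact hf (DFunLike.congr_fun h t)

/-- A simplex with image in the range factors through f as a map of sets; the embedding property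
makes the factor continuous. -/
lemma mem_inside_iff {X Y : Type} [TopologicalSpace X] [TopologicalSpace Y] (f : C(X, Y))
    (hf : Topology.IsEmbedding f) (n : ℕ) (c : Sing n Y →₀ ZMod 2) :
    c ∈ inside (Set.range f) n ↔ ∃ u, map f n u = c := by
  constructor
  · intro hc
    refine map_supported_le (LinearMap.id : (Sing n Y →₀ ZMod 2) →ₗ[ZMod 2] _) _
      (LinearMap.range (map f n)) (fun σ hσ => ?_) hc
    choose g hg using fun t => hσ ⟨t, rfl⟩
    refine ⟨Finsupp.single ⟨g, ?_⟩ 1, ?_⟩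
    · rw [hf.continuous_iff]
      convert σ.continuous using 1
      exact funext hg
    · rw [map_single]
      congr 1
      ext t
      exact hg t
  · rintro ⟨u, rfl⟩
    refine map_supported_le (map f n) Set.univ _ (fun σ _ => ?_) (by simp)
    rw [map_single]
    apply Finsupp.single_mem_supported
    rintro _ ⟨t, rfl⟩
    exact ⟨_, rfl⟩

/-- Two open subspaces covering a space, together with their intersection, up to isomorphism. -/
structure OpenCover (P A B X : TopCat.{0}) where
  /-- the inclusion of the intersection into the first subspace -/
  p : P ⟶ A
  /-- the inclusion of the intersection into the second subspace -/
  q : P ⟶ B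
  /-- the inclusion of the first subspace -/
  a : A ⟶ X
  /-- the inclusion of the second subspace -/
  b : B ⟶ X
  comm : p ≫ a = q ≫ b
  open_a : Topology.IsOpenEmbedding a
  open_b : Topology.IsOpenEmbedding b
  embedding : Topology.IsEmbedding (p ≫ a)
  cover : Set.range a ∪ Set.range b = Set.univ
  inter : Set.range (p ≫ a) = Set.range a ∩ Set.range b

namespace OpenCover

variable {P A B X : TopCat.{0}} (S : OpenCover P A B X)

/-- The inclusion of the chains of the intersection, into both subspaces. -/
def f : sc.obj P ⟶ sc.obj A ⊞ sc.obj B := biprod.lift (sc.map S.p) (sc.map S.q)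

/-- The sum of the inclusions of the chains of the two subspaces. -/
def g : sc.obj A ⊞ sc.obj B ⟶ sc.obj X := biprod.desc (sc.map S.a) (sc.map S.b)

lemma f_g : S.f ≫ S.g = 0 := by
  rw [f, g, biprod.lift_desc, ← Functor.map_comp, ← Functor.map_comp, S.comm]
  ext n x
  exact TupleChain.add_self_zero _

/-- The complex of small chains. -/
abbrev Small : ChainComplex (ModuleCat.{0} (ZMod 2)) ℕ := cokernel S.f

/-- The inclusion of small chains. -/
def ψ : S.Small ⟶ sc.obj X := cokernel.desc S.f S.g S.f_g

lemma π_ψ : cokernel.π S.f ≫ S.ψ = S.g := cokernel.π_desc _ _ _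

lemma biprod_eq {K L : ChainComplex (ModuleCat.{0} (ZMod 2)) ℕ} {n : ℕ} (x : (K ⊞ L).X n) :
    x = ((biprod.inl : K ⟶ K ⊞ L).f n).hom (((biprod.fst : K ⊞ L ⟶ K).f n).hom x) +
      ((biprod.inr : L ⟶ K ⊞ L).f n).hom (((biprod.snd : K ⊞ L ⟶ L).f n).hom x) := by
  have := congrArg (fun φ : K ⊞ L ⟶ K ⊞ L => (φ.f n).hom x) (biprod.total (X := K) (Y := L))
  exact this.symm

lemma g_apply {n : ℕ} (x : (sc.obj A ⊞ sc.obj B).X n) :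
    (S.g.f n).hom x =
      ((sc.map S.a).f n).hom (((biprod.fst : sc.obj A ⊞ sc.obj B ⟶ _).f n).hom x) +
      ((sc.map S.b).f n).hom (((biprod.snd : sc.obj A ⊞ sc.obj B ⟶ _).f n).hom x) := by
  have : S.g = biprod.fst ≫ sc.map S.a + biprod.snd ≫ sc.map S.b := by
    rw [g, biprod.desc_eq]
  rw [this]
  rfl

lemma fst_f {n : ℕ} (y : (sc.obj P).X n) :
    ((biprod.fst : sc.obj A ⊞ sc.obj B ⟶ _).f n).hom ((S.f.f n).hom y) =
      ((sc.map S.p).f n).hom y :=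
  congrArg (fun φ : sc.obj P ⟶ sc.obj A => (φ.f n).hom y) (biprod.lift_fst _ _)

lemma snd_f {n : ℕ} (y : (sc.obj P).X n) :
    ((biprod.snd : sc.obj A ⊞ sc.obj B ⟶ _).f n).hom ((S.f.f n).hom y) =
      ((sc.map S.q).f n).hom y :=
  congrArg (fun φ : sc.obj P ⟶ sc.obj B => (φ.f n).hom y) (biprod.lift_snd _ _)

lemma sc_map_injective {X Y : TopCat.{0}} (f : X ⟶ Y) (hf : Function.Injective f) (n : ℕ) :
    Function.Injective ((sc.map f).f n).hom := by
  intro x y h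
  obtain ⟨x, rfl⟩ := toSc_surjective n _ x
  obtain ⟨y, rfl⟩ := toSc_surjective n _ y
  rw [map_toSc, map_toSc] at h
  rw [map_injective f.hom hf n (toSc_injective _ _ h)]

lemma injective_p : Function.Injective S.p := by
  have h : Function.Injective (S.a ∘ S.p) := S.embedding.injective
  exact h.of_comp

instance mono_f : Mono S.f := by
  have : Mono (sc.map S.p) := by
    apply +allowSynthFailures HomologicalComplex.mono_of_mono_f
    intro n
    rw [ModuleCat.mono_iff_injective]
    exact sc_map_injective S.p S.injective_p n
  exact mono_of_mono_fac (biprod.lift_fst _ _ : S.f ≫ biprod.fst = sc.map S.p)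

/-- A chain coming from both A and B is supported on simplices lying in both ranges, hence in the
range of P. Injectivity on chains then identifies the preimages in A and B. -/
lemma exists_of_g_eq_zero {n : ℕ} (x : (sc.obj A ⊞ sc.obj B).X n) (hx : (S.g.f n).hom x = 0) :
    ∃ y, (S.f.f n).hom y = x := by
  rw [g_apply] at hx
  obtain ⟨u, hu⟩ := toSc_surjective n _ (((biprod.fst : sc.obj A ⊞ sc.obj B ⟶ _).f n).hom x)
  obtain ⟨w, hw⟩ := toSc_surjective n _ (((biprod.snd : sc.obj A ⊞ sc.obj B ⟶ _).f n).hom x)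
  rw [← hu, ← hw, map_toSc, map_toSc, ← map_add, ← map_zero (toSc n X)] at hx
  replace hx := toSc_injective _ _ hx
  have hx' : map S.a.hom n u = map S.b.hom n w :=
    eq_of_add_eq_zero hx
  have h1 : map S.a.hom n u ∈ inside (Set.range (S.p ≫ S.a).hom) n := by
    have : Set.range (S.p ≫ S.a).hom = Set.range S.a.hom ∩ Set.range S.b.hom := S.inter
    rw [this, inside]
    have e : {σ : Sing n X | Set.range σ ⊆ Set.range S.a.hom ∩ Set.range S.b.hom} =
        {σ : Sing n X | Set.range σ ⊆ Set.range S.a.hom} ∩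
          {σ : Sing n X | Set.range σ ⊆ Set.range S.b.hom} := by
      ext σ
      exact Set.subset_inter_iff
    rw [e, Finsupp.supported_inter]
    refine ⟨(mem_inside_iff S.a.hom S.open_a.isEmbedding n _).2 ⟨u, rfl⟩, ?_⟩
    rw [hx']
    exact (mem_inside_iff S.b.hom S.open_b.isEmbedding n _).2 ⟨w, rfl⟩
  obtain ⟨y, hy⟩ := (mem_inside_iff (S.p ≫ S.a).hom S.embedding n _).1 h1
  have comp : ∀ {X Y Z : TopCat.{0}} (f : X ⟶ Y) (g : Y ⟶ Z) (c : Sing n X →₀ ZMod 2),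
      map (f ≫ g).hom n c = map g.hom n (map f.hom n c) := by
    intro X Y Z f g c
    simp only [map, Finsupp.lmapDomain_apply, ← Finsupp.mapDomain_comp]
    rfl
  have hyu : map S.p.hom n y = u := by
    rw [comp] at hy
    exact map_injective S.a.hom S.open_a.injective n hy
  have hyw : map S.q.hom n y = w := by
    rw [S.comm, comp, hx'] at hy
    exact map_injective S.b.hom S.open_b.injective n hy
  refine ⟨toSc n P y, ?_⟩
  rw [biprod_eq x, biprod_eq ((S.f.f n).hom _), fst_f, snd_f, map_toSc, map_toSc, hyu, hyw, hu, hw]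

lemma π_surjective (n : ℕ) : Function.Surjective ((cokernel.π S.f).f n).hom := by
  rw [← ModuleCat.epi_iff_surjective]
  infer_instance

lemma g_eq_ψ {n : ℕ} (x : (sc.obj A ⊞ sc.obj B).X n) :
    (S.ψ.f n).hom (((cokernel.π S.f).f n).hom x) = (S.g.f n).hom x :=
  congrArg (fun φ : sc.obj A ⊞ sc.obj B ⟶ sc.obj X => (φ.f n).hom x) S.π_ψ

instance mono_ψ : Mono S.ψ := by
  apply +allowSynthFailures HomologicalComplex.mono_of_mono_f
  intro n
  rw [ModuleCat.mono_iff_injective]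
  refine (injective_iff_map_eq_zero (S.ψ.f n).hom).2 fun z hz => ?_
  obtain ⟨x, rfl⟩ := S.π_surjective n z
  rw [g_eq_ψ] at hz
  obtain ⟨y, rfl⟩ := S.exists_of_g_eq_zero x hz
  exact congrArg (fun φ : sc.obj P ⟶ S.Small => (φ.f n).hom y) (cokernel.condition S.f)

lemma mem_range_ψ {n : ℕ} (c : Sing n X →₀ ZMod 2) :
    (∃ z, (S.ψ.f n).hom z = toSc n X c) ↔
      c ∈ inside (Set.range S.a) n ⊔ inside (Set.range S.b) n := by
  constructor
  · rintro ⟨z, hz⟩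
    obtain ⟨x, rfl⟩ := S.π_surjective n z
    rw [g_eq_ψ, g_apply] at hz
    obtain ⟨u, hu⟩ := toSc_surjective n _ (((biprod.fst : sc.obj A ⊞ sc.obj B ⟶ _).f n).hom x)
    obtain ⟨w, hw⟩ := toSc_surjective n _ (((biprod.snd : sc.obj A ⊞ sc.obj B ⟶ _).f n).hom x)
    rw [← hu, ← hw, map_toSc, map_toSc, ← map_add] at hz
    rw [← toSc_injective _ _ hz]
    exact add_mem
      (Submodule.mem_sup_left ((mem_inside_iff S.a.hom S.open_a.isEmbedding n _).2 ⟨u, rfl⟩))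
      (Submodule.mem_sup_right ((mem_inside_iff S.b.hom S.open_b.isEmbedding n _).2 ⟨w, rfl⟩))
  · intro hc
    obtain ⟨c₁, h1, c₂, h2, rfl⟩ := Submodule.mem_sup.1 hc
    obtain ⟨u, rfl⟩ := (mem_inside_iff S.a.hom S.open_a.isEmbedding n _).1 h1
    obtain ⟨w, rfl⟩ := (mem_inside_iff S.b.hom S.open_b.isEmbedding n _).1 h2
    refine ⟨((cokernel.π S.f).f n).hom (((biprod.inl : _ ⟶ sc.obj A ⊞ sc.obj B).f n).hom
      (toSc n A u) + ((biprod.inr : _ ⟶ sc.obj A ⊞ sc.obj B).f n).hom (toSc n B w)), ?_⟩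
    rw [g_eq_ψ, map_add, map_add]
    congr 1
    · rw [← map_toSc]
      exact congrArg (fun φ : sc.obj A ⟶ sc.obj X => (φ.f n).hom (toSc n A u))
        (biprod.inl_desc _ _ : biprod.inl ≫ S.g = _)
    · rw [← map_toSc]
      exact congrArg (fun φ : sc.obj B ⟶ sc.obj X => (φ.f n).hom (toSc n B w))
        (biprod.inr_desc _ _ : biprod.inr ≫ S.g = _)

/-- This is the theorem of small simplices in homological form: a cycle modulo small chains is a
chain with small boundary, and such a chain is a boundary modulo small chains. In degree 0 every
chain is small. -/
lemma exactAt_cokernel_ψ (n : ℕ) : (cokernel S.ψ).ExactAt n := by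
  have hsurj : ∀ n, Function.Surjective ((cokernel.π S.ψ).f n).hom := fun n => by
    rw [← ModuleCat.epi_iff_surjective]
    infer_instance
  have hψ : ∀ n z, ((cokernel.π S.ψ).f n).hom ((S.ψ.f n).hom z) = 0 := fun n z =>
    congrArg (fun φ : S.Small ⟶ cokernel S.ψ => (φ.f n).hom z) (cokernel.condition S.ψ)
  have hex : (ShortComplex.mk _ _ (cokernel.condition S.ψ)).Exact :=
    ShortComplex.exact_cokernel _
  have hker : ∀ n c, ((cokernel.π S.ψ).f n).hom c = 0 → ∃ z, (S.ψ.f n).hom z = c := by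
    intro n
    have := hex.map (HomologicalComplex.eval (ModuleCat.{0} (ZMod 2)) (ComplexShape.down ℕ) n)
    exact (ShortComplex.moduleCat_exact_iff _).1 this
  have hd : ∀ i j c, ((cokernel S.ψ).d i j).hom (((cokernel.π S.ψ).f i).hom c) =
      ((cokernel.π S.ψ).f j).hom (((sc.obj X).d i j).hom c) := fun i j c =>
    congrArg (fun φ => ModuleCat.Hom.hom φ c) ((cokernel.π S.ψ).comm i j)
  cases n with
  | zero =>
    rw [HomologicalComplex.exactAt_iff' _ 1 0 0 (by simp) (by simp),
      ShortComplex.moduleCat_exact_iff]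
    intro z _
    refine ⟨0, ?_⟩
    obtain ⟨c, rfl⟩ := hsurj 0 z
    obtain ⟨c, rfl⟩ := toSc_surjective 0 _ c
    obtain ⟨y, hy⟩ := (S.mem_range_ψ c).2 (mem_small_zero _ _ S.cover c)
    rw [← hy, hψ, map_zero]
    rfl
  | succ n =>
    rw [HomologicalComplex.exactAt_iff' _ (n + 2) (n + 1) n (by simp) (by simp),
      ShortComplex.moduleCat_exact_iff]
    intro z hz
    obtain ⟨c, rfl⟩ := hsurj (n + 1) z
    obtain ⟨c, rfl⟩ := toSc_surjective (n + 1) _ c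
    obtain ⟨y, hy⟩ := hker n _ ((hd (n + 1) n _).symm.trans hz)
    rw [d_toSc] at hy
    obtain ⟨e, he⟩ := exists_add_bdry_mem _ _ S.open_a.isOpen_range S.open_b.isOpen_range
      S.cover c ((S.mem_range_ψ _).1 ⟨y, hy⟩)
    obtain ⟨y', hy'⟩ := (S.mem_range_ψ _).2 he
    refine ⟨((cokernel.π S.ψ).f (n + 2)).hom (toSc (n + 2) X e), (hd (n + 2) (n + 1) _).trans ?_⟩
    rw [d_toSc]
    have h0 := hψ (n + 1) y'
    rw [hy', map_add, map_add] at h0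
    exact (eq_of_add_eq_zero h0).symm

/-- In the long exact sequence of small chains inside all chains, the homology of the quotient
vanishes. -/
instance quasiIso_ψ (n : ℕ) : IsIso (HomologicalComplex.homologyMap S.ψ n) := by
  have hS : (ShortComplex.mk _ _ (cokernel.condition S.ψ)).ShortExact :=
    { exact := ShortComplex.exact_cokernel _ }
  have h0 : ∀ k, IsZero ((cokernel S.ψ).homology k) := fun k =>
    (S.exactAt_cokernel_ψ k).isZero_homology
  have : Mono (HomologicalComplex.homologyMap S.ψ n) :=
    (hS.homology_exact₁ (n + 1) n (by simp)).mono_g ((h0 _).eq_of_src _ _)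
  have : Epi (HomologicalComplex.homologyMap S.ψ n) :=
    (hS.homology_exact₂ n).epi_f ((h0 _).eq_of_tgt _ _)
  exact isIso_of_mono_of_epi _

/-- The map on homology induced by a continuous map, as a linear map. -/
abbrev _root_.SingularChain.hsc {X Y : TopCat.{0}} (i : ℕ) (f : X ⟶ Y) :
    (sc.obj X).homology i →ₗ[ZMod 2] (sc.obj Y).homology i :=
  (HomologicalComplex.homologyMap (sc.map f) i).hom

lemma shortExact : (ShortComplex.mk _ _ (cokernel.condition S.f)).ShortExact :=
  { exact := ShortComplex.exact_cokernel _ }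

lemma homologyMap_biprod_eq (i : ℕ) (z : (sc.obj A ⊞ sc.obj B).homology i) :
    z = (HomologicalComplex.homologyMap (biprod.inl : sc.obj A ⟶ sc.obj A ⊞ sc.obj B) i).hom
        ((HomologicalComplex.homologyMap (biprod.fst : sc.obj A ⊞ sc.obj B ⟶ sc.obj A) i).hom z) +
      (HomologicalComplex.homologyMap (biprod.inr : sc.obj B ⟶ sc.obj A ⊞ sc.obj B) i).hom
        ((HomologicalComplex.homologyMap (biprod.snd : sc.obj A ⊞ sc.obj B ⟶ sc.obj B) i).hom z) := by
  have h := congrArg (fun φ => HomologicalComplex.homologyMap φ i)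
    (biprod.total (X := sc.obj A) (Y := sc.obj B))
  simp only [HomologicalComplex.homologyMap_add, HomologicalComplex.homologyMap_comp,
    HomologicalComplex.homologyMap_id] at h
  exact (congrArg (fun φ => ModuleCat.Hom.hom φ z) h).symm

lemma homologyMap_g (i : ℕ) (z : (sc.obj A ⊞ sc.obj B).homology i) :
    (HomologicalComplex.homologyMap S.g i).hom z =
      hsc i S.a
        ((HomologicalComplex.homologyMap (biprod.fst : sc.obj A ⊞ sc.obj B ⟶ sc.obj A) i).hom z) +
      hsc i S.b
        ((HomologicalComplex.homologyMap (biprod.snd : sc.obj A ⊞ sc.obj B ⟶ sc.obj B) i).hom z) := by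
  have h : S.g = biprod.fst ≫ sc.map S.a + biprod.snd ≫ sc.map S.b := by
    rw [g, biprod.desc_eq]
  rw [h, HomologicalComplex.homologyMap_add, HomologicalComplex.homologyMap_comp,
    HomologicalComplex.homologyMap_comp]
  rfl

lemma exists_biprod (i : ℕ) (u : (sc.obj A).homology i) (w : (sc.obj B).homology i) :
    ∃ z : (sc.obj A ⊞ sc.obj B).homology i,
      (HomologicalComplex.homologyMap (biprod.fst : sc.obj A ⊞ sc.obj B ⟶ sc.obj A) i).hom z = u ∧
      (HomologicalComplex.homologyMap (biprod.snd : sc.obj A ⊞ sc.obj B ⟶ sc.obj B) i).hom z =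
        w := by
  have key : ∀ {K L M : ChainComplex (ModuleCat.{0} (ZMod 2)) ℕ} {f : K ⟶ L} {g : L ⟶ M}
      {h : K ⟶ M} (_ : f ≫ g = h) (x), (HomologicalComplex.homologyMap g i).hom
        ((HomologicalComplex.homologyMap f i).hom x) =
          (HomologicalComplex.homologyMap h i).hom x := by
    rintro K L M f g _ rfl x
    rw [HomologicalComplex.homologyMap_comp]
    rfl
  refine ⟨(HomologicalComplex.homologyMap (biprod.inl : sc.obj A ⟶ sc.obj A ⊞ sc.obj B) i).hom u +
    (HomologicalComplex.homologyMap (biprod.inr : sc.obj B ⟶ sc.obj A ⊞ sc.obj B) i).hom w, ?_, ?_⟩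
  · rw [map_add, key biprod.inl_fst, key biprod.inr_fst, HomologicalComplex.homologyMap_id,
      HomologicalComplex.homologyMap_zero]
    exact add_zero u
  · rw [map_add, key biprod.inl_snd, key biprod.inr_snd, HomologicalComplex.homologyMap_id,
      HomologicalComplex.homologyMap_zero]
    exact zero_add w

lemma homologyMap_f (i : ℕ) (y : (sc.obj P).homology i) :
    (HomologicalComplex.homologyMap (biprod.fst : sc.obj A ⊞ sc.obj B ⟶ sc.obj A) i).hom
        ((HomologicalComplex.homologyMap S.f i).hom y) = hsc i S.p y ∧
      (HomologicalComplex.homologyMap (biprod.snd : sc.obj A ⊞ sc.obj B ⟶ sc.obj B) i).hom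
        ((HomologicalComplex.homologyMap S.f i).hom y) = hsc i S.q y := by
  constructor
  · have h := HomologicalComplex.homologyMap_comp S.f biprod.fst i
    rw [f, biprod.lift_fst] at h
    exact (congrArg (fun φ => ModuleCat.Hom.hom φ y) h).symm
  · have h := HomologicalComplex.homologyMap_comp S.f biprod.snd i
    rw [f, biprod.lift_snd] at h
    exact (congrArg (fun φ => ModuleCat.Hom.hom φ y) h).symm

lemma homologyMap_f_eq_zero_iff (i : ℕ) (y : (sc.obj P).homology i) :
    (HomologicalComplex.homologyMap S.f i).hom y = 0 ↔ hsc i S.p y = 0 ∧ hsc i S.q y = 0 := by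
  constructor
  · intro h
    rw [← (S.homologyMap_f i y).1, ← (S.homologyMap_f i y).2, h, map_zero, map_zero]
    exact ⟨rfl, rfl⟩
  · rintro ⟨h1, h2⟩
    rw [homologyMap_biprod_eq i ((HomologicalComplex.homologyMap S.f i).hom y),
      (S.homologyMap_f i y).1, (S.homologyMap_f i y).2, h1, h2, map_zero, map_zero, add_zero]

lemma exists_connecting_small (i : ℕ) :
    ∃ δ : S.Small.homology (i + 1) →ₗ[ZMod 2] (sc.obj P).homology i,
      (∀ x, δ x = 0 ↔
        ∃ z, (HomologicalComplex.homologyMap (cokernel.π S.f) (i + 1)).hom z = x) ∧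
      ∀ y, (∃ x, δ x = y) ↔ (HomologicalComplex.homologyMap S.f i).hom y = 0 := by
  have hrel : (ComplexShape.down ℕ).Rel (i + 1) i := by simp
  refine ⟨(S.shortExact.δ (i + 1) i hrel).hom, fun x => ⟨fun h => ?_, ?_⟩, fun y => ⟨?_, fun h => ?_⟩⟩
  · exact (ShortComplex.moduleCat_exact_iff _).1 (S.shortExact.homology_exact₃ (i + 1) i hrel) x h
  · rintro ⟨z, rfl⟩
    exact congrArg (fun φ => ModuleCat.Hom.hom φ z) (S.shortExact.comp_δ (i + 1) i hrel)
  · rintro ⟨x, rfl⟩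
    exact congrArg (fun φ => ModuleCat.Hom.hom φ x) (S.shortExact.δ_comp (i + 1) i hrel)
  · exact (ShortComplex.moduleCat_exact_iff _).1 (S.shortExact.homology_exact₁ (i + 1) i hrel) y h

/-- The connecting homomorphism of the Mayer–Vietoris sequence. -/
theorem exists_connecting_sc (i : ℕ) :
    ∃ δ : (sc.obj X).homology (i + 1) →ₗ[ZMod 2] (sc.obj P).homology i,
      (∀ x, δ x = 0 ↔ ∃ u w, hsc (i + 1) S.a u + hsc (i + 1) S.b w = x) ∧
      ∀ y, (∃ x, δ x = y) ↔ hsc i S.p y = 0 ∧ hsc i S.q y = 0 := by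
  obtain ⟨δ, h1, h2⟩ := S.exists_connecting_small i
  let e := (asIso (HomologicalComplex.homologyMap S.ψ (i + 1))).toLinearEquiv
  have hg : ∀ z, e ((HomologicalComplex.homologyMap (cokernel.π S.f) (i + 1)).hom z) =
      (HomologicalComplex.homologyMap S.g (i + 1)).hom z := fun z => by
    have h := HomologicalComplex.homologyMap_comp (cokernel.π S.f) S.ψ (i + 1)
    rw [S.π_ψ] at h
    exact (congrArg (fun φ => ModuleCat.Hom.hom φ z) h).symm
  refine ⟨δ.comp e.symm.toLinearMap, fun x => ?_, fun y => ?_⟩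
  · obtain ⟨x, rfl⟩ := e.surjective x
    rw [LinearMap.comp_apply, LinearEquiv.coe_coe, e.symm_apply_apply, h1]
    constructor
    · rintro ⟨z, rfl⟩
      exact ⟨_, _, (S.homologyMap_g (i + 1) z).symm.trans (hg z).symm⟩
    · rintro ⟨u, w, h⟩
      obtain ⟨z, rfl, rfl⟩ := exists_biprod (i + 1) u w
      rw [← S.homologyMap_g, ← hg] at h
      exact ⟨z, e.injective h⟩
  · rw [← S.homologyMap_f_eq_zero_iff, ← h2]
    constructor
    · rintro ⟨x, h⟩
      exact ⟨_, h⟩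
    · rintro ⟨x, rfl⟩
      exact ⟨e x, by rw [LinearMap.comp_apply, LinearEquiv.coe_coe, e.symm_apply_apply]⟩

/-- Exactness of the Mayer–Vietoris sequence in the middle. -/
theorem add_eq_zero_iff_sc (i : ℕ) (u : (sc.obj A).homology i) (w : (sc.obj B).homology i) :
    hsc i S.a u + hsc i S.b w = 0 ↔ ∃ y, hsc i S.p y = u ∧ hsc i S.q y = w := by
  constructor
  · intro h
    obtain ⟨z, rfl, rfl⟩ := exists_biprod i u w
    rw [← S.homologyMap_g, ← S.π_ψ, HomologicalComplex.homologyMap_comp] at h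
    have hz : (HomologicalComplex.homologyMap (cokernel.π S.f) i).hom z = 0 := by
      apply (ModuleCat.mono_iff_injective (HomologicalComplex.homologyMap S.ψ i)).1 inferInstance
      rw [map_zero]
      exact h
    obtain ⟨y, rfl⟩ := (ShortComplex.moduleCat_exact_iff _).1
      (S.shortExact.homology_exact₂ i) _ hz
    exact ⟨y, (S.homologyMap_f i y).1.symm, (S.homologyMap_f i y).2.symm⟩
  · rintro ⟨y, rfl, rfl⟩
    have h1 := congrArg (fun f => hsc i f y) S.comm
    simp only [hsc, Functor.map_comp, HomologicalComplex.homologyMap_comp] at h1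
    exact (congrArg₂ (· + ·) h1 rfl).trans (TupleChain.add_self_zero _)

/-- The end of the Mayer–Vietoris sequence. -/
theorem exists_add_eq_sc (x : (sc.obj X).homology 0) :
    ∃ u w, hsc 0 S.a u + hsc 0 S.b w = x := by
  have : Epi (HomologicalComplex.homologyMap (cokernel.π S.f) 0) :=
    HomologicalComplex.epi_homologyMap_of_epi_of_not_rel _ 0 (by simp)
  have : Epi (HomologicalComplex.homologyMap S.g 0) := by
    rw [← S.π_ψ, HomologicalComplex.homologyMap_comp]
    infer_instance
  obtain ⟨z, rfl⟩ := (ModuleCat.epi_iff_surjective _).1 this x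
  exact ⟨_, _, (S.homologyMap_g 0 z).symm⟩

/-- The map on homology induced by a continuous map, as a linear map. -/
abbrev _root_.SingularChain.hmap {X Y : TopCat.{0}} (i : ℕ) (f : X ⟶ Y) :
    (homologyZ2 i).obj X →ₗ[ZMod 2] (homologyZ2 i).obj Y :=
  ((homologyZ2 i).map f).hom

/-- The connecting homomorphism of the Mayer–Vietoris sequence. -/
theorem exists_connecting (i : ℕ) :
    ∃ δ : (homologyZ2 (i + 1)).obj X →ₗ[ZMod 2] (homologyZ2 i).obj P,
      (∀ x, δ x = 0 ↔ ∃ u w, hmap (i + 1) S.a u + hmap (i + 1) S.b w = x) ∧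
      ∀ y, (∃ x, δ x = y) ↔ hmap i S.p y = 0 ∧ hmap i S.q y = 0 :=
  S.exists_connecting_sc i

/-- Exactness of the Mayer–Vietoris sequence in the middle. -/
theorem add_eq_zero_iff (i : ℕ) (u : (homologyZ2 i).obj A) (w : (homologyZ2 i).obj B) :
    hmap i S.a u + hmap i S.b w = 0 ↔ ∃ y, hmap i S.p y = u ∧ hmap i S.q y = w :=
  S.add_eq_zero_iff_sc i u w

/-- The end of the Mayer–Vietoris sequence. -/
theorem exists_add_eq (x : (homologyZ2 0).obj X) :
    ∃ u w, hmap 0 S.a u + hmap 0 S.b w = x :=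
  S.exists_add_eq_sc x

end OpenCover

end SingularChain

/-! ### Homotopy invariance and open covers of subsets -/

namespace SingularChain

lemma hmap_comp {X Y Z : TopCat.{0}} (i : ℕ) (f : X ⟶ Y) (g : Y ⟶ Z)
    (x : (homologyZ2 i).obj X) : hmap i (f ≫ g) x = hmap i g (hmap i f x) := by
  simp [hmap]

lemma hmap_id {X : TopCat.{0}} (i : ℕ) (x : (homologyZ2 i).obj X) : hmap i (𝟙 X) x = x := by
  simp [hmap]

/-- Homotopic maps agree on homology. -/
lemma hmap_eq_of_homotopy {X Y : TopCat.{0}} (i : ℕ) {f g : X ⟶ Y} (H : TopCat.Homotopy f g) :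
    hmap i f = hmap i g :=
  congrArg ModuleCat.Hom.hom
    (H.congr_homologyMap_singularChainComplexFunctor (ModuleCat.of (ZMod 2) (ZMod 2)) i)

/-- Maps into a subset of a vector space which are joined by segments agree on homology. -/
lemma hmap_eq_of_segment {X : TopCat.{0}} {E : Type} [AddCommGroup E] [Module ℝ E]
    [TopologicalSpace E] [ContinuousAdd E] [ContinuousSMul ℝ E] {A : Set E} (i : ℕ)
    (f g : X ⟶ TopCat.of A)
    (h : ∀ x, ∀ a b : ℝ, 0 ≤ a → 0 ≤ b → a + b = 1 →
      a • (f x : E) + b • (g x : E) ∈ A) :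
    hmap i f = hmap i g := by
  refine hmap_eq_of_homotopy i (ContinuousMap.Homotopy.mk ⟨fun p =>
    ⟨(1 - (p.1 : ℝ)) • (f p.2 : E) + (p.1 : ℝ) • (g p.2 : E),
      h p.2 _ _ (by linarith [p.1.2.2]) p.1.2.1 (by ring)⟩, ?_⟩ ?_ ?_)
  · refine Continuous.subtype_mk ?_ _
    have hf : Continuous fun p : unitInterval × X => (f p.2 : E) :=
      continuous_subtype_val.comp (f.hom.continuous.comp continuous_snd)
    have hg : Continuous fun p : unitInterval × X => (g p.2 : E) :=
      continuous_subtype_val.comp (g.hom.continuous.comp continuous_snd)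
    have h1 : Continuous fun p : unitInterval × X => (p.1 : ℝ) :=
      continuous_subtype_val.comp continuous_fst
    exact ((continuous_const.sub h1).smul hf).add (h1.smul hg)
  · intro x
    apply Subtype.ext
    simp
  · intro x
    apply Subtype.ext
    simp

lemma isZero_homology_of_isEmpty (X : TopCat.{0}) [IsEmpty X] (i : ℕ) :
    Subsingleton ((homologyZ2 i).obj X) := by
  have : IsEmpty (Sing i X) := ⟨fun σ => isEmptyElim (σ (stdSimplex.vertex 0))⟩
  have h : Limits.IsZero ((sc.obj X).X i) := by
    rw [ModuleCat.isZero_iff_subsingleton]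
    exact (toSc_surjective i X).subsingleton
  have h' : Limits.IsZero ((sc.obj X).homology i) :=
    (HomologicalComplex.ExactAt.of_isZero h).isZero_homology
  exact ModuleCat.isZero_iff_subsingleton.1 h'

/-- A subset of a space, as an object of the category of spaces, with its inclusions. -/
def inc {E : Type} [TopologicalSpace E] {A B : Set E} (h : A ⊆ B) :
    TopCat.of A ⟶ TopCat.of B :=
  TopCat.ofHom ⟨Set.inclusion h, continuous_inclusion h⟩

/-- The open cover of a subset by its intersections with two open sets. -/
def openCoverOfSets {E : Type} [TopologicalSpace E] (A O₁ O₂ : Set E) (h₁ : IsOpen O₁)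
    (h₂ : IsOpen O₂) (h : A ⊆ O₁ ∪ O₂) :
    OpenCover (TopCat.of ↥(A ∩ O₁ ∩ O₂)) (TopCat.of ↥(A ∩ O₁)) (TopCat.of ↥(A ∩ O₂))
      (TopCat.of A) where
  p := inc Set.inter_subset_left
  q := inc (fun _ hx => ⟨hx.1.1, hx.2⟩)
  a := inc Set.inter_subset_left
  b := inc Set.inter_subset_left
  comm := rfl
  open_a := by
    refine ⟨Topology.IsEmbedding.inclusion Set.inter_subset_left, ?_⟩
    convert h₁.preimage (continuous_subtype_val (p := (· ∈ A))) using 1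
    ext x
    exact ⟨by rintro ⟨y, rfl⟩; exact y.2.2, fun hx => ⟨⟨x.1, x.2, hx⟩, rfl⟩⟩
  open_b := by
    refine ⟨Topology.IsEmbedding.inclusion Set.inter_subset_left, ?_⟩
    convert h₂.preimage (continuous_subtype_val (p := (· ∈ A))) using 1
    ext x
    exact ⟨by rintro ⟨y, rfl⟩; exact y.2.2, fun hx => ⟨⟨x.1, x.2, hx⟩, rfl⟩⟩
  embedding := Topology.IsEmbedding.inclusion (fun _ hx => hx.1.1)
  cover := by
    rw [Set.eq_univ_iff_forall]
    intro x
    rcases h x.2 with hx | hx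
    · exact Or.inl ⟨⟨x.1, x.2, hx⟩, rfl⟩
    · exact Or.inr ⟨⟨x.1, x.2, hx⟩, rfl⟩
  inter := by
    ext x
    constructor
    · rintro ⟨y, rfl⟩
      exact ⟨⟨⟨y.1, y.2.1⟩, rfl⟩, ⟨⟨y.1, y.2.1.1, y.2.2⟩, rfl⟩⟩
    · rintro ⟨⟨y, rfl⟩, ⟨z, hz⟩⟩
      refine ⟨⟨y.1, y.2, ?_⟩, rfl⟩
      have : (z : E) = y := congrArg Subtype.val hz
      rw [← this]
      exact z.2.2

end SingularChain

/-! ### Realizations: star, link and deletion of a vertex -/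

namespace PreAbstractSimplicialComplex

open SingularChain

variable {V : Type} [Fintype V] [DecidableEq V] (C : PreAbstractSimplicialComplex V)

lemma face_nonempty {C : PreAbstractSimplicialComplex V} {s : Finset V} (hs : s ∈ C.faces) :
    s.Nonempty := (C.isRelLowerSet_faces hs).1

lemma face_mono {C : PreAbstractSimplicialComplex V} {s t : Finset V} (hs : s ∈ C.faces)
    (hts : t ⊆ s) (ht : t.Nonempty) : t ∈ C.faces := (C.isRelLowerSet_faces hs).2 hts ht

lemma mem_realization {x : V → ℝ} :
    x ∈ C.realization ↔
      (∀ v, 0 ≤ x v) ∧ ∑ v, x v = 1 ∧ ∃ s ∈ C.faces, ∀ v ∉ s, x v = 0 := by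
  simp only [realization, polyhedron, Set.mem_iUnion, exists_prop]
  constructor
  · rintro ⟨s, hs, hx⟩
    have key : convexHull ℝ ((fun v : V => (Pi.single v (1 : ℝ) : V → ℝ)) '' (s : Set V)) ⊆
        {x | (∀ v, 0 ≤ x v) ∧ ∑ v, x v = 1 ∧ ∀ v ∉ s, x v = 0} := by
      refine convexHull_min ?_ ?_
      · rintro _ ⟨v, hv, rfl⟩
        refine ⟨fun w => ?_, by simp, fun w hw => ?_⟩
        · by_cases h : w = v
          · subst h; simp
          · simp [h]
        · have : w ≠ v := by rintro rfl; exact hw hv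
          simp [this]
      · rintro x ⟨h1, h2, h3⟩ y ⟨k1, k2, k3⟩ a b ha hb hab
        refine ⟨fun v => ?_, ?_, fun v hv => ?_⟩
        · simp only [Pi.add_apply, Pi.smul_apply, smul_eq_mul]
          have := h1 v
          have := k1 v
          positivity
        · simp [Finset.sum_add_distrib, ← Finset.mul_sum, h2, k2, hab]
        · simp [h3 v hv, k3 v hv]
    exact ⟨(key hx).1, (key hx).2.1, s, hs, (key hx).2.2⟩
  · rintro ⟨h1, h2, s, hs, h3⟩
    refine ⟨s, hs, ?_⟩
    have hx : x = ∑ v ∈ s, x v • (Pi.single v (1 : ℝ) : V → ℝ) := by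
      ext w
      simp only [Finset.sum_apply, Pi.smul_apply, Pi.single_apply, smul_eq_mul, mul_ite, mul_one,
        mul_zero, Finset.sum_ite_eq]
      split_ifs with hw
      · rfl
      · exact h3 w hw
    rw [hx]
    refine (convex_convexHull ℝ _).sum_mem (fun v _ => h1 v) ?_
      fun v hv => subset_convexHull ℝ _ ⟨v, hv, rfl⟩
    rw [← h2]
    exact Finset.sum_subset (Finset.subset_univ s) fun v _ hv => h3 v hv

/-- The set of vertices with nonzero barycentric coordinate. -/
def supp (x : V → ℝ) : Finset V := Finset.univ.filter fun v => x v ≠ 0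

lemma mem_supp {x : V → ℝ} {v : V} : v ∈ supp x ↔ x v ≠ 0 := by simp [supp]

lemma supp_mem {C : PreAbstractSimplicialComplex V} {x : V → ℝ} (hx : x ∈ C.realization) :
    supp x ∈ C.faces := by
  obtain ⟨-, h2, s, hs, h3⟩ := C.mem_realization.1 hx
  refine face_mono hs (fun v hv => ?_) ?_
  · by_contra h
    exact mem_supp.1 hv (h3 v h)
  · by_contra h
    rw [Finset.not_nonempty_iff_eq_empty] at h
    have : ∀ v, x v = 0 := fun v => by
      by_contra hv
      have := mem_supp.2 hv
      rw [h] at this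
      exact absurd this (Finset.notMem_empty v)
    simp [this] at h2

/-- The support of y lies in that of x, so the whole segment stays in one simplex. This supplies the
straight-line homotopies below. -/
lemma add_smul_mem_realization {C : PreAbstractSimplicialComplex V} {x y : V → ℝ}
    (hx : x ∈ C.realization) (hy0 : ∀ v, 0 ≤ y v) (hy1 : ∑ v, y v = 1)
    (h : ∀ v, x v = 0 → y v = 0) {a b : ℝ} (ha : 0 ≤ a) (hb : 0 ≤ b) (hab : a + b = 1) :
    a • x + b • y ∈ C.realization := by
  obtain ⟨h1, h2, s, hs, h3⟩ := C.mem_realization.1 hx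
  refine C.mem_realization.2 ⟨fun v => ?_, ?_, s, hs, fun v hv => ?_⟩
  · have := h1 v
    have := hy0 v
    simp only [Pi.add_apply, Pi.smul_apply, smul_eq_mul]
    positivity
  · simp [Finset.sum_add_distrib, ← Finset.mul_sum, h2, hy1, hab]
  · simp [h3 v hv, h v (h3 v hv)]

lemma realization_mono {C D : PreAbstractSimplicialComplex V} (h : C.faces ⊆ D.faces) :
    C.realization ⊆ D.realization := fun x hx => by
  obtain ⟨h1, h2, s, hs, h3⟩ := C.mem_realization.1 hx
  exact D.mem_realization.2 ⟨h1, h2, s, h hs, h3⟩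

lemma deletion_faces_subset (v : V) : (C.deletion v).faces ⊆ C.faces := fun _ h => h.1

lemma link_faces_subset (v : V) : (C.link v).faces ⊆ (C.deletion v).faces := fun _ h =>
  ⟨face_mono h.2.2 (Finset.subset_insert _ _) h.1, h.2.1⟩

/-- The points of the realization outside a vertex. -/
abbrev awayFrom (v : V) : Set (V → ℝ) := C.realization ∩ {x | x v < 1}

/-- The open star of a vertex. -/
abbrev openStar (v : V) : Set (V → ℝ) := C.realization ∩ {x | 0 < x v}

/-- The open star of a vertex, without the vertex. -/
abbrev puncturedStar (v : V) : Set (V → ℝ) := C.realization ∩ {x | x v < 1} ∩ {x | 0 < x v}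

/-- The cover of the realization by the open star of a vertex and the complement of the vertex. -/
def starCover (v : V) : OpenCover (TopCat.of (C.puncturedStar v)) (TopCat.of (C.awayFrom v))
    (TopCat.of (C.openStar v)) (TopCat.of C.realization) :=
  openCoverOfSets C.realization {x | x v < 1} {x | 0 < x v}
    (isOpen_lt (continuous_apply v) continuous_const)
    (isOpen_lt continuous_const (continuous_apply v)) (fun x _ => by
      rcases lt_or_ge (x v) 1 with h | h
      · exact Or.inl h
      · exact Or.inr (lt_of_lt_of_le one_pos h))

/-- Projection away from a vertex. -/
def project (v : V) (x : V → ℝ) : V → ℝ := (1 - x v)⁻¹ • Function.update x v 0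

lemma project_self (v : V) (x : V → ℝ) : project v x v = 0 := by simp [project]

lemma project_of_ne {v w : V} (h : w ≠ v) (x : V → ℝ) :
    project v x w = (1 - x v)⁻¹ * x w := by simp [project, h]

lemma project_nonneg {v : V} {x : V → ℝ} (hx : ∀ w, 0 ≤ x w) (hv : x v < 1) (w : V) :
    0 ≤ project v x w := by
  by_cases h : w = v
  · subst h; rw [project_self]
  · rw [project_of_ne h]
    exact mul_nonneg (inv_nonneg.2 (by linarith)) (hx w)

lemma sum_project {v : V} {x : V → ℝ} (hx : ∑ w, x w = 1) (hv : x v < 1) :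
    ∑ w, project v x w = 1 := by
  have h1 : ∑ w, Function.update x v 0 w = 1 - x v := by
    rw [Finset.sum_update_of_mem (Finset.mem_univ v), zero_add,
      ← hx, ← Finset.sum_sdiff (Finset.subset_univ {v})]
    simp
  simp only [project, Pi.smul_apply, smul_eq_mul, ← Finset.mul_sum]
  rw [h1]
  exact inv_mul_cancel₀ (by linarith)

lemma project_eq_zero {v w : V} {x : V → ℝ} (h : x w = 0) : project v x w = 0 := by
  by_cases hw : w = v
  · subst hw; exact project_self _ _
  · rw [project_of_ne hw, h, mul_zero]

lemma project_of_zero {v : V} {x : V → ℝ} (h : x v = 0) : project v x = x := by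
  rw [project, h, ← h, Function.update_eq_self, h]
  simp

lemma exists_ne_of_lt {C : PreAbstractSimplicialComplex V} {x : V → ℝ} {v : V}
    (hx : x ∈ C.realization) (hv : x v < 1) : ((supp x).erase v).Nonempty := by
  obtain ⟨h1, h2, -⟩ := C.mem_realization.1 hx
  by_contra h
  rw [Finset.not_nonempty_iff_eq_empty] at h
  have h0 : ∀ w ≠ v, x w = 0 := fun w hw => by
    by_contra hne
    have : w ∈ (supp x).erase v := Finset.mem_erase.2 ⟨hw, mem_supp.2 hne⟩
    rw [h] at this
    exact Finset.notMem_empty _ this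
  rw [Finset.sum_eq_single v (fun w _ hw => h0 w hw) (by simp)] at h2
  linarith

lemma project_mem_deletion {v : V} {x : V → ℝ} (hx : x ∈ C.awayFrom v) :
    project v x ∈ (C.deletion v).realization := by
  obtain ⟨hx, hv⟩ := hx
  obtain ⟨h1, h2, -⟩ := C.mem_realization.1 hx
  refine (mem_realization _).2 ⟨project_nonneg h1 hv, sum_project h2 hv, (supp x).erase v,
    ⟨face_mono (supp_mem hx) (Finset.erase_subset _ _) (exists_ne_of_lt hx hv), by simp⟩, ?_⟩
  intro w hw
  by_cases h : w = v
  · subst h; exact project_self _ _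
  · apply project_eq_zero
    by_contra hne
    exact hw (Finset.mem_erase.2 ⟨h, mem_supp.2 hne⟩)

lemma project_mem_link {v : V} {x : V → ℝ} (hx : x ∈ C.puncturedStar v) :
    project v x ∈ (C.link v).realization := by
  obtain ⟨⟨hx, hv⟩, hv0⟩ := hx
  obtain ⟨h1, h2, -⟩ := C.mem_realization.1 hx
  refine (mem_realization _).2 ⟨project_nonneg h1 hv, sum_project h2 hv, (supp x).erase v,
    ⟨exists_ne_of_lt hx hv, by simp, ?_⟩, ?_⟩
  · rw [Finset.insert_erase (mem_supp.2 (ne_of_gt hv0))]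
    exact supp_mem hx
  intro w hw
  by_cases h : w = v
  · subst h; exact project_self _ _
  · apply project_eq_zero
    by_contra hne
    exact hw (Finset.mem_erase.2 ⟨h, mem_supp.2 hne⟩)

lemma eq_zero_of_mem_deletion {v : V} {x : V → ℝ} (hx : x ∈ (C.deletion v).realization) :
    x v = 0 := by
  obtain ⟨-, -, s, hs, h3⟩ := (mem_realization _).1 hx
  exact h3 v hs.2

lemma mem_awayFrom_of_mem_deletion {v : V} {x : V → ℝ} (hx : x ∈ (C.deletion v).realization) :
    x ∈ C.awayFrom v :=
  ⟨realization_mono (C.deletion_faces_subset v) hx, by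
    rw [Set.mem_ofPred_eq, C.eq_zero_of_mem_deletion hx]; exact one_pos⟩

/-- The midpoint between a point and a vertex. -/
def midpointTo (v : V) (x : V → ℝ) : V → ℝ := (2 : ℝ)⁻¹ • (x + Pi.single v 1)

lemma midpointTo_self {v : V} {x : V → ℝ} (h : x v = 0) : midpointTo v x v = 2⁻¹ := by
  simp [midpointTo, h]

lemma midpointTo_of_ne {v w : V} (h : w ≠ v) (x : V → ℝ) : midpointTo v x w = 2⁻¹ * x w := by
  simp [midpointTo, h]

lemma eq_zero_of_mem_link {v : V} {x : V → ℝ} (hx : x ∈ (C.link v).realization) : x v = 0 :=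
  C.eq_zero_of_mem_deletion (realization_mono (C.link_faces_subset v) hx)

lemma sum_midpointTo {v : V} {x : V → ℝ} (h : ∑ w, x w = 1) : ∑ w, midpointTo v x w = 1 := by
  simp [midpointTo, ← Finset.mul_sum, Finset.sum_add_distrib, h]
  norm_num

lemma midpointTo_nonneg {v : V} {x : V → ℝ} (h : ∀ w, 0 ≤ x w) (w : V) :
    0 ≤ midpointTo v x w := by
  have : (0 : ℝ) ≤ (Pi.single v (1 : ℝ) : V → ℝ) w := by
    by_cases hw : w = v
    · subst hw; simp
    · simp [hw]
  have := h w
  simp only [midpointTo, Pi.smul_apply, Pi.add_apply, smul_eq_mul]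
  positivity

/-- The link itself misses the punctured star, on which the coordinate at v is positive. It is
therefore pushed halfway towards v before being included. -/
lemma midpointTo_mem {v : V} {x : V → ℝ} (hx : x ∈ (C.link v).realization) :
    midpointTo v x ∈ C.puncturedStar v := by
  obtain ⟨h1, h2, s, hs, h3⟩ := (mem_realization _).1 hx
  have h0 := C.eq_zero_of_mem_link hx
  refine ⟨⟨C.mem_realization.2 ⟨midpointTo_nonneg h1, sum_midpointTo h2, insert v s, hs.2.2,
    fun w hw => ?_⟩, ?_⟩, ?_⟩
  · rw [midpointTo_of_ne (fun h => hw (by simp [h])), h3 w (fun h => hw (by simp [h])), mul_zero]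
  · rw [Set.mem_ofPred_eq, midpointTo_self h0]; norm_num
  · rw [Set.mem_ofPred_eq, midpointTo_self h0]; norm_num

lemma project_midpointTo {v : V} {x : V → ℝ} (h : x v = 0) : project v (midpointTo v x) = x := by
  ext w
  by_cases hw : w = v
  · subst hw; rw [project_self, h]
  · rw [project_of_ne hw, midpointTo_self h, midpointTo_of_ne hw]
    norm_num
    ring

lemma continuousOn_project (v : V) : ContinuousOn (project v) {x : V → ℝ | x v < 1} := by
  unfold project
  refine ContinuousOn.smul (ContinuousOn.inv₀
    (continuous_const.sub (continuous_apply v)).continuousOn fun x hx => ?_) ?_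
  · have : x v < 1 := hx
    change 1 - x v ≠ 0
    linarith
  · exact (continuous_id.update v continuous_const).continuousOn

/-- The inclusion of the deletion of a vertex into the complement of the vertex. -/
def deletionToAway (v : V) : TopCat.of (C.deletion v).realization ⟶ TopCat.of (C.awayFrom v) :=
  inc fun _ hx => C.mem_awayFrom_of_mem_deletion hx

/-- The retraction of the complement of a vertex to the deletion of the vertex. -/
def awayToDeletion (v : V) : TopCat.of (C.awayFrom v) ⟶ TopCat.of (C.deletion v).realization :=
  TopCat.ofHom ⟨fun x => ⟨project v x, C.project_mem_deletion x.2⟩,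
    ((continuousOn_project v).comp_continuous continuous_subtype_val
      fun x => x.2.2).subtype_mk _⟩

/-- The embedding of the link of a vertex into its punctured star. -/
def linkToStar (v : V) : TopCat.of (C.link v).realization ⟶ TopCat.of (C.puncturedStar v) :=
  TopCat.ofHom ⟨fun x => ⟨midpointTo v x, C.midpointTo_mem x.2⟩,
    (by unfold midpointTo; fun_prop : Continuous fun x : (C.link v).realization =>
      midpointTo v (x : V → ℝ)).subtype_mk _⟩

/-- The projection of the punctured star of a vertex to its link. -/
def starToLink (v : V) : TopCat.of (C.puncturedStar v) ⟶ TopCat.of (C.link v).realization :=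
  TopCat.ofHom ⟨fun x => ⟨project v x, C.project_mem_link x.2⟩,
    ((continuousOn_project v).comp_continuous continuous_subtype_val
      fun x => x.2.1.2).subtype_mk _⟩

/-- The complement of a vertex has the homology of its deletion. -/
def deletionEquiv (v : V) (i : ℕ) :
    (homologyZ2 i).obj (TopCat.of (C.deletion v).realization) ≃ₗ[ZMod 2]
      (homologyZ2 i).obj (TopCat.of (C.awayFrom v)) :=
  LinearEquiv.ofLinearMap (hmap i (C.deletionToAway v)) (hmap i (C.awayToDeletion v))
    (by
      ext x
      rw [LinearMap.comp_apply, ← hmap_comp, hmap_eq_of_segment i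
        (C.awayToDeletion v ≫ C.deletionToAway v) (𝟙 _), hmap_id]
      · rfl
      · intro x a b ha hb hab
        obtain ⟨h1, h2, -⟩ := C.mem_realization.1 x.2.1
        have hv : (x : V → ℝ) v < 1 := x.2.2
        rw [add_comm]
        refine ⟨add_smul_mem_realization x.2.1 (project_nonneg h1 hv) (sum_project h2 hv)
          (fun w hw => project_eq_zero hw) hb ha (by rw [add_comm]; exact hab), ?_⟩
        change b * (x : V → ℝ) v + a * project v x v < 1
        rw [project_self, mul_zero, add_zero]
        nlinarith [h1 v])
    (by
      ext x
      rw [LinearMap.comp_apply, ← hmap_comp]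
      have : C.deletionToAway v ≫ C.awayToDeletion v = 𝟙 _ := by
        refine ConcreteCategory.hom_ext _ _ fun x => ?_
        exact Subtype.ext (project_of_zero (C.eq_zero_of_mem_deletion x.2))
      rw [this, hmap_id]
      rfl)

/-- The punctured star of a vertex has the homology of the link. -/
def linkEquiv (v : V) (i : ℕ) :
    (homologyZ2 i).obj (TopCat.of (C.link v).realization) ≃ₗ[ZMod 2]
      (homologyZ2 i).obj (TopCat.of (C.puncturedStar v)) :=
  LinearEquiv.ofLinearMap (hmap i (C.linkToStar v)) (hmap i (C.starToLink v))
    (by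
      ext x
      rw [LinearMap.comp_apply, ← hmap_comp, hmap_eq_of_segment i
        (C.starToLink v ≫ C.linkToStar v) (𝟙 _), hmap_id]
      · rfl
      · intro x a b ha hb hab
        obtain ⟨h1, h2, -⟩ := C.mem_realization.1 x.2.1.1
        have hv : (x : V → ℝ) v < 1 := x.2.1.2
        have hv0 : 0 < (x : V → ℝ) v := x.2.2
        have e : midpointTo v (project v x) v = 2⁻¹ := midpointTo_self (project_self _ _)
        rw [add_comm]
        refine ⟨⟨add_smul_mem_realization x.2.1.1 (midpointTo_nonneg (project_nonneg h1 hv))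
          (sum_midpointTo (sum_project h2 hv)) (fun w hw => ?_) hb ha
          (by rw [add_comm]; exact hab), ?_⟩, ?_⟩
        · have hwv : w ≠ v := by rintro rfl; exact hv0.ne' hw
          change midpointTo v (project v x) w = 0
          rw [midpointTo_of_ne hwv, project_eq_zero hw, mul_zero]
        · change b * (x : V → ℝ) v + a * midpointTo v (project v x) v < 1
          rw [e]
          nlinarith
        · change 0 < b * (x : V → ℝ) v + a * midpointTo v (project v x) v
          rw [e]
          rcases hb.eq_or_lt with rfl | hb
          · have : a = 1 := by linarith
            rw [this]
            norm_num
          · positivity)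
    (by
      ext x
      rw [LinearMap.comp_apply, ← hmap_comp]
      have : C.linkToStar v ≫ C.starToLink v = 𝟙 _ := by
        refine ConcreteCategory.hom_ext _ _ fun x => ?_
        exact Subtype.ext (project_midpointTo (C.eq_zero_of_mem_link x.2))
      rw [this, hmap_id]
      rfl)

lemma single_mem_realization {v : V} (hv : {v} ∈ C.faces) : Pi.single v 1 ∈ C.realization := by
  refine C.mem_realization.2 ⟨fun w => ?_, by simp, {v}, hv, fun w hw => ?_⟩
  · by_cases h : w = v
    · subst h; simp
    · simp [h]
  · simp [Finset.mem_singleton.not.1 hw]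

lemma single_mem_openStar {v : V} (hv : {v} ∈ C.faces) : Pi.single v 1 ∈ C.openStar v :=
  ⟨C.single_mem_realization hv, by simp⟩

/-- The constant map with value the vertex is homotopic to the identity of the open star. -/
lemma hmap_openStar_eq {v : V} (hv : {v} ∈ C.faces) {X : TopCat.{0}} (i : ℕ)
    (f g : X ⟶ TopCat.of (C.openStar v)) : hmap i f = hmap i g := by
  have key : ∀ f : X ⟶ TopCat.of (C.openStar v), hmap i f =
      hmap i (TopCat.ofHom (ContinuousMap.const X ⟨Pi.single v 1, C.single_mem_openStar hv⟩)) := by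
    intro f
    apply hmap_eq_of_segment
    intro x a b ha hb hab
    have hx := (f x).2
    have hv0 : 0 < ((f x : C.openStar v) : V → ℝ) v := hx.2
    refine ⟨add_smul_mem_realization hx.1 ?_ (by simp) (fun w hw => ?_) ha hb hab, ?_⟩
    · exact (C.mem_realization.1 (C.single_mem_realization hv)).1
    · have : w ≠ v := by rintro rfl; exact hv0.ne' hw
      simp [this]
    · change 0 < a * ((f x : C.openStar v) : V → ℝ) v + b * (Pi.single v (1 : ℝ) : V → ℝ) v
      rw [Pi.single_eq_same]
      rcases ha.eq_or_lt with rfl | ha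
      · have : b = 1 := by linarith
        rw [this]
        norm_num
      · positivity
  rw [key f, key g]

end PreAbstractSimplicialComplex

/-! ### Zeroth homology and the homology of a point -/

namespace SingularChain

lemma finrank_homology_zero (X : TopCat.{0}) [Finite (ZerothHomotopy X)] :
    Module.Finite (ZMod 2) ((homologyZ2 0).obj X) ∧
      Module.finrank (ZMod 2) ((homologyZ2 0).obj X) = Nat.card (ZerothHomotopy X) := by
  classical
  have := Fintype.ofFinite (ZerothHomotopy X)
  let e : (homologyZ2 0).obj X ≅
      ModuleCat.of (ZMod 2) (DirectSum (ZerothHomotopy X) fun _ => ZMod 2) :=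
    X.singularHomology₀Iso (ModuleCat.of (ZMod 2) (ZMod 2)) ≪≫
      ModuleCat.coprodIsoDirectSum (fun _ : ZerothHomotopy X => ModuleCat.of (ZMod 2) (ZMod 2))
  let e' : (homologyZ2 0).obj X ≃ₗ[ZMod 2] (ZerothHomotopy X → ZMod 2) :=
    e.toLinearEquiv.trans
      (DirectSum.linearEquivFunOnFintype (ZMod 2) (ZerothHomotopy X) fun _ => ZMod 2)
  refine ⟨Module.Finite.equiv e'.symm, ?_⟩
  rw [e'.finrank_eq, Module.finrank_fintype_fun_eq_card, Nat.card_eq_fintype_card]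

lemma subsingleton_homology_punit (i : ℕ) :
    Subsingleton ((homologyZ2 (i + 1)).obj (TopCat.of PUnit)) := by
  have h := AlgebraicTopology.isZero_singularHomologyFunctor_of_totallyDisconnectedSpace
    (C := ModuleCat.{0} (ZMod 2)) (i + 1) (ModuleCat.of (ZMod 2) (ZMod 2)) (TopCat.of PUnit)
    (Nat.succ_ne_zero i)
  exact ModuleCat.isZero_iff_subsingleton.1 h

lemma finrank_homology_punit :
    Module.Finite (ZMod 2) ((homologyZ2 0).obj (TopCat.of PUnit)) ∧
      Module.finrank (ZMod 2) ((homologyZ2 0).obj (TopCat.of PUnit)) = 1 := by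
  have h : Subsingleton (ZerothHomotopy (TopCat.of PUnit)) :=
    ⟨fun a b => by
      obtain ⟨x, rfl⟩ := ZerothHomotopy.mk_surjective a
      obtain ⟨y, rfl⟩ := ZerothHomotopy.mk_surjective b
      rfl⟩
  have h' : Nonempty (ZerothHomotopy (TopCat.of PUnit)) := ⟨ZerothHomotopy.mk PUnit.unit⟩
  have := finrank_homology_zero (TopCat.of PUnit)
  rw [Nat.card_eq_one_iff_unique.2 ⟨h, h'⟩] at this
  exact this

lemma finite_of_exact {A B D : Type} [AddCommGroup A] [AddCommGroup B] [AddCommGroup D]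
    [Module (ZMod 2) A] [Module (ZMod 2) B] [Module (ZMod 2) D] [Module.Finite (ZMod 2) A]
    [Module.Finite (ZMod 2) D] (f : A →ₗ[ZMod 2] B) (g : B →ₗ[ZMod 2] D)
    (h : ∀ b, g b = 0 → ∃ a, f a = b) : Module.Finite (ZMod 2) B := by
  have h1 : LinearMap.ker g ≤ LinearMap.range f := fun b hb => h b hb
  have h2 : Module.Finite (ZMod 2) (LinearMap.ker g) := Submodule.finiteDimensional_of_le h1
  have h3 : Module.Finite (ZMod 2) (B ⧸ LinearMap.ker g) :=
    Module.Finite.equiv g.quotKerEquivRange.symm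
  exact Module.Finite.of_submodule_quotient (LinearMap.ker g)

end SingularChain

/-! ### The Mayer–Vietoris sequence of a vertex and its Betti numbers -/

namespace PreAbstractSimplicialComplex

open SingularChain

variable {V : Type} [Fintype V] [DecidableEq V] (C : PreAbstractSimplicialComplex V)

/-- The homology of a complex is finite-dimensional. -/
def FiniteHomology : Prop := ∀ i, Module.Finite (ZMod 2) (C.homology i)

/-- The open star of a vertex has the homology of a point. -/
def openStarEquiv {v : V} (hv : {v} ∈ C.faces) (i : ℕ) :
    (homologyZ2 i).obj (TopCat.of (C.openStar v)) ≃ₗ[ZMod 2]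
      (homologyZ2 i).obj (TopCat.of PUnit) :=
  LinearEquiv.ofLinearMap
    (hmap i (TopCat.ofHom (ContinuousMap.const (C.openStar v) PUnit.unit)))
    (hmap i (TopCat.ofHom (ContinuousMap.const PUnit ⟨Pi.single v 1, C.single_mem_openStar hv⟩)))
    (by
      ext x
      rw [LinearMap.comp_apply, ← hmap_comp]
      exact hmap_id i x)
    (by
      ext x
      rw [LinearMap.comp_apply, ← hmap_comp, C.hmap_openStar_eq hv i _ (𝟙 _)]
      exact hmap_id i x)

lemma subsingleton_openStar {v : V} (hv : {v} ∈ C.faces) (i : ℕ) :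
    Subsingleton ((homologyZ2 (i + 1)).obj (TopCat.of (C.openStar v))) := by
  have := subsingleton_homology_punit i
  exact (C.openStarEquiv hv (i + 1)).toEquiv.subsingleton

lemma finite_openStar {v : V} (hv : {v} ∈ C.faces) (i : ℕ) :
    Module.Finite (ZMod 2) ((homologyZ2 i).obj (TopCat.of (C.openStar v))) := by
  cases i with
  | zero =>
    have := finrank_homology_punit.1
    exact Module.Finite.equiv (C.openStarEquiv hv 0).symm
  | succ i =>
    have := C.subsingleton_openStar hv i
    infer_instance

lemma finrank_openStar {v : V} (hv : {v} ∈ C.faces) :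
    Module.finrank (ZMod 2) ((homologyZ2 0).obj (TopCat.of (C.openStar v))) = 1 := by
  rw [(C.openStarEquiv hv 0).finrank_eq]
  exact finrank_homology_punit.2

/-- The map on homology induced by the inclusion of the deletion of a vertex. -/
def delMap (v : V) (i : ℕ) : (C.deletion v).homology i →ₗ[ZMod 2] C.homology i :=
  hmap i (inc (realization_mono (C.deletion_faces_subset v)))

/-- The map from the homology of the link to the homology of the deletion. -/
def linkMap (v : V) (i : ℕ) : (C.link v).homology i →ₗ[ZMod 2] (C.deletion v).homology i :=
  (C.deletionEquiv v i).symm.toLinearMap ∘ₗ hmap i (C.starCover v).p ∘ₗ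
    (C.linkEquiv v i).toLinearMap

/-- The map from the homology of the link to the homology of the open star. -/
def linkStarMap (v : V) (i : ℕ) : (C.link v).homology i →ₗ[ZMod 2]
    (homologyZ2 i).obj (TopCat.of (C.openStar v)) :=
  hmap i (C.starCover v).q ∘ₗ (C.linkEquiv v i).toLinearMap

/-- The map from the homology of the open star to the homology of the complex. -/
def starMap (v : V) (i : ℕ) : (homologyZ2 i).obj (TopCat.of (C.openStar v)) →ₗ[ZMod 2]
    C.homology i := hmap i (C.starCover v).b

lemma delMap_eq (v : V) (i : ℕ) (u) :
    C.delMap v i u = hmap i (C.starCover v).a (C.deletionEquiv v i u) :=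
  hmap_comp i (C.deletionToAway v) (C.starCover v).a u

lemma cone_exact_connecting (v : V) (i : ℕ) :
    ∃ δ : C.homology (i + 1) →ₗ[ZMod 2] (C.link v).homology i,
      (∀ x, δ x = 0 ↔ ∃ u w, C.delMap v (i + 1) u + C.starMap v (i + 1) w = x) ∧
      ∀ y, (∃ x, δ x = y) ↔ C.linkMap v i y = 0 ∧ C.linkStarMap v i y = 0 := by
  obtain ⟨δ, h1, h2⟩ := (C.starCover v).exists_connecting i
  refine ⟨(C.linkEquiv v i).symm.toLinearMap ∘ₗ δ, fun x => ?_, fun y => ?_⟩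
  · rw [LinearMap.comp_apply, LinearEquiv.coe_coe, LinearEquiv.map_eq_zero_iff, h1]
    constructor
    · rintro ⟨u, w, h⟩
      refine ⟨(C.deletionEquiv v (i + 1)).symm u, w, ?_⟩
      rw [delMap_eq, LinearEquiv.apply_symm_apply]
      exact h
    · rintro ⟨u, w, h⟩
      rw [delMap_eq] at h
      exact ⟨_, w, h⟩
  · rw [linkMap, linkStarMap]
    simp only [LinearMap.comp_apply, LinearEquiv.coe_coe]
    rw [LinearEquiv.map_eq_zero_iff, ← h2]
    simp only [LinearEquiv.symm_apply_eq]

lemma cone_exact_middle (v : V) (i : ℕ) (u w) :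
    C.delMap v i u + C.starMap v i w = 0 ↔
      ∃ y, C.linkMap v i y = u ∧ C.linkStarMap v i y = w := by
  rw [delMap_eq]
  refine ((C.starCover v).add_eq_zero_iff i _ w).trans ⟨?_, ?_⟩
  · rintro ⟨y, h1, h2⟩
    refine ⟨(C.linkEquiv v i).symm y, ?_, ?_⟩
    · simp only [linkMap, LinearMap.comp_apply, LinearEquiv.coe_coe, LinearEquiv.apply_symm_apply]
      rw [LinearEquiv.symm_apply_eq]
      exact h1
    · simp only [linkStarMap, LinearMap.comp_apply, LinearEquiv.coe_coe,
        LinearEquiv.apply_symm_apply]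
      exact h2
  · rintro ⟨y, rfl, rfl⟩
    refine ⟨C.linkEquiv v i y, ?_, rfl⟩
    simp only [linkMap, LinearMap.comp_apply, LinearEquiv.coe_coe, LinearEquiv.apply_symm_apply]

lemma cone_exact_zero (v : V) (x : C.homology 0) :
    ∃ u w, C.delMap v 0 u + C.starMap v 0 w = x := by
  obtain ⟨u, w, h⟩ := (C.starCover v).exists_add_eq x
  refine ⟨(C.deletionEquiv v 0).symm u, w, ?_⟩
  rw [delMap_eq, LinearEquiv.apply_symm_apply]
  exact h

/-- A nonempty link provides a point of the punctured star. The constant map from the open star to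
this point, followed by the inclusion, induces the identity on homology because the star is
contractible. -/
lemma linkStarMap_surjective {v : V} (hv : {v} ∈ C.faces) (hL : (C.link v).faces.Nonempty)
    (i : ℕ) : Function.Surjective (C.linkStarMap v i) := by
  intro w
  obtain ⟨s, hs⟩ := hL
  obtain ⟨u, hu⟩ := face_nonempty hs
  have hu' : {u} ∈ (C.link v).faces :=
    face_mono hs (Finset.singleton_subset_iff.2 hu) (Finset.singleton_nonempty u)
  let y : C.puncturedStar v := ⟨_, C.midpointTo_mem (single_mem_realization _ hu')⟩
  let c : TopCat.of (C.openStar v) ⟶ TopCat.of (C.puncturedStar v) :=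
    TopCat.ofHom (ContinuousMap.const _ y)
  refine ⟨(C.linkEquiv v i).symm (hmap i c w), ?_⟩
  simp only [linkStarMap, LinearMap.comp_apply, LinearEquiv.coe_coe, LinearEquiv.apply_symm_apply]
  rw [← hmap_comp, C.hmap_openStar_eq hv i _ (𝟙 _), hmap_id]

variable {C}

lemma subsingleton_homology_of_empty (h : C.faces = ∅) (i : ℕ) : Subsingleton (C.homology i) := by
  have : IsEmpty C.realization := ⟨fun x => by
    obtain ⟨-, -, s, hs, -⟩ := C.mem_realization.1 x.2
    rw [h] at hs
    exact hs⟩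
  exact isZero_homology_of_isEmpty (TopCat.of C.realization) i

lemma betti_of_empty (h : C.faces = ∅) (i : ℕ) : C.betti i = 0 := by
  have := subsingleton_homology_of_empty h i
  exact Module.finrank_zero_of_subsingleton

lemma finiteHomology_of_empty (h : C.faces = ∅) : C.FiniteHomology := fun i => by
  have := subsingleton_homology_of_empty h i
  infer_instance

variable {v : V} (hv : {v} ∈ C.faces)

include hv

lemma finiteHomology_of_cone (hD : (C.deletion v).FiniteHomology)
    (hL : (C.link v).FiniteHomology) : C.FiniteHomology := by
  intro i
  have := C.finite_openStar hv
  have := hD i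
  cases i with
  | zero =>
    refine Module.Finite.of_surjective ((C.delMap v 0).coprod (C.starMap v 0)) fun x => ?_
    obtain ⟨u, w, h⟩ := C.cone_exact_zero v x
    exact ⟨(u, w), h⟩
  | succ i =>
    have := hL i
    obtain ⟨δ, h1, -⟩ := C.cone_exact_connecting v i
    refine finite_of_exact ((C.delMap v (i + 1)).coprod (C.starMap v (i + 1))) δ fun x hx => ?_
    obtain ⟨u, w, h⟩ := (h1 x).1 hx
    exact ⟨(u, w), h⟩

/-- The open star has no homology in positive degree, so only the deletion contributes to the kernel
of the connecting map. -/
lemma cone_exact_succ (i : ℕ) :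
    ∃ δ : C.homology (i + 1) →ₗ[ZMod 2] (C.link v).homology i,
      LinearMap.ker δ = LinearMap.range (C.delMap v (i + 1)) ∧
      LinearMap.range δ = LinearMap.ker (C.linkMap v i) ⊓ LinearMap.ker (C.linkStarMap v i) := by
  obtain ⟨δ, h1, h2⟩ := C.cone_exact_connecting v i
  have := C.subsingleton_openStar hv i
  refine ⟨δ, ?_, ?_⟩
  · ext x
    rw [LinearMap.mem_ker, h1, LinearMap.mem_range]
    constructor
    · rintro ⟨u, w, h⟩
      rw [Subsingleton.elim w 0, map_zero, add_zero] at h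
      exact ⟨u, h⟩
    · rintro ⟨u, h⟩
      exact ⟨u, 0, by rw [map_zero, add_zero, h]⟩
  · ext y
    rw [LinearMap.mem_range, h2, Submodule.mem_inf, LinearMap.mem_ker, LinearMap.mem_ker]

lemma betti_succ_le (hD : (C.deletion v).FiniteHomology) (hL : (C.link v).FiniteHomology)
    (i : ℕ) : C.betti (i + 1) ≤ (C.deletion v).betti (i + 1) + (C.link v).betti i := by
  obtain ⟨δ, h1, -⟩ := cone_exact_succ hv i
  have := finiteHomology_of_cone hv hD hL (i + 1)
  have := hD (i + 1)
  have := hL i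
  rw [betti, ← LinearMap.finrank_range_add_finrank_ker δ, h1, add_comm]
  exact add_le_add (LinearMap.finrank_range_le _) (Submodule.finrank_le _)

/-- By exactness in the middle, a class of the link that dies in the star has an image in the
deletion that dies in C. Injectivity makes that image zero already. -/
lemma ker_inf_eq_of_injective {i : ℕ} (h : Function.Injective (C.delMap v i)) :
    LinearMap.ker (C.linkMap v i) ⊓ LinearMap.ker (C.linkStarMap v i) =
      LinearMap.ker (C.linkStarMap v i) := by
  refine inf_eq_right.2 fun y hy => ?_
  have := (C.cone_exact_middle v i (C.linkMap v i y) (C.linkStarMap v i y)).2 ⟨y, rfl, rfl⟩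
  rw [LinearMap.mem_ker.1 hy, map_zero, add_zero] at this
  exact h (this.trans (map_zero _).symm)

/-- In positive degree every class of the link dies in the star. Injectivity in the lower degree
makes the connecting map surjective; injectivity in the upper degree identifies its kernel with the
homology of the deletion. -/
lemma betti_succ_eq (hD : (C.deletion v).FiniteHomology) (hL : (C.link v).FiniteHomology)
    {i : ℕ} (h : Function.Injective (C.delMap v (i + 1)))
    (h' : Function.Injective (C.delMap v (i + 2))) :
    C.betti (i + 2) = (C.deletion v).betti (i + 2) + (C.link v).betti (i + 1) := by
  obtain ⟨δ, h1, h2⟩ := cone_exact_succ hv (i + 1)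
  have := finiteHomology_of_cone hv hD hL (i + 2)
  have := C.subsingleton_openStar hv i
  have h3 : LinearMap.ker (C.linkStarMap v (i + 1)) = ⊤ :=
    eq_top_iff.2 fun y _ => Subsingleton.elim _ _
  rw [ker_inf_eq_of_injective hv h, h3] at h2
  rw [betti, ← LinearMap.finrank_range_add_finrank_ker δ, h1, h2, finrank_top,
    LinearMap.finrank_range_of_inj h', add_comm]
  rfl

/-- The image of the connecting map is the kernel of the surjection from H_0 of the link to the
one-dimensional H_0 of the star. The extra 1 is thus the difference between β_0 of the link and its
reduced version. -/
lemma betti_one_add_one (hD : (C.deletion v).FiniteHomology) (hL : (C.link v).FiniteHomology)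
    (hne : (C.link v).faces.Nonempty) (h : Function.Injective (C.delMap v 0))
    (h' : Function.Injective (C.delMap v 1)) :
    C.betti 1 + 1 = (C.deletion v).betti 1 + (C.link v).betti 0 := by
  obtain ⟨δ, h1, h2⟩ := cone_exact_succ hv 0
  have := finiteHomology_of_cone hv hD hL 1
  have := hL 0
  rw [ker_inf_eq_of_injective hv h] at h2
  have h4 := LinearMap.finrank_range_add_finrank_ker (C.linkStarMap v 0)
  rw [LinearMap.range_eq_top.2 (C.linkStarMap_surjective hv hne 0), finrank_top,
    C.finrank_openStar hv] at h4
  rw [betti, ← LinearMap.finrank_range_add_finrank_ker δ, h1, h2,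
    LinearMap.finrank_range_of_inj h', betti, betti]
  change 1 + _ = Module.finrank (ZMod 2) ((C.link v).homology 0) at h4
  rw [← h4]
  ring

/-- A nonempty link lets every class of the star be moved into the deletion, so the injection H_0(D)
→ H_0(C) is also surjective. -/
lemma betti_zero_eq (hne : (C.link v).faces.Nonempty) (h : Function.Injective (C.delMap v 0)) :
    C.betti 0 = (C.deletion v).betti 0 := by
  refine (LinearEquiv.ofBijective (C.delMap v 0) ⟨h, fun x => ?_⟩).finrank_eq.symm
  obtain ⟨u, w, rfl⟩ := C.cone_exact_zero v x
  obtain ⟨y, rfl⟩ := C.linkStarMap_surjective hv hne 0 w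
  have h1 := (C.cone_exact_middle v 0 _ _).2 ⟨y, rfl, rfl⟩
  refine ⟨u + C.linkMap v 0 y, ?_⟩
  rw [map_add, eq_of_add_eq_zero h1]

/-- For a connected link, H_0 of the link maps isomorphically to H_0 of the star. The connecting map
is then zero and H_1 of the deletion surjects onto H_1(C), without any injectivity assumption. -/
lemma betti_one_le (hD : (C.deletion v).FiniteHomology) (hL : (C.link v).FiniteHomology)
    (hne : (C.link v).faces.Nonempty) (h : (C.link v).betti 0 = 1) :
    C.betti 1 ≤ (C.deletion v).betti 1 := by
  obtain ⟨δ, h1, h2⟩ := cone_exact_succ hv 0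
  have := finiteHomology_of_cone hv hD hL 1
  have := hL 0
  have := hD 1
  have h4 := LinearMap.finrank_range_add_finrank_ker (C.linkStarMap v 0)
  rw [LinearMap.range_eq_top.2 (C.linkStarMap_surjective hv hne 0), finrank_top,
    C.finrank_openStar hv] at h4
  change 1 + _ = (C.link v).betti 0 at h4
  have h5 : Module.finrank (ZMod 2) (LinearMap.range δ) ≤ 0 := by
    rw [h2]
    refine (Submodule.finrank_mono inf_le_right).trans ?_
    omega
  rw [betti, ← LinearMap.finrank_range_add_finrank_ker δ, h1]
  have h6 : Module.finrank (ZMod 2) (LinearMap.range (C.delMap v (0 + 1))) ≤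
    (C.deletion v).betti 1 := LinearMap.finrank_range_le _
  omega

/-- The alternating sum of dimensions along the end of the Mayer–Vietoris sequence. The vanishing of
β_1 of the link makes H_1(D) → H_1(C) injective and cuts the sequence off on the left. -/
lemma betti_zero_sub_betti_one (hD : (C.deletion v).FiniteHomology)
    (hL : (C.link v).FiniteHomology) (h : (C.link v).betti 1 = 0) :
    (C.betti 0 : ℤ) - C.betti 1 =
      (C.deletion v).betti 0 - (C.deletion v).betti 1 + 1 - (C.link v).betti 0 := by
  have hC := finiteHomology_of_cone hv hD hL
  obtain ⟨δ, h1, h2⟩ := cone_exact_succ hv 0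
  have := hC 1
  have := hC 0
  have := hL 0
  have := hL 1
  have := hD 0
  have := C.finite_openStar hv 0
  have hsub : Subsingleton ((C.link v).homology 1) := Module.finrank_zero_iff.1 h
  have hinj : Function.Injective (C.delMap v 1) := by
    refine (injective_iff_map_eq_zero _).2 fun u hu => ?_
    obtain ⟨y, rfl, -⟩ := (C.cone_exact_middle v 1 u 0).1 (by rw [hu, map_zero, add_zero])
    rw [Subsingleton.elim y 0, map_zero]
  have e1 := LinearMap.finrank_range_add_finrank_ker δ
  rw [h1, h2, LinearMap.finrank_range_of_inj hinj, ← LinearMap.ker_prod] at e1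
  change _ + (C.deletion v).betti 1 = C.betti 1 at e1
  have e2 := LinearMap.finrank_range_add_finrank_ker ((C.linkMap v 0).prod (C.linkStarMap v 0))
  have e3 := LinearMap.finrank_range_add_finrank_ker ((C.delMap v 0).coprod (C.starMap v 0))
  have hr : LinearMap.range ((C.linkMap v 0).prod (C.linkStarMap v 0)) =
      LinearMap.ker ((C.delMap v 0).coprod (C.starMap v 0)) := by
    ext ⟨u, w⟩
    rw [LinearMap.mem_ker, LinearMap.coprod_apply, C.cone_exact_middle v 0 u w]
    simp [LinearMap.mem_range, Prod.ext_iff]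
  have htop : LinearMap.range ((C.delMap v 0).coprod (C.starMap v 0)) = ⊤ := by
    rw [LinearMap.range_eq_top]
    intro x
    obtain ⟨u, w, h⟩ := C.cone_exact_zero v x
    exact ⟨(u, w), h⟩
  rw [htop, finrank_top, ← hr, Module.finrank_prod, C.finrank_openStar hv] at e3
  change _ + _ = (C.link v).betti 0 at e2
  change C.betti 0 + _ = (C.deletion v).betti 0 + 1 at e3
  omega

lemma betti_succ_of_link_empty (hD : (C.deletion v).FiniteHomology)
    (he : (C.link v).faces = ∅) (i : ℕ) :
    C.betti (i + 1) = (C.deletion v).betti (i + 1) := by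
  have hL := finiteHomology_of_empty he
  refine le_antisymm ((betti_succ_le hv hD hL i).trans ?_) ?_
  · rw [betti_of_empty he, add_zero]
  · have hsub := subsingleton_homology_of_empty he (i + 1)
    have := finiteHomology_of_cone hv hD hL (i + 1)
    refine LinearMap.finrank_le_finrank_of_injective (f := C.delMap v (i + 1)) ?_
    refine (injective_iff_map_eq_zero _).2 fun u hu => ?_
    obtain ⟨y, rfl, -⟩ := (C.cone_exact_middle v (i + 1) u 0).1 (by rw [hu, map_zero, add_zero])
    rw [Subsingleton.elim y 0, map_zero]

lemma betti_zero_of_link_empty (hD : (C.deletion v).FiniteHomology)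
    (he : (C.link v).faces = ∅) : C.betti 0 = (C.deletion v).betti 0 + 1 := by
  have h1 := betti_zero_sub_betti_one hv hD (finiteHomology_of_empty he) (betti_of_empty he 1)
  have h2 := betti_succ_of_link_empty hv hD he 0
  rw [betti_of_empty he, zero_add] at *
  omega

end PreAbstractSimplicialComplex

/-! ### Edge paths and connected components -/

namespace PreAbstractSimplicialComplex

open SingularChain

variable {V : Type}

/-- The relation of being joined by an edge path. -/
def Reach (C : PreAbstractSimplicialComplex V) [DecidableEq V] : V → V → Prop :=
  Relation.ReflTransGen fun a b => {a, b} ∈ C.faces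

/-- A set of vertices meeting each connected component in one vertex. -/
structure IsTransversal [DecidableEq V] (C : PreAbstractSimplicialComplex V) (R : Finset V) :
    Prop where
  mem : ∀ r ∈ R, {r} ∈ C.faces
  exists_reach : ∀ v, {v} ∈ C.faces → ∃ r ∈ R, C.Reach r v
  eq_of_reach : ∀ r ∈ R, ∀ r' ∈ R, C.Reach r r' → r = r'

/-- The full subcomplex on a set of vertices. -/
def restrict (C : PreAbstractSimplicialComplex V) (S : Set V) :
    PreAbstractSimplicialComplex V where
  faces := {s | s ∈ C.faces ∧ (s : Set V) ⊆ S}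
  isRelLowerSet_faces := fun _ hs =>
    ⟨(C.isRelLowerSet_faces hs.1).1, fun _ hts ht =>
      ⟨(C.isRelLowerSet_faces hs.1).2 hts ht, fun _ hx => hs.2 (hts hx)⟩⟩

section Reach

variable [Fintype V] [DecidableEq V] {C : PreAbstractSimplicialComplex V}

lemma Reach.refl (a : V) : C.Reach a a := Relation.ReflTransGen.refl

lemma Reach.trans {a b c : V} (h : C.Reach a b) (h' : C.Reach b c) : C.Reach a c :=
  Relation.ReflTransGen.trans h h'

lemma Reach.symm {a b : V} (h : C.Reach a b) : C.Reach b a := by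
  have : Std.Symm fun a b => ({a, b} : Finset V) ∈ C.faces := ⟨fun x y hxy => by
    rw [Finset.pair_comm]
    exact hxy⟩
  exact Relation.ReflTransGen.stdSymm.symm _ _ h

lemma Reach.of_mem {a b : V} (h : {a, b} ∈ C.faces) : C.Reach a b := Relation.ReflTransGen.single h

lemma Reach.of_face {s : Finset V} (hs : s ∈ C.faces) {a b : V} (ha : a ∈ s) (hb : b ∈ s) :
    C.Reach a b :=
  Reach.of_mem (face_mono hs (by simp [Finset.insert_subset_iff, ha, hb]) (by simp))

lemma Reach.mono {D : PreAbstractSimplicialComplex V} (h : C.faces ⊆ D.faces) {a b : V}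
    (hab : C.Reach a b) : D.Reach a b :=
  Relation.ReflTransGen.mono (fun _ _ h' => h h') _ _ hab

lemma vertex_mem {s : Finset V} (hs : s ∈ C.faces) {a : V} (ha : a ∈ s) : {a} ∈ C.faces :=
  face_mono hs (Finset.singleton_subset_iff.2 ha) (Finset.singleton_nonempty a)

lemma Reach.vertex {a b : V} (h : C.Reach a b) (ha : {a} ∈ C.faces) : {b} ∈ C.faces := by
  induction h with
  | refl => exact ha
  | tail _ h _ => exact vertex_mem h (by simp)

lemma exists_isTransversal (C : PreAbstractSimplicialComplex V) :
    ∃ R : Finset V, C.IsTransversal R := by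
  classical
  let S : Setoid V := ⟨C.Reach, Reach.refl, Reach.symm, Reach.trans⟩
  let R : Finset V := Finset.univ.filter fun v => {v} ∈ C.faces ∧ (⟦v⟧ : Quotient S).out = v
  have hout : ∀ v, C.Reach (⟦v⟧ : Quotient S).out v := fun v => Quotient.mk_out (s := S) v
  refine ⟨R, fun r hr => (Finset.mem_filter.1 hr).2.1, fun v hv => ?_, fun r hr r' hr' h => ?_⟩
  · refine ⟨(⟦v⟧ : Quotient S).out, Finset.mem_filter.2 ⟨Finset.mem_univ _,
      (hout v).symm.vertex hv, ?_⟩, hout v⟩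
    rw [Quotient.out_eq]
  · rw [← (Finset.mem_filter.1 hr).2.2, ← (Finset.mem_filter.1 hr').2.2,
      Quotient.sound (s := S) h]

end Reach

variable [Fintype V] [DecidableEq V]

lemma joined_of_reach {C : PreAbstractSimplicialComplex V} {a b : V} (h : C.Reach a b)
    (ha : {a} ∈ C.faces) (hb : {b} ∈ C.faces) :
    Joined (⟨_, C.single_mem_realization ha⟩ : C.realization)
      ⟨_, C.single_mem_realization hb⟩ := by
  induction h with
  | refl => exact Joined.refl _
  | @tail c d _ h ih =>
    have hc := vertex_mem h (show c ∈ ({c, d} : Finset V) by simp)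
    refine (ih hc).trans ?_
    have hseg : ∀ t : unitInterval, (1 - (t : ℝ)) • (Pi.single c (1 : ℝ) : V → ℝ) +
        (t : ℝ) • (Pi.single d (1 : ℝ) : V → ℝ) ∈ C.realization := fun t => by
      have h0 := t.2.1
      have h1 := t.2.2
      refine C.mem_realization.2 ⟨fun v => ?_, ?_, _, h, fun v hv => ?_⟩
      · have e1 : (0 : ℝ) ≤ (Pi.single c (1 : ℝ) : V → ℝ) v := by
          by_cases hw : v = c <;> simp [hw]
        have e2 : (0 : ℝ) ≤ (Pi.single d (1 : ℝ) : V → ℝ) v := by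
          by_cases hw : v = d <;> simp [hw]
        simp only [Pi.add_apply, Pi.smul_apply, smul_eq_mul]
        exact add_nonneg (mul_nonneg (by linarith) e1) (mul_nonneg h0 e2)
      · simp [Finset.sum_add_distrib, ← Finset.mul_sum]
      · simp only [Finset.mem_insert, Finset.mem_singleton, not_or] at hv
        simp [hv.1, hv.2]
    exact ⟨⟨⟨fun t => ⟨_, hseg t⟩, by fun_prop⟩, Subtype.ext (by simp), Subtype.ext (by simp)⟩⟩

lemma joined_single {C : PreAbstractSimplicialComplex V} {x : V → ℝ} (hx : x ∈ C.realization)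
    {v : V} (hv : {v} ∈ C.faces) (h : x v ≠ 0) :
    Joined (⟨_, C.single_mem_realization hv⟩ : C.realization) ⟨x, hx⟩ := by
  have hseg : ∀ t : unitInterval, (t : ℝ) • x + (1 - (t : ℝ)) • (Pi.single v (1 : ℝ) : V → ℝ) ∈
      C.realization := fun t => by
    refine add_smul_mem_realization hx (fun w => ?_) (by simp) (fun w hw => ?_) t.2.1
      (by linarith [t.2.2]) (by ring)
    · by_cases hw : w = v <;> simp [hw]
    · have : w ≠ v := fun e => h (e ▸ hw)
      simp [this]
  exact ⟨⟨⟨fun t => ⟨_, hseg t⟩, by fun_prop⟩, Subtype.ext (by simp), Subtype.ext (by simp)⟩⟩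

-- Along a path, the total barycentric mass on the vertices reachable from a is continuous. It takes
-- only the values 0 and 1, since the vertices of a face are all reachable or all unreachable, so it
-- cannot pass from 1 to 0.
open Classical in
lemma reach_of_joined {C : PreAbstractSimplicialComplex V} {a b : V}
    (ha : {a} ∈ C.faces) (hb : {b} ∈ C.faces)
    (h : Joined (⟨_, C.single_mem_realization ha⟩ : C.realization)
      ⟨_, C.single_mem_realization hb⟩) : C.Reach a b := by
  by_contra hab
  obtain ⟨γ⟩ := h
  let g : unitInterval → ℝ := fun t =>
    ∑ v ∈ Finset.univ.filter (fun v => C.Reach a v), (γ t : V → ℝ) v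
  have hg : Continuous g := by fun_prop
  have h0 : g 0 = 1 := by
    simp [g, Finset.sum_pi_single', Reach.refl]
  have h1 : g 1 = 0 := by
    simp [g, Finset.sum_pi_single', hab]
  obtain ⟨t, ht⟩ := mem_range_of_exists_le_of_exists_ge hg (c := 2⁻¹)
    ⟨1, by rw [h1]; norm_num⟩ ⟨0, by rw [h0]; norm_num⟩
  obtain ⟨-, e2, s, hs, e3⟩ := C.mem_realization.1 (γ t).2
  by_cases hr : ∃ v ∈ s, C.Reach a v
  · obtain ⟨v, hv, hav⟩ := hr
    have : g t = 1 := by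
      rw [← e2]
      refine Finset.sum_subset (Finset.subset_univ _) fun w _ hw => e3 w fun hws => hw ?_
      exact Finset.mem_filter.2 ⟨Finset.mem_univ _, hav.trans (Reach.of_face hs hv hws)⟩
    norm_num [this] at ht
  · have : g t = 0 := Finset.sum_eq_zero fun w hw => e3 w fun hws =>
      hr ⟨w, hws, (Finset.mem_filter.1 hw).2⟩
    norm_num [this] at ht

/-- The zeroth Betti number is the number of connected components. -/
lemma IsTransversal.betti_zero {C : PreAbstractSimplicialComplex V} {R : Finset V}
    (hR : C.IsTransversal R) : C.betti 0 = R.card := by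
  let f : R → ZerothHomotopy (TopCat.of C.realization) := fun r =>
    ZerothHomotopy.mk ⟨_, C.single_mem_realization (hR.mem r r.2)⟩
  have hf : Function.Bijective f := by
    constructor
    · intro r r' h
      refine Subtype.ext (hR.eq_of_reach r r.2 r' r'.2 (reach_of_joined (hR.mem r r.2)
        (hR.mem r' r'.2) ?_))
      exact Quotient.exact h
    · intro z
      obtain ⟨⟨x, hx⟩, rfl⟩ := ZerothHomotopy.mk_surjective z
      obtain ⟨v, hv⟩ := face_nonempty (supp_mem hx)
      have hvC := vertex_mem (supp_mem hx) hv
      obtain ⟨r, hr, hrv⟩ := hR.exists_reach v hvC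
      exact ⟨⟨r, hr⟩, Quotient.sound ((joined_of_reach hrv (hR.mem r hr) hvC).trans
        (joined_single hx hvC (mem_supp.1 hv)))⟩
  have : Finite (ZerothHomotopy (TopCat.of C.realization)) := Finite.of_surjective f hf.2
  rw [betti, (finrank_homology_zero _).2, ← Nat.card_congr (Equiv.ofBijective f hf)]
  simp

end PreAbstractSimplicialComplex

/-! ### Linear embeddings, and tightness for full subcomplexes -/

namespace PreAbstractSimplicialComplex

open SingularChain

variable {V : Type} [Fintype V] [DecidableEq V]

/-- The linear extension to barycentric coordinates of a map on the vertices. -/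
abbrev lin {E : Type} [AddCommGroup E] [Module ℝ E] (φ : V → E) : (V → ℝ) →ₗ[ℝ] E :=
  Fintype.linearCombination ℝ φ

lemma mem_of_mem_convexHull_single {s : Set V} {x : V → ℝ}
    (hx : x ∈ convexHull ℝ ((fun v : V => (Pi.single v (1 : ℝ) : V → ℝ)) '' s)) :
    (∑ v, x v = 1 ∧ ∀ v ∉ s, x v = 0) := by
  have key : convexHull ℝ ((fun v : V => (Pi.single v (1 : ℝ) : V → ℝ)) '' s) ⊆
      {x | ∑ v, x v = 1 ∧ ∀ v ∉ s, x v = 0} := by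
    refine convexHull_min ?_ ?_
    · rintro _ ⟨v, hv, rfl⟩
      refine ⟨by simp, fun w hw => ?_⟩
      have : w ≠ v := by rintro rfl; exact hw hv
      simp [this]
    · rintro x ⟨h2, h3⟩ y ⟨k2, k3⟩ a b ha hb hab
      refine ⟨?_, fun v hv => ?_⟩
      · simp [Finset.sum_add_distrib, ← Finset.mul_sum, h2, k2, hab]
      · simp [h3 v hv, k3 v hv]
  exact key hx

lemma convexHull_image_eq {E : Type} [AddCommGroup E] [Module ℝ E] (φ : V → E) (s : Set V) :
    convexHull ℝ (φ '' s) =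
      lin φ '' convexHull ℝ ((fun v : V => (Pi.single v (1 : ℝ) : V → ℝ)) '' s) := by
  rw [(lin φ).image_convexHull, Set.image_image]
  congr 1
  refine Set.image_congr fun v _ => ?_
  simp [lin, Fintype.linearCombination_apply_single]

lemma polyhedron_eq_image {E : Type} [AddCommGroup E] [Module ℝ E]
    (C : PreAbstractSimplicialComplex V) (φ : V → E) :
    C.polyhedron φ = lin φ '' C.realization := by
  simp only [realization, polyhedron, Set.image_iUnion, convexHull_image_eq φ]

lemma isCompact_realization (C : PreAbstractSimplicialComplex V) : IsCompact C.realization := by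
  refine (Set.toFinite C.faces).isCompact_biUnion fun s _ => ?_
  exact (Set.toFinite _).isCompact_convexHull (𝕜 := ℝ)

lemma eq_of_affineIndependent {E : Type} [AddCommGroup E] [Module ℝ E] {φ : V → E}
    {s : Finset V} (h : AffineIndependent ℝ (fun v : s => φ v)) {x y : V → ℝ}
    (hx : ∑ v, x v = 1) (hy : ∑ v, y v = 1) (hx0 : ∀ v ∉ s, x v = 0) (hy0 : ∀ v ∉ s, y v = 0)
    (hxy : lin φ x = lin φ y) : x = y := by
  rw [affineIndependent_iff] at h
  have key : ∀ v, v ∉ s → x v - y v = 0 := fun v hv => by rw [hx0 v hv, hy0 v hv, sub_zero]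
  have h1 := h Finset.univ (fun v => x v - y v) (by
    rw [Finset.sum_coe_sort s fun v => x v - y v]
    rw [Finset.sum_subset (Finset.subset_univ s) fun v _ hv => key v hv, Finset.sum_sub_distrib,
      hx, hy, sub_self]) (by
    rw [Finset.sum_coe_sort s fun v => (x v - y v) • φ v]
    rw [Finset.sum_subset (Finset.subset_univ s) fun v _ hv => by rw [key v hv, zero_smul]]
    simp only [lin, Fintype.linearCombination_apply] at hxy
    simp only [sub_smul, Finset.sum_sub_distrib, hxy, sub_self])
  ext v
  by_cases hv : v ∈ s
  · exact sub_eq_zero.1 (h1 ⟨v, hv⟩ (Finset.mem_univ _))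
  · exact sub_eq_zero.1 (key v hv)

/-- Two points with the same image share it with a point of the common face, by the intersection
condition; affine independence in each simplex identifies both with that point. The later arguments
use linear embeddings only through this injectivity, which passes to subcomplexes. -/
lemma IsLinearEmbedding.injOn {E : Type} [AddCommGroup E] [Module ℝ E]
    {C : PreAbstractSimplicialComplex V} {φ : V → E} (h : C.IsLinearEmbedding φ) :
    Set.InjOn (lin φ) C.realization := by
  intro x hx y hy hxy
  obtain ⟨s, hs, hxs⟩ := Set.mem_iUnion₂.1 hx
  obtain ⟨t, ht, hyt⟩ := Set.mem_iUnion₂.1 hy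
  have h1 : lin φ x ∈ convexHull ℝ (φ '' (s : Set V)) ∩ convexHull ℝ (φ '' (t : Set V)) := by
    refine ⟨?_, ?_⟩
    · rw [convexHull_image_eq]
      exact ⟨x, hxs, rfl⟩
    · rw [convexHull_image_eq]
      exact ⟨y, hyt, hxy.symm⟩
  rw [h.inter_eq s hs t ht, convexHull_image_eq] at h1
  obtain ⟨z, hz, hzx⟩ := h1
  have hx' := mem_of_mem_convexHull_single hxs
  have hy' := mem_of_mem_convexHull_single hyt
  have hz' := mem_of_mem_convexHull_single hz
  have e1 := eq_of_affineIndependent (h.affineIndependent s hs) hx'.1 hz'.1 hx'.2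
    (fun v hv => hz'.2 v fun hv' => hv hv'.1) hzx.symm
  have e2 := eq_of_affineIndependent (h.affineIndependent t ht) hy'.1 hz'.1 hy'.2
    (fun v hv => hz'.2 v fun hv' => hv hv'.2) (hxy.symm.trans hzx.symm)
  rw [e1, e2]

lemma restrict_faces_subset (C : PreAbstractSimplicialComplex V) (S : Set V) :
    (C.restrict S).faces ⊆ C.faces := fun _ h => h.1

section Upper

variable {C : PreAbstractSimplicialComplex V} {E : Type} [NormedAddCommGroup E]
  [InnerProductSpace ℝ E] {φ : V → E} (π : E)

/-- The sum of the barycentric coordinates at the vertices above a level. -/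
def upperMass (φ : V → E) (t : ℝ) (x : V → ℝ) : ℝ := ∑ v with t < inner ℝ π (φ v), x v

lemma upperMass_pos {t : ℝ} {x : V → ℝ} (h0 : ∀ v, 0 ≤ x v) (h1 : ∑ v, x v = 1)
    (h : t < inner ℝ π (lin φ x)) : 0 < upperMass π φ t x := by
  rw [lin, Fintype.linearCombination_apply, inner_sum] at h
  have : ∃ v, t < inner ℝ π (φ v) ∧ x v ≠ 0 := by
    by_contra hcon
    push Not at hcon
    refine absurd h (not_lt.2 ?_)
    calc ∑ v, inner ℝ π (x v • φ v) ≤ ∑ v, x v * t := by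
          refine Finset.sum_le_sum fun v _ => ?_
          rw [inner_smul_right]
          rcases le_or_gt (inner ℝ π (φ v)) t with hv | hv
          · exact mul_le_mul_of_nonneg_left hv (h0 v)
          · rw [hcon v hv, zero_mul, zero_mul]
      _ = t := by rw [← Finset.sum_mul, h1, one_mul]
  obtain ⟨v, hv, hx⟩ := this
  exact Finset.sum_pos' (fun w _ => h0 w) ⟨v, by simp [hv], lt_of_le_of_ne (h0 v) hx.symm⟩

/-- The projection to the full subcomplex on the vertices above a level. -/
def upperProj (φ : V → E) (t : ℝ) (x : V → ℝ) : V → ℝ := fun v =>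
  if t < inner ℝ π (φ v) then (upperMass π φ t x)⁻¹ * x v else 0

lemma upperProj_mem {t : ℝ} {x : V → ℝ} (hx : x ∈ C.realization)
    (h : t < inner ℝ π (lin φ x)) :
    upperProj π φ t x ∈ (C.restrict {v | t < inner ℝ π (φ v)}).realization := by
  obtain ⟨h0, h1, -⟩ := C.mem_realization.1 hx
  have hpos := upperMass_pos π h0 h1 h
  have hsum : ∑ v, upperProj π φ t x v = 1 := by
    simp only [upperProj]
    rw [← Finset.sum_filter, ← Finset.mul_sum]
    exact inv_mul_cancel₀ hpos.ne'
  refine (mem_realization _).2 ⟨fun v => ?_, hsum, ?_⟩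
  · unfold upperProj
    split_ifs
    · exact mul_nonneg (inv_nonneg.2 hpos.le) (h0 v)
    · exact le_rfl
  · refine ⟨(supp x).filter fun v => t < inner ℝ π (φ v), ⟨face_mono (supp_mem hx)
      (Finset.filter_subset _ _) ?_, fun v hv => (Finset.mem_filter.1 hv).2⟩, fun v hv => ?_⟩
    · obtain ⟨v, hv, hv'⟩ := Finset.exists_ne_zero_of_sum_ne_zero hpos.ne'
      exact ⟨v, Finset.mem_filter.2 ⟨mem_supp.2 hv', (Finset.mem_filter.1 hv).2⟩⟩
    · rw [Finset.mem_filter, not_and, mem_supp] at hv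
      unfold upperProj
      split_ifs with hvt
      · rw [not_not.1 fun hne => hv hne hvt, mul_zero]
      · rfl

lemma upperProj_eq {t : ℝ} {x : V → ℝ}
    (hx : x ∈ (C.restrict {v | t < inner ℝ π (φ v)}).realization) : upperProj π φ t x = x := by
  obtain ⟨-, h1, s, hs, h2⟩ := (mem_realization _).1 hx
  have hm : upperMass π φ t x = 1 := by
    rw [← h1]
    refine Finset.sum_subset (Finset.subset_univ _) fun v _ hv => h2 v fun hvs => hv ?_
    exact Finset.mem_filter.2 ⟨Finset.mem_univ _, hs.2 hvs⟩
  ext v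
  unfold upperProj
  split_ifs with hv
  · rw [hm, inv_one, one_mul]
  · exact (h2 v fun hvs => hv (hs.2 hvs)).symm

lemma lt_inner_of_mem {t : ℝ} {x : V → ℝ}
    (hx : x ∈ (C.restrict {v | t < inner ℝ π (φ v)}).realization) :
    t < inner ℝ π (lin φ x) := by
  obtain ⟨h0, h1, s, hs, h2⟩ := (mem_realization _).1 hx
  rw [lin, Fintype.linearCombination_apply, inner_sum]
  have hex : ∃ v, 0 < x v := by
    by_contra hcon
    push Not at hcon
    have : ∑ v, x v ≤ 0 := Finset.sum_nonpos fun v _ => hcon v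
    linarith
  obtain ⟨u, hu⟩ := hex
  have hin : ∀ v, 0 < x v → t < inner ℝ π (φ v) := fun v hv => by
    by_contra hcon
    exact hv.ne' (h2 v fun hvs => hcon (hs.2 hvs))
  calc t = ∑ v, x v * t := by rw [← Finset.sum_mul, h1, one_mul]
    _ < _ := by
      refine Finset.sum_lt_sum (fun v _ => ?_) ⟨u, Finset.mem_univ _, ?_⟩
      · rw [inner_smul_right]
        rcases (h0 v).eq_or_lt with hv | hv
        · rw [← hv, zero_mul, zero_mul]
        · exact mul_le_mul_of_nonneg_left (hin v hv).le (h0 v)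
      · rw [inner_smul_right]
        exact mul_lt_mul_of_pos_left (hin u hu) hu

lemma continuousOn_upperProj (t : ℝ) :
    ContinuousOn (upperProj π φ t) {x | 0 < upperMass π φ t x} := by
  have hc : Continuous (upperMass π φ t) := by unfold upperMass; fun_prop
  refine continuousOn_pi.2 fun v => ?_
  unfold upperProj
  split_ifs
  · refine ContinuousOn.mul (hc.continuousOn.inv₀ fun x hx => ne_of_gt hx) ?_
    fun_prop
  · exact continuousOn_const

/-- Tightness of the polyhedron gives injectivity for the full subcomplexes above a level. -/
lemma injective_of_isPiTight (hφ : C.IsLinearEmbedding φ) (htight : IsPiTight π (C.polyhedron φ))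
    (t : ℝ) (i : ℕ) : Function.Injective (hmap i (inc (realization_mono
      (C.restrict_faces_subset {v | t < inner ℝ π (φ v)})))) := by
  have hcont : Continuous (lin φ) := by
    have : (lin φ : (V → ℝ) → E) = fun x => ∑ v, x v • φ v := by
      ext x; exact Fintype.linearCombination_apply ..
    rw [this]
    fun_prop
  let Φ : C.realization ≃ C.polyhedron φ :=
    (Equiv.Set.imageOfInjOn (lin φ) C.realization hφ.injOn).trans
      (Equiv.setCongr (C.polyhedron_eq_image φ).symm)
  have hΦ : Continuous Φ := Continuous.subtype_mk (hcont.comp continuous_subtype_val) _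
  have := isCompact_iff_compactSpace.1 C.isCompact_realization
  -- A continuous bijection from a compact space to a Hausdorff space.
  let Ψ : C.realization ≃ₜ C.polyhedron φ := hΦ.homeoOfEquivCompactToT2
  have hΨ : ∀ x, (Ψ x : E) = lin φ x := fun x => rfl
  let R := C.restrict {v | t < inner ℝ π (φ v)}
  have hR : R.realization ⊆ C.realization := realization_mono (C.restrict_faces_subset _)
  let A := {x : E | t < inner ℝ π x} ∩ C.polyhedron φ
  let f : TopCat.of R.realization ⟶ TopCat.of A := TopCat.ofHom
    ⟨fun x => ⟨Ψ ⟨x, hR x.2⟩, lt_inner_of_mem π x.2, (Ψ ⟨x, hR x.2⟩).2⟩, by fun_prop⟩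
  have hlow : ∀ y : A, t < inner ℝ π (lin φ (Ψ.symm ⟨y, y.2.2⟩ : C.realization)) := fun y => by
    rw [← hΨ, Homeomorph.apply_symm_apply]
    exact y.2.1
  let g : TopCat.of A ⟶ TopCat.of R.realization := TopCat.ofHom
    ⟨fun y => ⟨upperProj π φ t (Ψ.symm ⟨y, y.2.2⟩ : C.realization),
      upperProj_mem π (Ψ.symm ⟨y, y.2.2⟩).2 (hlow y)⟩, by
      refine Continuous.subtype_mk ?_ _
      refine (continuousOn_upperProj π t).comp_continuous (f := fun y : A =>
        ((Ψ.symm ⟨y, y.2.2⟩ : C.realization) : V → ℝ)) (by fun_prop) fun y => ?_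
      obtain ⟨h0, h1, -⟩ := C.mem_realization.1 (Ψ.symm ⟨y, y.2.2⟩).2
      exact upperMass_pos π h0 h1 (hlow y)⟩
  have hfg : f ≫ g = 𝟙 _ := ConcreteCategory.hom_ext _ _ fun x => Subtype.ext (by
    change upperProj π φ t (Ψ.symm (Ψ ⟨x, hR x.2⟩) : C.realization) = x
    rw [Homeomorph.symm_apply_apply]
    exact upperProj_eq π x.2)
  let k : TopCat.of C.realization ⟶ TopCat.of (C.polyhedron φ) := TopCat.ofHom ⟨Ψ, by fun_prop⟩
  have hsq : f ≫ inc Set.inter_subset_right = inc hR ≫ k :=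
    ConcreteCategory.hom_ext _ _ fun x => rfl
  -- Only injectivity of f on homology is needed, so the retraction g suffices and no homotopy from
  -- f after g to the identity is required.
  have h1 : Function.Injective (hmap i f) := by
    refine Function.LeftInverse.injective (g := hmap i g) fun x => ?_
    rw [← hmap_comp, hfg, hmap_id]
  have h2 : Function.Injective (hmap i (inc (Set.inter_subset_right :
    A ⊆ C.polyhedron φ))) := htight t i
  have h3 := h2.comp h1
  intro x y hxy
  refine h3 ?_
  rw [Function.comp_apply, Function.comp_apply, ← hmap_comp, ← hmap_comp, hsq, hmap_comp,
    hmap_comp]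
  exact congrArg _ hxy

end Upper

end PreAbstractSimplicialComplex

/-! ### Build-ups and discrete Morse functions -/

namespace PreAbstractSimplicialComplex

variable {V : Type} [DecidableEq V]

/-- `Build K c`: the family `K` of faces is built up by attaching critical faces, of which `c k`
have `k` vertices, and pairs consisting of a face and a free facet of it. -/
inductive Build : Set (Finset V) → (ℕ → ℕ) → Prop
  | empty : Build ∅ 0
  | crit {K : Set (Finset V)} {c : ℕ → ℕ} (σ : Finset V) (h : Build K c) (hne : σ.Nonempty)
      (hσ : σ ∉ K) (hb : ∀ τ, τ.Nonempty → τ ⊂ σ → τ ∈ K) :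
      Build (insert σ K) (c + Pi.single σ.card 1)
  | pair {K : Set (Finset V)} {c : ℕ → ℕ} (σ : Finset V) (x : V) (h : Build K c)
      (hne : σ.Nonempty) (hx : x ∉ σ) (hσ : σ ∉ K) (hxσ : insert x σ ∉ K)
      (hb : ∀ τ, τ.Nonempty → τ ⊂ insert x σ → τ ≠ σ → τ ∈ K) :
      Build (insert σ (insert (insert x σ) K)) c

lemma Build.lower {K : Set (Finset V)} {c : ℕ → ℕ} (h : Build K c) :
    ∀ σ ∈ K, σ.Nonempty ∧ ∀ τ, τ.Nonempty → τ ⊆ σ → τ ∈ K := by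
  induction h with
  | empty => exact fun σ h => h.elim
  | crit ρ h hne hσ hb ih =>
    rintro σ (rfl | hσK)
    · refine ⟨hne, fun τ hτ hτσ => ?_⟩
      rcases hτσ.eq_or_ssubset with rfl | h
      · exact Or.inl rfl
      · exact Or.inr (hb τ hτ h)
    · exact ⟨(ih σ hσK).1, fun τ hτ hτσ => Or.inr ((ih σ hσK).2 τ hτ hτσ)⟩
  | pair ρ x h hne hx hσ hxσ hb ih =>
    rintro σ (rfl | rfl | hσK)
    · refine ⟨hne, fun τ hτ hτσ => ?_⟩
      rcases eq_or_ne τ σ with rfl | h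
      · exact Or.inl rfl
      · exact Or.inr (Or.inr (hb τ hτ (hτσ.trans_ssubset (Finset.ssubset_insert hx)) h))
    · refine ⟨Finset.insert_nonempty _ _, fun τ hτ hτσ => ?_⟩
      rcases hτσ.eq_or_ssubset with rfl | h
      · exact Or.inr (Or.inl rfl)
      · rcases eq_or_ne τ ρ with rfl | h'
        · exact Or.inl rfl
        · exact Or.inr (Or.inr (hb τ hτ h h'))
    · exact ⟨(ih σ hσK).1, fun τ hτ hτσ => Or.inr (Or.inr ((ih σ hσK).2 τ hτ hτσ))⟩

/-- A face is critical for a function on a family of faces. -/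
def CritIn (K : Set (Finset V)) (f : Finset V → ℤ) (σ : Finset V) : Prop :=
  (∀ τ ∈ K, τ ⊂ σ → f τ < f σ) ∧ ∀ τ ∈ K, σ ⊂ τ → f σ < f τ

/-- A discrete Morse function on a family of faces with prescribed numbers of critical faces. -/
structure MorseOn (K : Set (Finset V)) (c : ℕ → ℕ) (f : Finset V → ℤ) (N : ℤ) : Prop where
  mono : ∀ σ ∈ K, ∀ τ ∈ K, σ ⊆ τ → f σ ≤ f τ
  lt : ∀ σ ∈ K, f σ < N
  two : ∀ a, {σ ∈ K | f σ = a}.encard ≤ 2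
  count : ∀ k, {σ ∈ K | σ.card = k ∧ CritIn K f σ}.encard = c k

section Extend

variable {K S : Set (Finset V)} {f : Finset V → ℤ} {N : ℤ}

open Classical in
/-- Extension of a function by a constant on a set. -/
def extendBy (S : Set (Finset V)) (f : Finset V → ℤ) (N : ℤ) : Finset V → ℤ :=
  fun σ => if σ ∈ S then N else f σ

lemma extendBy_of_mem {σ : Finset V} (h : σ ∈ S) : extendBy S f N σ = N := if_pos h

lemma extendBy_of_notMem {σ : Finset V} (h : σ ∉ S) : extendBy S f N σ = f σ := if_neg h

variable (hS : ∀ σ ∈ S, ∀ τ ∈ K, ¬ σ ⊆ τ)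

include hS

lemma extendBy_of_mem_left {σ : Finset V} (h : σ ∈ K) : extendBy S f N σ = f σ :=
  extendBy_of_notMem fun h' => hS σ h' σ h subset_rfl

lemma critIn_extendBy (hlt : ∀ σ ∈ K, f σ < N) {σ : Finset V} (h : σ ∈ K) :
    CritIn (S ∪ K) (extendBy S f N) σ ↔ CritIn K f σ := by
  have e := fun {σ : Finset V} (h : σ ∈ K) => extendBy_of_mem_left (f := f) (N := N) hS h
  constructor
  · rintro ⟨h1, h2⟩
    refine ⟨fun τ hτ hl => ?_, fun τ hτ hl => ?_⟩
    · have := h1 τ (Or.inr hτ) hl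
      rwa [e hτ, e h] at this
    · have := h2 τ (Or.inr hτ) hl
      rwa [e hτ, e h] at this
  · rintro ⟨h1, h2⟩
    refine ⟨?_, ?_⟩
    · rintro τ (hτ | hτ) hl
      · exact absurd hl.subset (hS τ hτ σ h)
      · rw [e hτ, e h]
        exact h1 τ hτ hl
    · rintro τ (hτ | hτ) hl
      · rw [e h, extendBy_of_mem hτ]
        exact hlt σ h
      · rw [e hτ, e h]
        exact h2 τ hτ hl

/-- The value N exceeds all earlier values and no new face lies in an old one. Hence monotonicity
persists and the old faces keep their criticality; only the new faces have to be counted. -/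
lemma MorseOn.extend {c c' : ℕ → ℕ} (h : MorseOn K c f N) (h2 : S.encard ≤ 2)
    (hc : ∀ k, {σ ∈ S | σ.card = k ∧ CritIn (S ∪ K) (extendBy S f N) σ}.encard + c k = c' k) :
    MorseOn (S ∪ K) c' (extendBy S f N) (N + 1) := by
  have e := fun {σ : Finset V} (h : σ ∈ K) => extendBy_of_mem_left (f := f) (N := N) hS h
  refine ⟨?_, ?_, fun a => ?_, fun k => ?_⟩
  · rintro σ hσ τ (hτ | hτ) hl
    · rw [extendBy_of_mem hτ]
      rcases hσ with hσ | hσ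
      · rw [extendBy_of_mem hσ]
      · rw [e hσ]
        exact (h.lt σ hσ).le
    · rcases hσ with hσ | hσ
      · exact absurd hl (hS σ hσ τ hτ)
      · rw [e hσ, e hτ]
        exact h.mono σ hσ τ hτ hl
  · rintro σ (hσ | hσ)
    · rw [extendBy_of_mem hσ]
      exact lt_add_one N
    · rw [e hσ]
      exact (h.lt σ hσ).trans (lt_add_one N)
  · by_cases ha : a = N
    · refine (Set.encard_le_encard ?_).trans h2
      rintro σ ⟨hσ | hσ, hf⟩
      · exact hσ
      · rw [e hσ, ha] at hf
        exact absurd hf (h.lt σ hσ).ne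
    · refine (Set.encard_le_encard ?_).trans (h.two a)
      rintro σ ⟨hσ | hσ, hf⟩
      · rw [extendBy_of_mem hσ] at hf
        exact absurd hf.symm ha
      · rw [e hσ] at hf
        exact ⟨hσ, hf⟩
  · rw [← hc k, ← h.count k, ← Set.encard_union_eq]
    · congr 1
      ext σ
      constructor
      · rintro ⟨hσ | hσ, hk, hcr⟩
        · exact Or.inl ⟨hσ, hk, hcr⟩
        · exact Or.inr ⟨hσ, hk, (critIn_extendBy hS h.lt hσ).1 hcr⟩
      · rintro (⟨hσ, hk, hcr⟩ | ⟨hσ, hk, hcr⟩)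
        · exact ⟨Or.inl hσ, hk, hcr⟩
        · exact ⟨Or.inr hσ, hk, (critIn_extendBy hS h.lt hσ).2 hcr⟩
    · rw [Set.disjoint_left]
      rintro σ ⟨hσ, -⟩ ⟨hσ', -⟩
      exact hS σ hσ σ hσ' subset_rfl

end Extend

/-- The values record the order of attachment. A critical face receives a value of its own, whereas
the two faces of a pair share one, which makes both non-critical. -/
lemma Build.exists_morseOn {K : Set (Finset V)} {c : ℕ → ℕ} (h : Build K c) :
    ∃ f N, MorseOn K c f N := by
  induction h with
  | empty => exact ⟨0, 0, by simp, by simp, by simp, by simp⟩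
  | @crit K c σ h hne hσ hb ih =>
    obtain ⟨f, N, hf⟩ := ih
    have hS : ∀ ρ ∈ ({σ} : Set (Finset V)), ∀ τ ∈ K, ¬ ρ ⊆ τ := by
      rintro _ rfl τ hτ hl
      exact hσ ((h.lower τ hτ).2 _ hne hl)
    refine ⟨_, _, MorseOn.extend hS hf (by simp) fun k => ?_⟩
    have hcr : CritIn ({σ} ∪ K) (extendBy {σ} f N) σ := by
      refine ⟨?_, ?_⟩
      · rintro τ (rfl | hτ) hl
        · exact absurd hl (ssubset_irrefl τ)
        · rw [extendBy_of_mem (Set.mem_singleton σ), extendBy_of_mem_left hS hτ]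
          exact hf.lt τ hτ
      · rintro τ (rfl | hτ) hl
        · exact absurd hl (ssubset_irrefl τ)
        · exact absurd hl.subset (hS σ rfl τ hτ)
    by_cases hk : k = σ.card
    · have : {ρ ∈ ({σ} : Set (Finset V)) | ρ.card = k ∧
          CritIn ({σ} ∪ K) (extendBy {σ} f N) ρ} = {σ} := by
        ext ρ
        constructor
        · exact fun h => h.1
        · rintro rfl
          exact ⟨rfl, hk.symm, hcr⟩
      rw [this, Set.encard_singleton, hk, Pi.add_apply, Pi.single_eq_same, add_comm]
      norm_cast
    · have : {ρ ∈ ({σ} : Set (Finset V)) | ρ.card = k ∧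
          CritIn ({σ} ∪ K) (extendBy {σ} f N) ρ} = ∅ := by
        rw [Set.eq_empty_iff_forall_notMem]
        rintro ρ ⟨rfl, h, -⟩
        exact hk h.symm
      rw [this, Set.encard_empty, zero_add, Pi.add_apply, Pi.single_eq_of_ne hk, add_zero]
  | @pair K c σ x h hne hx hσ hxσ hb ih =>
    obtain ⟨f, N, hf⟩ := ih
    have hS : ∀ ρ ∈ ({σ, insert x σ} : Set (Finset V)), ∀ τ ∈ K, ¬ ρ ⊆ τ := by
      rintro ρ (rfl | rfl) τ hτ hl
      · exact hσ ((h.lower τ hτ).2 _ hne hl)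
      · exact hxσ ((h.lower τ hτ).2 _ (Finset.insert_nonempty _ _) hl)
    have hun : insert σ (insert (insert x σ) K) = {σ, insert x σ} ∪ K := by
      rw [Set.insert_union, Set.singleton_union]
    rw [hun]
    refine ⟨_, _, MorseOn.extend hS hf (Set.encard_pair (Finset.ssubset_insert hx).ne).le
      fun k => ?_⟩
    rw [Set.encard_eq_zero.2, zero_add]
    rw [Set.eq_empty_iff_forall_notMem]
    have hl : σ ⊂ insert x σ := Finset.ssubset_insert hx
    have h1 : σ ∈ ({σ, insert x σ} : Set (Finset V)) := Or.inl rfl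
    have h2 : insert x σ ∈ ({σ, insert x σ} : Set (Finset V)) := Or.inr rfl
    rintro ρ ⟨rfl | rfl, -, hcr⟩
    · have := hcr.2 _ (Or.inl h2) hl
      rw [extendBy_of_mem h1, extendBy_of_mem h2] at this
      exact lt_irrefl _ this
    · have := hcr.1 _ (Or.inl h1) hl
      rw [extendBy_of_mem h1, extendBy_of_mem h2] at this
      exact lt_irrefl _ this

/-- A build-up of a complex gives a discrete Morse function. -/
lemma Build.exists_isDiscreteMorse {C : PreAbstractSimplicialComplex V} {c : ℕ → ℕ}
    (h : Build C.faces c) : ∃ f : C.faces → ℤ, C.IsDiscreteMorse f ∧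
      ∀ i, {σ : C.faces | (σ : Finset V).card = i + 1 ∧ C.IsCritical f σ}.encard = c (i + 1) := by
  obtain ⟨f, N, hf⟩ := h.exists_morseOn
  refine ⟨fun σ => f σ, ⟨fun σ τ => hf.mono σ σ.2 τ τ.2, fun a => ?_⟩, fun i => ?_⟩
  · refine le_trans (le_of_eq ?_) (hf.two a)
    rw [← Subtype.val_injective.encard_image]
    congr 1
    ext σ
    constructor
    · rintro ⟨τ, hτ, rfl⟩
      exact ⟨τ.2, hτ⟩
    · rintro ⟨h1, h2⟩
      exact ⟨⟨σ, h1⟩, h2, rfl⟩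
  · rw [← hf.count, ← Subtype.val_injective.encard_image]
    congr 1
    ext σ
    constructor
    · rintro ⟨τ, ⟨h1, h2, h3⟩, rfl⟩
      exact ⟨τ.2, h1, fun ρ hρ => h2 ⟨ρ, hρ⟩, fun ρ hρ => h3 ⟨ρ, hρ⟩⟩
    · rintro ⟨h1, h2, h3, h4⟩
      exact ⟨⟨σ, h1⟩, ⟨h2, fun ρ => h3 ρ ρ.2, fun ρ => h4 ρ ρ.2⟩, rfl⟩

lemma eq_insert_erase_of_ssubset_insert {v : V} {σ τ : Finset V}
    (hτ : τ ⊂ insert v σ) (hv : v ∈ τ) :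
    τ = insert v (τ.erase v) ∧ τ.erase v ⊂ σ := by
  refine ⟨(Finset.insert_erase hv).symm, ?_⟩
  rw [Finset.ssubset_iff_subset_ne]
  refine ⟨Finset.subset_insert_iff.1 hτ.subset, ?_⟩
  rintro rfl
  rw [Finset.insert_erase hv] at hτ
  exact ssubset_irrefl _ hτ

/-- The family obtained by attaching the cone over a family of faces. -/
def coneSet (D : Set (Finset V)) (v : V) (M : Set (Finset V)) : Set (Finset V) :=
  insert {v} (D ∪ insert v '' M)

lemma coneSet_insert (D : Set (Finset V)) (v : V) (M : Set (Finset V)) (σ : Finset V) :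
    coneSet D v (insert σ M) = insert (insert v σ) (coneSet D v M) := by
  ext τ
  simp only [coneSet, Set.image_insert_eq, Set.mem_insert_iff, Set.mem_union]
  tauto

lemma insert_notMem_coneSet {D M : Set (Finset V)} {v : V} (hD : ∀ σ ∈ D, v ∉ σ)
    (hM : ∀ σ ∈ M, v ∉ σ) {σ : Finset V} (hσ : σ ∉ M) (hv : v ∉ σ) (hne : σ.Nonempty) :
    insert v σ ∉ coneSet D v M := by
  rintro (h | h | ⟨τ, hτ, h⟩)
  · obtain ⟨w, hw⟩ := hne
    have : w ∈ ({v} : Finset V) := h ▸ Finset.mem_insert_of_mem hw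
    rw [Finset.mem_singleton] at this
    exact hv (this ▸ hw)
  · exact hD _ h (Finset.mem_insert_self v σ)
  · have : τ = σ := by
      rw [← Finset.erase_insert (hM τ hτ), ← Finset.erase_insert hv, h]
    exact hσ (this ▸ hτ)

/-- Critical faces of a cone attached to a family of faces. -/
lemma Build.cone {D : Set (Finset V)} {d : ℕ → ℕ} (hD : Build D d) {v : V}
    (hvD : ∀ σ ∈ D, v ∉ σ) {M : Set (Finset V)} {m : ℕ → ℕ} (hM : Build M m) (hMD : M ⊆ D) :
    M = ∅ ∧ m = 0 ∨ M.Nonempty ∧ ∃ c, Build (coneSet D v M) c ∧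
      ∀ k, c (k + 1) + (if k = 1 then 1 else 0) = d (k + 1) + m k := by
  induction hM with
  | empty => exact Or.inl ⟨rfl, rfl⟩
  | @crit M m σ h hne hσ hb ih =>
    refine Or.inr ⟨⟨σ, Or.inl rfl⟩, ?_⟩
    have hMD' : M ⊆ D := fun τ hτ => hMD (Or.inr hτ)
    have hσD : σ ∈ D := hMD (Or.inl rfl)
    rcases ih hMD' with ⟨rfl, rfl⟩ | ⟨hMne, c, hc, hcd⟩
    -- The first face of M is a critical vertex w. Attaching {v} and {v, w} as a pair absorbs both
    -- the apex and the contribution of w; this is the correction at k = 1.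
    · obtain ⟨w, hw⟩ := hne
      have hσw : σ = {w} := by
        by_contra hcon
        exact hb {w} (Finset.singleton_nonempty w)
          (Finset.ssubset_iff_subset_ne.2 ⟨Finset.singleton_subset_iff.2 hw, Ne.symm hcon⟩)
      subst hσw
      have hwv : w ≠ v := by
        rintro rfl
        exact hvD _ hσD (by simp)
      have := Build.pair (K := D) {v} w hD (Finset.singleton_nonempty v) (by simpa using hwv)
        (fun h => hvD _ h (by simp)) (fun h => hvD _ h (by simp)) (fun τ hτ hl hn => by
          have : τ = {w} := by
            by_cases hvτ : v ∈ τ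
            · rw [Finset.pair_comm] at hl
              obtain ⟨h1, h2⟩ := eq_insert_erase_of_ssubset_insert hl hvτ
              rw [Finset.ssubset_singleton_iff] at h2
              rw [h2] at h1
              exact absurd h1 hn
            · have : τ ⊆ {w} := by
                intro a ha
                have := hl.subset ha
                simp only [Finset.mem_insert, Finset.mem_singleton] at this ⊢
                rcases this with h | rfl
                · exact h
                · exact absurd ha hvτ
              exact (Finset.Nonempty.subset_singleton_iff hτ).1 this
          rw [this]
          exact hσD)
      refine ⟨d, ?_, fun k => ?_⟩
      · convert this using 1
        ext τ
        simp only [coneSet, Set.mem_insert_iff, Set.mem_union, Set.mem_image,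
          Finset.pair_comm w v, insert_empty_eq, Set.mem_singleton_iff, exists_eq_left]
        rw [eq_comm (a := ({v, w} : Finset V))]
        tauto
      · simp [Pi.single_apply]
    -- Once the apex is present, a critical face of M gives a critical face with one vertex more,
    -- hence the shift between the indices of c and m.
    · have hvσ := hvD _ hσD
      have := Build.crit (insert v σ) hc (Finset.insert_nonempty _ _)
        (insert_notMem_coneSet hvD (fun τ hτ => hvD τ (hMD' hτ)) hσ hvσ hne) (fun τ hτ hl => by
          by_cases hvτ : v ∈ τ
          · obtain ⟨h1, h2⟩ := eq_insert_erase_of_ssubset_insert hl hvτ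
            rcases (τ.erase v).eq_empty_or_nonempty with h3 | h3
            · rw [h3] at h1
              exact Or.inl h1
            · exact Or.inr (Or.inr ⟨_, hb _ h3 h2, h1.symm⟩)
          · exact Or.inr (Or.inl ((hD.lower _ hσD).2 τ hτ
              ((Finset.subset_insert_iff_of_notMem hvτ).1 hl.subset))))
      refine ⟨_, by rwa [coneSet_insert], fun k => ?_⟩
      have := hcd k
      rw [Finset.card_insert_of_notMem hvσ]
      simp only [Pi.add_apply, Pi.single_apply, Nat.add_right_cancel_iff]
      omega
  | @pair M m σ x h hne hx hσ hxσ hb ih =>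
    refine Or.inr ⟨⟨σ, Or.inl rfl⟩, ?_⟩
    have hMD' : M ⊆ D := fun τ hτ => hMD (Or.inr (Or.inr hτ))
    have hσD : σ ∈ D := hMD (Or.inl rfl)
    have hxσD : insert x σ ∈ D := hMD (Or.inr (Or.inl rfl))
    have hvx := hvD _ hxσD
    have hvσ := hvD _ hσD
    -- The vertex x is a proper face of the larger face of the pair and differs from σ, so it is
    -- present already. A pair can therefore never be the first step, and the apex has been
    -- attached.
    have hxM : {x} ∈ M := by
      refine hb {x} (Finset.singleton_nonempty x) ?_ ?_
      · refine Finset.ssubset_iff_subset_ne.2 ⟨by simp, fun h' => ?_⟩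
        obtain ⟨w, hw⟩ := hne
        have : w ∈ ({x} : Finset V) := h' ▸ Finset.mem_insert_of_mem hw
        rw [Finset.mem_singleton] at this
        exact hx (this ▸ hw)
      · rintro rfl
        exact hx (Finset.mem_singleton_self x)
    rcases ih hMD' with ⟨rfl, -⟩ | ⟨hMne, c, hc, hcd⟩
    · exact hxM.elim
    · have hMv : ∀ τ ∈ M, v ∉ τ := fun τ hτ => hvD τ (hMD' hτ)
      have := Build.pair (insert v σ) x hc (Finset.insert_nonempty _ _)
        (by
          rw [Finset.mem_insert, not_or]
          exact ⟨fun e => hvx (by simp [e]), hx⟩)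
        (insert_notMem_coneSet hvD hMv hσ hvσ hne)
        (by
          rw [Finset.insert_comm]
          exact insert_notMem_coneSet hvD hMv hxσ hvx (Finset.insert_nonempty _ _))
        (fun τ hτ hl hn => by
          rw [Finset.insert_comm] at hl
          by_cases hvτ : v ∈ τ
          · obtain ⟨h1, h2⟩ := eq_insert_erase_of_ssubset_insert hl hvτ
            rcases (τ.erase v).eq_empty_or_nonempty with h3 | h3
            · rw [h3] at h1
              exact Or.inl h1
            · refine Or.inr (Or.inr ⟨_, hb _ h3 h2 fun e => ?_, h1.symm⟩)
              rw [e] at h1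
              exact hn h1
          · exact Or.inr (Or.inl ((hD.lower _ hxσD).2 τ hτ
              ((Finset.subset_insert_iff_of_notMem hvτ).1 hl.subset))))
      refine ⟨c, ?_, hcd⟩
      rwa [coneSet_insert, coneSet_insert, Finset.insert_comm]

section Vertex

variable {C : PreAbstractSimplicialComplex V} {v : V}

lemma coneSet_deletion_link (hv : {v} ∈ C.faces) :
    coneSet (C.deletion v).faces v (C.link v).faces = C.faces := by
  ext s
  constructor
  · rintro (rfl | h | ⟨t, ht, rfl⟩)
    · exact hv
    · exact h.1
    · exact ht.2.2
  · intro hs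
    by_cases hvs : v ∈ s
    · rcases (s.erase v).eq_empty_or_nonempty with h | h
      · refine Or.inl ?_
        rw [← Finset.insert_erase hvs, h]
        rfl
      · refine Or.inr (Or.inr ⟨s.erase v, ⟨h, by simp, ?_⟩, Finset.insert_erase hvs⟩)
        rwa [Finset.insert_erase hvs]
    · exact Or.inr (Or.inl ⟨hs, hvs⟩)

lemma Build.of_link_empty {d : ℕ → ℕ} (hv : {v} ∈ C.faces) (hD : Build (C.deletion v).faces d)
    (hL : (C.link v).faces = ∅) : Build C.faces (d + Pi.single 1 1) := by
  have := Build.crit {v} hD (Finset.singleton_nonempty v) (fun h => h.2 (by simp))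
    (fun τ hτ hl => absurd (Finset.ssubset_singleton_iff.1 hl) hτ.ne_empty)
  rw [← coneSet_deletion_link hv, hL]
  simpa [coneSet] using this

end Vertex

end PreAbstractSimplicialComplex

/-! ### Euler characteristic -/

namespace PreAbstractSimplicialComplex

variable {V : Type} [Fintype V] [DecidableEq V]

open Classical in
/-- The Euler characteristic of a family of faces. -/
def chi (K : Set (Finset V)) : ℤ := ∑ s : Finset V with s ∈ K, (-1) ^ (s.card + 1)

@[simp]
lemma chi_empty : chi (∅ : Set (Finset V)) = 0 := by simp [chi]

lemma chi_insert {K : Set (Finset V)} {σ : Finset V} (h : σ ∉ K) :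
    chi (insert σ K) = chi K + (-1) ^ (σ.card + 1) := by
  classical
  unfold chi
  have h' : σ ∉ Finset.univ.filter fun s => s ∈ K := by simpa using h
  rw [add_comm]
  refine Eq.trans ?_ ((Finset.sum_insert (f := fun s => (-1 : ℤ) ^ (s.card + 1)) h').trans ?_)
  · refine Finset.sum_congr ?_ fun _ _ => rfl
    ext τ
    simp
  · congr!

lemma chi_pair {K : Set (Finset V)} {σ : Finset V} {x : V} (hx : x ∉ σ) (h : σ ∉ K)
    (h' : insert x σ ∉ K) : chi (insert σ (insert (insert x σ) K)) = chi K := by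
  rw [chi_insert, chi_insert h', Finset.card_insert_of_notMem hx]
  · ring
  · rintro (e | e)
    · exact (Finset.ssubset_insert hx).ne e
    · exact h e

/-- The two faces of a pair have opposite signs, so only critical faces contribute. The bound on N
ensures that the sum covers every possible number of vertices. -/
lemma Build.chi_eq {K : Set (Finset V)} {c : ℕ → ℕ} (h : Build K c) {N : ℕ}
    (hN : Fintype.card V < N) : chi K = ∑ k ∈ Finset.range N, (-1) ^ (k + 1) * (c k : ℤ) := by
  induction h with
  | empty => simp
  | crit σ h hne hσ hb ih =>
    rw [chi_insert hσ, ih]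
    have : σ.card ∈ Finset.range N :=
      Finset.mem_range.2 ((Finset.card_le_univ σ).trans_lt hN)
    simp only [Pi.add_apply, Nat.cast_add, mul_add, Finset.sum_add_distrib]
    congr 1
    rw [Finset.sum_eq_single_of_mem _ this]
    · simp
    · intro b _ hb
      simp [Pi.single_eq_of_ne hb]
  | pair σ x h hne hx hσ hxσ hb ih => rw [chi_pair hx hσ hxσ, ih]

lemma chi_union {K L : Set (Finset V)} (h : Disjoint K L) : chi (K ∪ L) = chi K + chi L := by
  classical
  unfold chi
  rw [← Finset.sum_union]
  · refine Finset.sum_congr ?_ fun _ _ => rfl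
    ext τ
    simp
  · rw [Finset.disjoint_left]
    simp only [Finset.mem_filter, Finset.mem_univ, true_and]
    exact fun _ h1 h2 => Set.disjoint_left.1 h h1 h2

lemma chi_image_insert {M : Set (Finset V)} {v : V} (hM : ∀ σ ∈ M, v ∉ σ) :
    chi (insert v '' M) = -chi M := by
  classical
  unfold chi
  rw [← Finset.sum_neg_distrib]
  symm
  refine Finset.sum_bij (fun σ _ => insert v σ) (fun σ hσ => ?_) (fun σ hσ τ hτ h => ?_)
    (fun σ hσ => ?_) fun σ hσ => ?_
  · simp only [Finset.mem_filter, Finset.mem_univ, true_and] at hσ ⊢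
    exact ⟨σ, hσ, rfl⟩
  · simp only [Finset.mem_filter, Finset.mem_univ, true_and] at hσ hτ
    rw [← Finset.erase_insert (hM σ hσ), h, Finset.erase_insert (hM τ hτ)]
  · simp only [Finset.mem_filter, Finset.mem_univ, true_and] at hσ
    obtain ⟨τ, hτ, rfl⟩ := hσ
    exact ⟨τ, by simpa using hτ, rfl⟩
  · simp only [Finset.mem_filter, Finset.mem_univ, true_and] at hσ
    rw [Finset.card_insert_of_notMem (hM σ hσ)]
    ring

/-- Besides {v}, the faces containing v are those of the link with one vertex added, which reverses
their signs. -/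
lemma chi_deletion_link {C : PreAbstractSimplicialComplex V} {v : V} (hv : {v} ∈ C.faces) :
    chi C.faces = chi (C.deletion v).faces + 1 - chi (C.link v).faces := by
  rw [← coneSet_deletion_link hv, coneSet, chi_insert, chi_union, chi_image_insert]
  · simp
    ring
  · exact fun σ hσ => hσ.2.1
  · rw [Set.disjoint_left]
    rintro _ h ⟨τ, -, rfl⟩
    exact h.2 (Finset.mem_insert_self v τ)
  · rintro (h | ⟨τ, hτ, h⟩)
    · exact h.2 (Finset.mem_singleton_self v)
    · obtain ⟨w, hw⟩ := hτ.1
      have : w ∈ ({v} : Finset V) := h ▸ Finset.mem_insert_of_mem hw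
      rw [Finset.mem_singleton] at this
      exact hτ.2.1 (this ▸ hw)

end PreAbstractSimplicialComplex

/-! ### Vertex figures and embeddability in dimension d -/

namespace PreAbstractSimplicialComplex

variable {V : Type} [Fintype V] [DecidableEq V]

/-- The complex can be linearly embedded in a real vector space of dimension `d`. -/
def Emb (C : PreAbstractSimplicialComplex V) (d : ℕ) : Prop :=
  ∃ φ : V → (Fin d → ℝ), Set.InjOn (lin φ) C.realization

lemma lin_comp {E F : Type} [AddCommGroup E] [Module ℝ E] [AddCommGroup F] [Module ℝ F]
    (φ : V → E) (g : E →ₗ[ℝ] F) (x : V → ℝ) : lin (fun v => g (φ v)) x = g (lin φ x) := by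
  simp [lin, Fintype.linearCombination_apply]

lemma Emb.of_space {C : PreAbstractSimplicialComplex V} {E : Type} [AddCommGroup E] [Module ℝ E]
    [Module.Finite ℝ E] {d : ℕ} (hd : Module.finrank ℝ E = d) {φ : V → E}
    (h : Set.InjOn (lin φ) C.realization) : C.Emb d := by
  have e : E ≃ₗ[ℝ] (Fin d → ℝ) := LinearEquiv.ofFinrankEq _ _ (by simp [hd])
  refine ⟨fun v => e.toLinearMap (φ v), fun x hx y hy hxy => h hx hy ?_⟩
  rw [lin_comp, lin_comp] at hxy
  exact e.injective hxy

lemma Emb.mono {C D : PreAbstractSimplicialComplex V} {d : ℕ} (h : C.Emb d)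
    (hD : D.faces ⊆ C.faces) : D.Emb d := by
  obtain ⟨φ, hφ⟩ := h
  exact ⟨φ, hφ.mono (realization_mono hD)⟩

lemma Emb.of_empty {C : PreAbstractSimplicialComplex V} (h : C.faces = ∅) (d : ℕ) : C.Emb d := by
  refine ⟨0, fun x hx => ?_⟩
  have := supp_mem hx
  rw [h] at this
  exact this.elim

/-- The link of a vertex which is the lowest for a linear functional can be embedded in a
hyperplane. -/
lemma emb_link {C : PreAbstractSimplicialComplex V} {E : Type} [AddCommGroup E] [Module ℝ E]
    [Module.Finite ℝ E] {d : ℕ} (hd : Module.finrank ℝ E = d + 1) {φ : V → E}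
    (hφ : Set.InjOn (lin φ) C.realization) (h : Module.Dual ℝ E) {v : V}
    (hlow : ∀ w, w ≠ v → {w} ∈ C.faces → h (φ v) < h (φ w)) : (C.link v).Emb d := by
  rcases Set.eq_empty_or_nonempty (C.link v).faces with hL | ⟨s, hs⟩
  · exact Emb.of_empty hL d
  have hgap : ∀ s ∈ (C.link v).faces, ∀ w ∈ s, 0 < h (φ w) - h (φ v) := fun s hs w hw => by
    have hwv : w ≠ v := fun e => hs.2.1 (e ▸ hw)
    have := hlow w hwv (vertex_mem hs.2.2 (Finset.mem_insert_of_mem hw))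
    linarith
  -- Each neighbour of v is moved along its ray from φ v until h exceeds h (φ v) by 1; ψ is its
  -- position relative to φ v. At vertices outside the link the value is irrelevant, because the
  -- coordinates of points of the link vanish there.
  let a : V → ℝ := fun w => h (φ w) - h (φ v)
  let ψ : V → E := fun w => (a w)⁻¹ • (φ w - φ v)
  have hψ : ∀ s ∈ (C.link v).faces, ∀ w ∈ s, h (ψ w) = 1 := fun s hs w hw => by
    simp only [ψ, map_smul, map_sub, smul_eq_mul]
    exact inv_mul_cancel₀ (hgap s hs w hw).ne'
  obtain ⟨w₀, hw₀⟩ := hs.1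
  have hh : h ≠ 0 := by
    rintro rfl
    have := hgap s hs w₀ hw₀
    simp at this
  let p := ψ w₀
  have hp : h p = 1 := hψ s hs w₀ hw₀
  -- Projection to the kernel along p. It is injective on the affine hyperplane h = 1, which
  -- contains the image of the link, and lowers the dimension by one.
  let q : E →ₗ[ℝ] LinearMap.ker h :=
    (LinearMap.id - h.smulRight p).codRestrict (LinearMap.ker h) fun z => by simp [hp]
  have hhψ : ∀ x ∈ (C.link v).realization, h (lin ψ x) = 1 := fun x hx => by
    obtain ⟨-, h2, t, ht, h3⟩ := (mem_realization _).1 hx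
    rw [← lin_comp ψ h, lin, Fintype.linearCombination_apply, ← h2]
    refine Finset.sum_congr rfl fun w _ => ?_
    by_cases hw : w ∈ t
    · rw [hψ t ht w hw, smul_eq_mul, mul_one]
    · rw [h3 w hw, zero_smul]
  have hdim : Module.finrank ℝ (LinearMap.ker h) = d := by
    have := Module.Dual.finrank_ker_add_one_of_ne_zero hh
    omega
  refine Emb.of_space hdim (φ := fun w => q (ψ w)) fun x hx y hy hxy => ?_
  have hxy' : lin ψ x = lin ψ y := by
    rw [lin_comp, lin_comp] at hxy
    have := congrArg Subtype.val hxy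
    change lin ψ x - h (lin ψ x) • p = lin ψ y - h (lin ψ y) • p at this
    rw [hhψ x hx, hhψ y hy] at this
    exact sub_left_injective this
  -- A point sufficiently close to φ v on the ray in direction `lin ψ x` is the image of a point of
  -- the cone from v over the link, with explicit coordinates. Thus equal directions give equal
  -- points of C, where φ is injective.
  have key : ∀ x ∈ (C.link v).realization,
      (∀ w, 0 ≤ (a w)⁻¹ * x w) ∧ ∀ ε : ℝ, 0 ≤ ε → ε * ∑ w, (a w)⁻¹ * x w ≤ 1 →
        ((1 - ε * ∑ w, (a w)⁻¹ * x w) • Pi.single v (1 : ℝ) + ε • fun w => (a w)⁻¹ * x w) ∈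
          C.realization ∧
        lin φ ((1 - ε * ∑ w, (a w)⁻¹ * x w) • Pi.single v (1 : ℝ) +
          ε • fun w => (a w)⁻¹ * x w) = φ v + ε • lin ψ x := by
    intro x hx
    obtain ⟨h1, h2, t, ht, h3⟩ := (mem_realization _).1 hx
    have h0 : ∀ w, 0 ≤ (a w)⁻¹ * x w := fun w => by
      by_cases hw : w ∈ t
      · exact mul_nonneg (inv_nonneg.2 (hgap t ht w hw).le) (h1 w)
      · rw [h3 w hw, mul_zero]
    refine ⟨h0, fun ε hε hε1 => ⟨C.mem_realization.2 ⟨fun w => ?_, ?_, insert v t, ht.2.2,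
      fun w hw => ?_⟩, ?_⟩⟩
    · have : (0 : ℝ) ≤ (Pi.single v (1 : ℝ) : V → ℝ) w := by
        by_cases hw : w = v <;> simp [hw]
      simp only [Pi.add_apply, Pi.smul_apply, smul_eq_mul]
      exact add_nonneg (mul_nonneg (by linarith) this) (mul_nonneg hε (h0 w))
    · simp only [Pi.add_apply, Pi.smul_apply, smul_eq_mul, Finset.sum_add_distrib,
        ← Finset.mul_sum, Finset.sum_pi_single', Finset.mem_univ, if_true]
      ring
    · rw [Finset.mem_insert, not_or] at hw
      simp [hw.1, h3 w hw.2]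
    · rw [map_add, map_smul, map_smul, lin, Fintype.linearCombination_apply_single, one_smul,
        Fintype.linearCombination_apply, Fintype.linearCombination_apply]
      have e : ∀ w, x w • ψ w = ((a w)⁻¹ * x w) • φ w - ((a w)⁻¹ * x w) • φ v := fun w => by
        simp only [ψ]
        rw [smul_smul, mul_comm, smul_sub]
      simp only [e, Finset.sum_sub_distrib, ← Finset.sum_smul]
      module
  obtain ⟨hx0, hx1⟩ := key x hx
  obtain ⟨hy0, hy1⟩ := key y hy
  set A := ∑ w, (a w)⁻¹ * x w with hA
  set B := ∑ w, (a w)⁻¹ * y w with hB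
  have hA0 : 0 ≤ A := Finset.sum_nonneg fun w _ => hx0 w
  have hB0 : 0 ≤ B := Finset.sum_nonneg fun w _ => hy0 w
  have hpos : 0 < 1 + A + B := by linarith
  -- One value of ε that is small enough for both x and y.
  obtain ⟨mx, ex⟩ := hx1 (1 + A + B)⁻¹ (inv_nonneg.2 hpos.le)
    (by rw [inv_mul_le_one₀ hpos]; linarith)
  obtain ⟨my, ey⟩ := hy1 (1 + A + B)⁻¹ (inv_nonneg.2 hpos.le)
    (by rw [inv_mul_le_one₀ hpos]; linarith)
  have heq := hφ mx my (by rw [ex, ey, hxy'])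
  obtain ⟨-, -, s, hs, hs0⟩ := (mem_realization _).1 hx
  obtain ⟨-, -, t, ht, ht0⟩ := (mem_realization _).1 hy
  ext w
  by_cases hw : w ∈ s ∨ w ∈ t
  · have hwv : w ≠ v := by
      rintro rfl
      rcases hw with hw | hw
      · exact hs.2.1 hw
      · exact ht.2.1 hw
    have ha : 0 < a w := by
      rcases hw with hw | hw
      · exact hgap s hs w hw
      · exact hgap t ht w hw
    have := congrFun heq w
    simp only [Pi.add_apply, Pi.smul_apply, smul_eq_mul, Pi.single_eq_of_ne hwv, mul_zero,
      zero_add] at this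
    exact mul_left_cancel₀ (inv_ne_zero ha.ne') (mul_left_cancel₀ (inv_ne_zero hpos.ne') this)
  · rw [not_or] at hw
    rw [hs0 w hw.1, ht0 w hw.2]

/-- The images of distinct vertices differ, and over the infinite field ℝ some functional is nonzero
on each of finitely many nonzero differences. This provides a sweep direction for links, where none
is given. -/
lemma exists_separating_dual {C : PreAbstractSimplicialComplex V} {E : Type} [AddCommGroup E]
    [Module ℝ E] {φ : V → E} (hφ : Set.InjOn (lin φ) C.realization) :
    ∃ h : Module.Dual ℝ E, ∀ v w, {v} ∈ C.faces → {w} ∈ C.faces → h (φ v) = h (φ w) → v = w := by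
  have hinj : ∀ v w, {v} ∈ C.faces → {w} ∈ C.faces → φ v = φ w → v = w := fun v w hv hw e => by
    have := hφ (C.single_mem_realization hv) (C.single_mem_realization hw) (by simpa [lin] using e)
    by_contra hne
    have := congrFun this v
    simp [Pi.single_eq_of_ne hne] at this
  let I := {x : V × V // {x.1} ∈ C.faces ∧ {x.2} ∈ C.faces ∧ x.1 ≠ x.2}
  obtain ⟨h, hh⟩ := Module.exists_dual_forall_apply_ne_zero (K := ℝ)
    (fun i : I => φ i.1.1 - φ i.1.2)
    fun i hi => i.2.2.2 (hinj _ _ i.2.1 i.2.2.1 (sub_eq_zero.1 hi))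
  refine ⟨h, fun v w hv hw e => ?_⟩
  by_contra hne
  exact hh ⟨(v, w), hv, hw, hne⟩ (by rw [map_sub, e, sub_self])

open Classical in
/-- The vertices of a complex. -/
def verts (C : PreAbstractSimplicialComplex V) : Finset V :=
  Finset.univ.filter fun v => {v} ∈ C.faces

lemma mem_verts {C : PreAbstractSimplicialComplex V} {v : V} : v ∈ C.verts ↔ {v} ∈ C.faces := by
  simp [verts]

lemma verts_nonempty {C : PreAbstractSimplicialComplex V} (h : C.faces.Nonempty) :
    C.verts.Nonempty := by
  obtain ⟨s, hs⟩ := h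
  obtain ⟨v, hv⟩ := face_nonempty hs
  exact ⟨v, mem_verts.2 (vertex_mem hs hv)⟩

lemma card_verts_lt {C D : PreAbstractSimplicialComplex V} (h : D.faces ⊆ C.faces) {v : V}
    (hv : {v} ∈ C.faces) (hv' : {v} ∉ D.faces) : D.verts.card < C.verts.card :=
  Finset.card_lt_card (Finset.ssubset_iff_of_subset
    (fun _ hw => mem_verts.2 (h (mem_verts.1 hw))) |>.2
      ⟨v, mem_verts.2 hv, fun h => hv' (mem_verts.1 h)⟩)

lemma card_verts_deletion_lt {C : PreAbstractSimplicialComplex V} {v : V} (hv : {v} ∈ C.faces) :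
    (C.deletion v).verts.card < C.verts.card :=
  card_verts_lt (C.deletion_faces_subset v) hv fun h => h.2 (Finset.mem_singleton_self v)

lemma link_subset (C : PreAbstractSimplicialComplex V) (v : V) : (C.link v).faces ⊆ C.faces :=
  (C.link_faces_subset v).trans (C.deletion_faces_subset v)

lemma card_verts_link_lt {C : PreAbstractSimplicialComplex V} {v : V} (hv : {v} ∈ C.faces) :
    (C.link v).verts.card < C.verts.card :=
  card_verts_lt (C.link_subset v) hv fun h => h.2.1 (Finset.mem_singleton_self v)

lemma exists_isLeast {C : PreAbstractSimplicialComplex V} (h : V → ℝ)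
    (hh : ∀ v w, {v} ∈ C.faces → {w} ∈ C.faces → h v = h w → v = w) (hne : C.faces.Nonempty) :
    ∃ v, {v} ∈ C.faces ∧ ∀ w, w ≠ v → {w} ∈ C.faces → h v < h w := by
  obtain ⟨v, hv, hmin⟩ := C.verts.exists_min_image h (verts_nonempty hne)
  refine ⟨v, mem_verts.1 hv, fun w hwv hw => ?_⟩
  exact lt_of_le_of_ne (hmin w (mem_verts.2 hw)) fun e => hwv (hh v w (mem_verts.1 hv) hw e).symm

lemma Emb.exists_link {C : PreAbstractSimplicialComplex V} {d : ℕ} (hC : C.Emb (d + 1))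
    (hne : C.faces.Nonempty) : ∃ v, {v} ∈ C.faces ∧ (C.link v).Emb d := by
  obtain ⟨φ, hφ⟩ := hC
  obtain ⟨h, hh⟩ := exists_separating_dual hφ
  obtain ⟨v, hv, hlow⟩ := exists_isLeast (fun v => h (φ v)) hh hne
  exact ⟨v, hv, emb_link (by simp) hφ h hlow⟩

/-- The lowest and the highest vertex in a generic direction are different once there are two
vertices, so one of them is not r; both have links that embed one dimension lower. -/
lemma Emb.exists_link_ne {C : PreAbstractSimplicialComplex V} {d : ℕ} (hC : C.Emb (d + 1))
    {r w : V} (hwr : w ≠ r) (hw : {w} ∈ C.faces) :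
    ∃ v, v ≠ r ∧ {v} ∈ C.faces ∧ (C.link v).Emb d := by
  obtain ⟨φ, hφ⟩ := hC
  obtain ⟨h, hh⟩ := exists_separating_dual hφ
  obtain ⟨v, hv, hlow⟩ := exists_isLeast (fun v => h (φ v)) hh ⟨_, hw⟩
  by_cases hvr : v = r
  · obtain ⟨u, hu, hlow'⟩ := exists_isLeast (fun v => (-h) (φ v))
      (fun a b ha hb e => hh a b ha hb (neg_injective e)) ⟨_, hw⟩
    refine ⟨u, ?_, hu, emb_link (by simp) hφ (-h) hlow'⟩
    rintro rfl
    have h1 := hlow' w hwr hw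
    have h2 := hlow w (by rwa [hvr]) hw
    rw [hvr] at h2
    simp only [LinearMap.neg_apply] at h1
    linarith
  · exact ⟨v, hvr, hv, emb_link (by simp) hφ h hlow⟩

lemma Emb.eq_of_zero {C : PreAbstractSimplicialComplex V} (hC : C.Emb 0) {v w : V}
    (hv : {v} ∈ C.faces) (hw : {w} ∈ C.faces) : v = w := by
  obtain ⟨φ, hφ⟩ := hC
  have := hφ (C.single_mem_realization hv) (C.single_mem_realization hw) (Subsingleton.elim _ _)
  by_contra hne
  have := congrFun this v
  simp [Pi.single_eq_of_ne hne] at this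

lemma Emb.eq_singleton_of_zero {C : PreAbstractSimplicialComplex V} (hC : C.Emb 0) {v : V}
    (hv : {v} ∈ C.faces) {s : Finset V} (hs : s ∈ C.faces) : s = {v} :=
  Finset.eq_singleton_iff_nonempty_unique_mem.2
    ⟨face_nonempty hs, fun _ hw => hC.eq_of_zero (vertex_mem hs hw) hv⟩

/-- Restricting to the face s forces the extremal vertex to lie in s; the rest of s is then a face
of a link embedded one dimension lower. -/
lemma Emb.card_le {C : PreAbstractSimplicialComplex V} {d : ℕ} (hC : C.Emb d) {s : Finset V}
    (hs : s ∈ C.faces) : s.card ≤ d + 1 := by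
  induction d generalizing C s with
  | zero =>
    obtain ⟨v, hv⟩ := face_nonempty hs
    rw [hC.eq_singleton_of_zero (vertex_mem hs hv) hs, Finset.card_singleton]
  | succ d ih =>
    have hR : (C.restrict s).Emb (d + 1) := hC.mono (C.restrict_faces_subset _)
    obtain ⟨v, hv, hL⟩ := hR.exists_link ⟨s, hs, subset_rfl⟩
    have hvs : v ∈ s := hv.2 (by simp)
    rcases (s.erase v).eq_empty_or_nonempty with h | h
    · rw [← Finset.card_erase_add_one hvs, h]
      simp
    · have := ih hL (s := s.erase v) ⟨h, by simp, by
        rw [Finset.insert_erase hvs]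
        exact ⟨hs, subset_rfl⟩⟩
      rw [← Finset.card_erase_add_one hvs]
      omega

/-- The subcomplex generated by the faces with a given number of vertices. -/
def generatedBy (C : PreAbstractSimplicialComplex V) (n : ℕ) : PreAbstractSimplicialComplex V where
  faces := {s | s.Nonempty ∧ ∃ t ∈ C.faces, t.card = n ∧ s ⊆ t}
  isRelLowerSet_faces := fun _ ⟨hs, t, ht, hn, hst⟩ =>
    ⟨hs, fun _ hus hu => ⟨hu, t, ht, hn, hus.trans hst⟩⟩

/-- A complex of full dimension in a vector space has a free facet of a face of top dimension. -/
lemma Emb.exists_free {C : PreAbstractSimplicialComplex V} {d : ℕ} (hC : C.Emb d) {t₀ : Finset V}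
    (ht₀ : t₀ ∈ C.faces) (hcard : t₀.card = d + 1) :
    ∃ e t : Finset V, e.card = d ∧ t ∈ C.faces ∧ t.card = d + 1 ∧ e ⊆ t ∧
      ∀ t' ∈ C.faces, t'.card = d + 1 → e ⊆ t' → t' = t := by
  induction d generalizing C t₀ with
  | zero =>
    -- In dimension 0 there is a single vertex, and the free facet is the empty set.
    refine ⟨∅, t₀, rfl, ht₀, hcard, Finset.empty_subset _, fun t' ht' _ _ => ?_⟩
    obtain ⟨v, hv⟩ := face_nonempty ht₀
    have := vertex_mem ht₀ hv
    rw [hC.eq_singleton_of_zero this ht₀, hC.eq_singleton_of_zero this ht']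
  | succ d ih =>
    -- Keeping only what lies in top faces guarantees that the extremal vertex v belongs to one, so
    -- its link is again of full dimension. A free facet of the link becomes free in C on adding v,
    -- because every top face of C through v has been kept.
    have hsub : (C.generatedBy (d + 2)).faces ⊆ C.faces := fun s ⟨hs, t, ht, _, hst⟩ =>
      face_mono ht hst hs
    obtain ⟨v, ⟨-, t₁, ht₁, hc₁, hvt⟩, hL⟩ := (hC.mono hsub).exists_link
      ⟨t₀, face_nonempty ht₀, t₀, ht₀, hcard, subset_rfl⟩
    have hlink : ∀ t ∈ C.faces, t.card = d + 2 → v ∈ t →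
        t.erase v ∈ ((C.generatedBy (d + 2)).link v).faces ∧ (t.erase v).card = d + 1 :=
      fun t ht hc hvt => by
        have hc' : (t.erase v).card = d + 1 := by
          rw [Finset.card_erase_of_mem hvt, hc]
          rfl
        refine ⟨⟨Finset.card_pos.1 (by omega), by simp, ?_⟩, hc'⟩
        rw [Finset.insert_erase hvt]
        exact ⟨face_nonempty ht, t, ht, hc, subset_rfl⟩
    obtain ⟨h1, h2⟩ := hlink t₁ ht₁ hc₁ (Finset.singleton_subset_iff.1 hvt)
    obtain ⟨e, t, he, ht, hc, het, huniq⟩ := ih hL h1 h2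
    refine ⟨insert v e, insert v t, ?_, hsub ht.2.2, ?_, Finset.insert_subset_insert v het,
      fun t' ht' hc' het' => ?_⟩
    · rw [Finset.card_insert_of_notMem fun h => ht.2.1 (het h), he]
    · rw [Finset.card_insert_of_notMem ht.2.1, hc]
    · have hvt' : v ∈ t' := het' (Finset.mem_insert_self v e)
      obtain ⟨h3, h4⟩ := hlink t' ht' hc' hvt'
      rw [← huniq _ h3 h4 ?_, Finset.insert_erase hvt']
      intro x hx
      exact Finset.mem_erase.2 ⟨fun h => ht.2.1 (h ▸ het hx), het' (Finset.mem_insert_of_mem hx)⟩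

end PreAbstractSimplicialComplex

/-! ### Betti numbers and build-ups of planar complexes -/

namespace PreAbstractSimplicialComplex

variable {V : Type} [Fintype V] [DecidableEq V]

/-- Induction on the number of vertices. -/
lemma induction_verts {p : PreAbstractSimplicialComplex V → Prop}
    (h : ∀ C, (∀ D : PreAbstractSimplicialComplex V, D.verts.card < C.verts.card → p D) → p C)
    (C : PreAbstractSimplicialComplex V) : p C := by
  induction hn : C.verts.card using Nat.strong_induction_on generalizing C with
  | _ n ih =>
    subst hn
    exact h C fun D hD => ih _ hD D rfl

lemma finiteHomology (C : PreAbstractSimplicialComplex V) : C.FiniteHomology := by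
  induction C using induction_verts with
  | h C ih =>
    rcases C.faces.eq_empty_or_nonempty with he | hne
    · exact finiteHomology_of_empty he
    · obtain ⟨v, hv⟩ := verts_nonempty hne
      have hv := mem_verts.1 hv
      exact finiteHomology_of_cone hv (ih _ (card_verts_deletion_lt hv))
        (ih _ (card_verts_link_lt hv))

lemma Emb.deletion {C : PreAbstractSimplicialComplex V} {d : ℕ} (h : C.Emb d) (v : V) :
    (C.deletion v).Emb d := h.mono (C.deletion_faces_subset v)

lemma Emb.link {C : PreAbstractSimplicialComplex V} {d : ℕ} (h : C.Emb d) (v : V) :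
    (C.link v).Emb d := h.mono (C.link_subset v)

lemma Emb.link_eq_empty {C : PreAbstractSimplicialComplex V} (hC : C.Emb 0) {v : V}
    (hv : {v} ∈ C.faces) : (C.link v).faces = ∅ := by
  rw [Set.eq_empty_iff_forall_notMem]
  intro s hs
  rw [hC.eq_singleton_of_zero hv (C.link_subset v hs)] at hs
  exact hs.2.1 (Finset.mem_singleton_self v)

lemma Emb.deletion_eq_empty {C : PreAbstractSimplicialComplex V} (hC : C.Emb 0) {v : V}
    (hv : {v} ∈ C.faces) : (C.deletion v).faces = ∅ := by
  rw [Set.eq_empty_iff_forall_notMem]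
  rintro s ⟨hs, hvs⟩
  rw [hC.eq_singleton_of_zero hv hs] at hvs
  exact hvs (Finset.mem_singleton_self v)

lemma Emb.betti_of_zero {C : PreAbstractSimplicialComplex V} (hC : C.Emb 0) :
    (∀ i, C.betti (i + 1) = 0) ∧ (C.betti 0 : ℤ) = chi C.faces ∧
      (C.faces.Nonempty → C.betti 0 = 1) := by
  rcases C.faces.eq_empty_or_nonempty with he | hne
  · simp [betti_of_empty he, he]
  · obtain ⟨v, hv⟩ := verts_nonempty hne
    have hv := mem_verts.1 hv
    have hL := hC.link_eq_empty hv
    have hD := hC.deletion_eq_empty hv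
    have h0 := betti_zero_of_link_empty hv (finiteHomology _) hL
    rw [betti_of_empty hD, zero_add] at h0
    refine ⟨fun i => ?_, ?_, fun _ => h0⟩
    · rw [betti_succ_of_link_empty hv (finiteHomology _) hL, betti_of_empty hD]
    · rw [h0, chi_deletion_link hv, hL, hD]
      simp

/-- The link of an extremal vertex is empty or a point, so attaching its cone creates no cycle; β_0
then satisfies the recursion of χ. -/
lemma Emb.betti_of_one {C : PreAbstractSimplicialComplex V} (hC : C.Emb 1) :
    (∀ i, C.betti (i + 1) = 0) ∧ (C.betti 0 : ℤ) = chi C.faces := by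
  induction C using induction_verts with
  | h C ih =>
    rcases C.faces.eq_empty_or_nonempty with he | hne
    · simp [betti_of_empty he, he]
    · obtain ⟨v, hv, hL⟩ := hC.exists_link hne
      obtain ⟨d1, d2⟩ := ih _ (card_verts_deletion_lt hv) (hC.deletion v)
      obtain ⟨l1, l2, l3⟩ := hL.betti_of_zero
      have hfin := finiteHomology (V := V)
      have hb : ∀ i, C.betti (i + 1) = 0 := fun i => by
        rcases (C.link v).faces.eq_empty_or_nonempty with hLe | hLne
        · rw [betti_succ_of_link_empty hv (hfin _) hLe, d1]
        · cases i with
          | zero =>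
            have := betti_one_le hv (hfin _) (hfin _) hLne (l3 hLne)
            rw [d1] at this
            exact Nat.le_zero.1 this
          | succ i =>
            have := betti_succ_le hv (hfin _) (hfin _) (i + 1)
            rw [d1, l1] at this
            exact Nat.le_zero.1 this
      refine ⟨hb, ?_⟩
      have := betti_zero_sub_betti_one hv (hfin _) (hfin _) (l1 0)
      have h1 := hb 0
      have h2 := d1 0
      rw [zero_add] at h1 h2
      rw [h1, h2] at this
      rw [chi_deletion_link hv, ← d2, ← l2]
      simpa using this

/-- Homology in degree i + 2 could come only from the deletion or, one degree lower, from a link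
embedded in a line, and both vanish. The difference β_0 − β_1 and χ obey the same recursion. -/
lemma Emb.betti_of_two {C : PreAbstractSimplicialComplex V} (hC : C.Emb 2) :
    (∀ i, C.betti (i + 2) = 0) ∧ (C.betti 0 : ℤ) - C.betti 1 = chi C.faces := by
  induction C using induction_verts with
  | h C ih =>
    rcases C.faces.eq_empty_or_nonempty with he | hne
    · simp [betti_of_empty he, he]
    · obtain ⟨v, hv, hL⟩ := hC.exists_link hne
      obtain ⟨d1, d2⟩ := ih _ (card_verts_deletion_lt hv) (hC.deletion v)
      obtain ⟨l1, l2⟩ := hL.betti_of_one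
      have hfin := finiteHomology (V := V)
      refine ⟨fun i => ?_, ?_⟩
      · have := betti_succ_le hv (hfin _) (hfin _) (i + 1)
        rw [d1, l1] at this
        exact Nat.le_zero.1 this
      · rw [betti_zero_sub_betti_one hv (hfin _) (hfin _) (l1 0), chi_deletion_link hv, d2, l2]

lemma build_vertices (R : Finset V) :
    Build (((fun r : V => ({r} : Finset V)) '' (R : Set V))) (Pi.single 1 R.card) := by
  induction R using Finset.induction_on with
  | empty => simpa using Build.empty
  | insert r R hr ih =>
    have := Build.crit {r} ih (Finset.singleton_nonempty r) (by simpa using hr)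
      (fun τ hτ hl => absurd (Finset.ssubset_singleton_iff.1 hl) hτ.ne_empty)
    rw [Finset.coe_insert, Set.image_insert_eq, Finset.card_insert_of_notMem hr]
    rw [Finset.card_singleton, ← Pi.single_add] at this
    exact this

lemma reach_exists_exit {C : PreAbstractSimplicialComplex V} {K : Set V} {a b : V}
    (h : C.Reach a b) (ha : a ∈ K) (hb : b ∉ K) :
    ∃ x y, x ∈ K ∧ y ∉ K ∧ {x, y} ∈ C.faces := by
  induction h with
  | refl => exact absurd ha hb
  | @tail c d _ h ih =>
    by_cases hc : c ∈ K
    · exact ⟨c, d, hc, hb, h⟩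
    · exact ih hc

/-- Starting from one critical vertex per component, take a maximal family built without further
critical vertices. A missing vertex would allow an edge leaving the family to be attached as a pair
with its new endpoint, and a missing edge could be attached as critical; so the family is
everything. The number of critical edges is left open, since the Euler characteristic determines it
later. -/
lemma IsTransversal.build_graph {C : PreAbstractSimplicialComplex V} {R : Finset V}
    (hR : C.IsTransversal R) (hC : ∀ s ∈ C.faces, s.card ≤ 2) :
    ∃ c, Build C.faces c ∧ c 0 = 0 ∧ c 1 = R.card ∧ ∀ k, c (k + 3) = 0 := by
  classical
  let P : Set (Finset V) → Prop := fun K => K ⊆ C.faces ∧ (∀ r ∈ R, {r} ∈ K) ∧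
    ∃ c, Build K c ∧ c 0 = 0 ∧ c 1 = R.card ∧ ∀ k, c (k + 3) = 0
  have hP0 : P ((fun r : V => ({r} : Finset V)) '' (R : Set V)) := by
    refine ⟨?_, fun r hr => ⟨r, hr, rfl⟩, _, build_vertices R, ?_, ?_, fun k => ?_⟩
    · rintro _ ⟨r, hr, rfl⟩
      exact hR.mem r hr
    · simp
    · simp
    · exact Pi.single_eq_of_ne (by omega) _
  obtain ⟨K, -, hK⟩ := (Set.toFinite {K | P K}).exists_le_maximal hP0
  obtain ⟨hKC, hKR, c, hc, c0, c1, c3⟩ := hK.prop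
  have hmax : ∀ K', P K' → K ⊆ K' → K' ⊆ K := fun K' h h' => hK.le_of_ge h h'
  have hvert : ∀ w, {w} ∈ C.faces → {w} ∈ K := by
    intro w hw
    by_contra hwK
    obtain ⟨r, hr, hrw⟩ := hR.exists_reach w hw
    obtain ⟨x, y, hx, hy, hxy⟩ := reach_exists_exit (K := {a : V | ({a} : Finset V) ∈ K})
      hrw (hKR r hr) hwK
    have hx : {x} ∈ K := hx
    have hy : {y} ∉ K := hy
    have hne : x ≠ y := fun e => hy (e ▸ hx)
    have hxyK : {x, y} ∉ K := fun h => hy ((hc.lower _ h).2 _ (Finset.singleton_nonempty y)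
      (by simp))
    have hb := Build.pair {y} x hc (Finset.singleton_nonempty y) (by simpa using hne) hy hxyK
      (fun τ hτ hl hn => by
        have hτx : x ∈ τ := by
          by_contra hx'
          refine hn ((Finset.Nonempty.subset_singleton_iff hτ).1 ?_)
          exact (Finset.subset_insert_iff_of_notMem hx').1 hl.subset
        obtain ⟨h1, h2⟩ := eq_insert_erase_of_ssubset_insert hl hτx
        rw [Finset.ssubset_singleton_iff.1 h2] at h1
        rw [h1]
        exact hx)
    refine hy (hmax _ ⟨?_, fun r hr => Or.inr (Or.inr (hKR r hr)), c, hb, c0, c1, c3⟩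
      (fun _ h => Or.inr (Or.inr h)) (Or.inl rfl))
    rintro s (rfl | rfl | hs)
    · exact vertex_mem hxy (by simp)
    · exact hxy
    · exact hKC hs
  have hall : C.faces ⊆ K := by
    intro s hs
    by_contra hsK
    have hproper : ∀ τ : Finset V, τ.Nonempty → τ ⊂ s → τ ∈ K := fun τ hτ hl => by
      have h1 := hC s hs
      have h2 := Finset.card_lt_card hl
      have h3 := hτ.card_pos
      obtain ⟨w, rfl⟩ := Finset.card_eq_one.1 (show τ.card = 1 by omega)
      exact hvert w (face_mono hs hl.subset hτ)
    have hs2 : s.card = 2 := by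
      have h1 := hC s hs
      have h2 := (face_nonempty hs).card_pos
      by_contra hne
      obtain ⟨w, rfl⟩ := Finset.card_eq_one.1 (show s.card = 1 by omega)
      exact hsK (hvert w hs)
    have hb := Build.crit s hc (face_nonempty hs) hsK hproper
    refine hsK (hmax _ ⟨?_, fun r hr => Or.inr (hKR r hr), _, hb, ?_, ?_, fun k => ?_⟩
      (fun _ h => Or.inr h) (Or.inl rfl))
    · rintro t (rfl | ht)
      · exact hs
      · exact hKC ht
    · simp [hs2, c0]
    · simp [hs2, c1]
    · rw [Pi.add_apply, c3, hs2, Pi.single_eq_of_ne (by omega), add_zero]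
  obtain rfl : K = C.faces := Set.Subset.antisymm hKC hall
  exact ⟨c, hc, c0, c1, c3⟩

/-- The complex obtained by an elementary collapse. -/
def collapse (C : PreAbstractSimplicialComplex V) (e t : Finset V)
    (h : ∀ s ∈ C.faces, e ⊆ s → s = e ∨ s = t) (h' : ∀ s ∈ C.faces, t ⊆ s → s = t) :
    PreAbstractSimplicialComplex V where
  faces := {s | s ∈ C.faces ∧ s ≠ e ∧ s ≠ t}
  isRelLowerSet_faces := fun s ⟨hs, hse, hst⟩ => ⟨face_nonempty hs, fun _ hus hu =>
    ⟨face_mono hs hus hu, fun e' => (h s hs (e' ▸ hus)).elim hse hst,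
      fun e' => hst (h' s hs (e' ▸ hus))⟩⟩

/-- As long as there is a triangle, one of them has a free edge, and this edge and triangle form the
last pair of the build-up. The collapse keeps the vertices and the components, hence the transversal
R; when no triangle is left, the complex is a graph. -/
lemma Emb.build_two {C : PreAbstractSimplicialComplex V} (hC : C.Emb 2) {R : Finset V}
    (hR : C.IsTransversal R) :
    ∃ c, Build C.faces c ∧ c 0 = 0 ∧ c 1 = R.card ∧ ∀ k, c (k + 3) = 0 := by
  induction hn : C.faces.ncard using Nat.strong_induction_on generalizing C with
  | _ n ih =>
    subst hn
    by_cases htri : ∃ t ∈ C.faces, t.card = 3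
    swap
    · refine hR.build_graph fun s hs => ?_
      have h1 := hC.card_le hs
      have h2 : s.card ≠ 3 := fun h => htri ⟨s, hs, h⟩
      omega
    obtain ⟨t₀, ht₀, hc₀⟩ := htri
    obtain ⟨e, t, he, ht, htc, het, huniq⟩ := hC.exists_free ht₀ hc₀
    have hmaxe : ∀ s ∈ C.faces, e ⊆ s → s = e ∨ s = t := fun s hs hes => by
      by_cases hs3 : s.card = 3
      · exact Or.inr (huniq s hs hs3 hes)
      · have := hC.card_le hs
        exact Or.inl (Finset.eq_of_subset_of_card_le hes (by omega)).symm
    have hmaxt : ∀ s ∈ C.faces, t ⊆ s → s = t := fun s hs hts =>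
      (Finset.eq_of_subset_of_card_le hts (by have := hC.card_le hs; omega)).symm
    let C' := C.collapse e t hmaxe hmaxt
    have hne : e ≠ t := fun h => by rw [h] at he; omega
    have heC : e ∈ C.faces := face_mono ht het (Finset.card_pos.1 (by omega))
    have hsub : C'.faces ⊆ C.faces := fun s hs => hs.1
    obtain ⟨x, hx, hxt⟩ : ∃ x, x ∉ e ∧ insert x e = t := by
      obtain ⟨x, hx⟩ := Finset.card_eq_one.1 (show (t \ e).card = 1 by
        rw [Finset.card_sdiff_of_subset het]; omega)
      have hxm : x ∈ t \ e := hx ▸ Finset.mem_singleton_self x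
      refine ⟨x, (Finset.mem_sdiff.1 hxm).2, ?_⟩
      rw [← Finset.sdiff_union_of_subset het, hx]
      rfl
    have hunion : insert e (insert (insert x e) C'.faces) = C.faces := by
      rw [hxt]
      ext s
      constructor
      · rintro (rfl | rfl | hs)
        · exact heC
        · exact ht
        · exact hs.1
      · intro hs
        by_cases h1 : s = e
        · exact Or.inl h1
        by_cases h2 : s = t
        · exact Or.inr (Or.inl h2)
        exact Or.inr (Or.inr ⟨hs, h1, h2⟩)
    have hvert : ∀ w, {w} ∈ C.faces → {w} ∈ C'.faces := fun w hw => by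
      refine ⟨hw, fun h => ?_, fun h => ?_⟩
      · rw [← h, Finset.card_singleton] at he; omega
      · rw [← h, Finset.card_singleton] at htc; omega
    -- A path along the removed edge is rerouted through the third vertex x of the removed triangle.
    have hreach : ∀ a b, C.Reach a b → C'.Reach a b := by
      intro a b hab
      induction hab with
      | refl => exact Reach.refl _
      | @tail c d _ h ih' =>
        refine ih'.trans ?_
        by_cases hce : {c, d} = e
        · have hxc : x ≠ c := fun h => hx (by rw [← hce, h]; simp)
          have hxd : x ≠ d := fun h => hx (by rw [← hce, h]; simp)
          have hpair : ∀ y ∈ e, ({x, y} : Finset V) ∈ C'.faces := fun y hy => by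
            refine ⟨face_mono ht ?_ (by simp), fun h => hx (h ▸ by simp), fun h => ?_⟩
            · rw [← hxt]
              exact Finset.insert_subset_insert x (Finset.singleton_subset_iff.2 hy)
            · have := Finset.card_le_two (a := x) (b := y)
              rw [h, htc] at this
              omega
          exact (Reach.of_mem (hpair c (hce ▸ by simp))).symm.trans
            (Reach.of_mem (hpair d (hce ▸ by simp)))
        · refine Reach.of_mem ⟨h, hce, fun h' => ?_⟩
          have := Finset.card_le_two (a := c) (b := d)
          rw [h', htc] at this
          omega
    have hR' : C'.IsTransversal R := ⟨fun r hr => hvert r (hR.mem r hr), fun v hv => by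
      obtain ⟨r, hr, h⟩ := hR.exists_reach v hv.1
      exact ⟨r, hr, hreach _ _ h⟩, fun r hr r' hr' h => hR.eq_of_reach r hr r' hr' (h.mono hsub)⟩
    have hlt : C'.faces.ncard < C.faces.ncard :=
      Set.ncard_lt_ncard ⟨hsub, fun h => (h heC).2.1 rfl⟩ (Set.toFinite _)
    obtain ⟨c, hc, hc'⟩ := ih _ hlt (hC.mono hsub) hR' rfl
    refine ⟨c, ?_, hc'⟩
    rw [← hunion]
    refine Build.pair e x hc (face_nonempty heC) hx (fun h => h.2.1 rfl)
      (fun h => h.2.2 hxt) fun τ hτ hl hτe => ?_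
    rw [hxt] at hl
    exact ⟨face_mono ht hl.subset hτ, hτe, hl.ne⟩

/-- A planar complex has a perfect build-up. -/
lemma Emb.exists_build {C : PreAbstractSimplicialComplex V} (hC : C.Emb 2) :
    ∃ c, Build C.faces c ∧ ∀ i, c (i + 1) = C.betti i := by
  obtain ⟨R, hR⟩ := C.exists_isTransversal
  obtain ⟨c, hc, c0, c1, c3⟩ := hC.build_two hR
  obtain ⟨b1, b2⟩ := hC.betti_of_two
  rw [← hR.betti_zero] at c1
  -- Comparing χ computed from critical faces with χ = β_0 − β_1 leaves c 2 as the only unknown. The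
  -- summation bound is chosen to include the indices 0, 1 and 2.
  have hchi := hc.chi_eq (N := Fintype.card V + 3) (by omega)
  rw [← Finset.sum_subset (Finset.range_subset_range.2 (show 3 ≤ Fintype.card V + 3 by omega))
    (fun k _ hk => by
      obtain ⟨j, rfl⟩ := Nat.exists_eq_add_of_le (not_lt.1 (mt Finset.mem_range.2 hk))
      rw [add_comm 3 j, c3]
      simp)] at hchi
  simp only [Finset.sum_range_succ, Finset.sum_range_zero, c0, c1] at hchi
  refine ⟨c, hc, fun i => ?_⟩
  match i with
  | 0 => exact c1
  | 1 =>
    norm_num at hchi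
    change c 2 = _
    omega
  | i + 2 => rw [b1, ← c3 i]

end PreAbstractSimplicialComplex

/-! ### Planar acyclic complexes -/

namespace PreAbstractSimplicialComplex

variable {V : Type} [Fintype V] [DecidableEq V]

/-- A complex is connected if it has a vertex and any two vertices are joined by an edge path. -/
def IsConn (C : PreAbstractSimplicialComplex V) : Prop :=
  ∃ r, {r} ∈ C.faces ∧ ∀ w, {w} ∈ C.faces → C.Reach r w

lemma IsConn.reach {C : PreAbstractSimplicialComplex V} (h : C.IsConn) {a b : V}
    (ha : {a} ∈ C.faces) (hb : {b} ∈ C.faces) : C.Reach a b := by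
  obtain ⟨r, -, h⟩ := h
  exact (h a ha).symm.trans (h b hb)

lemma isConn_iff {C : PreAbstractSimplicialComplex V} : C.IsConn ↔ C.betti 0 = 1 := by
  constructor
  · rintro ⟨r, hr, h⟩
    have : C.IsTransversal {r} := ⟨by simpa using hr, by simpa using h, by simp⟩
    rw [this.betti_zero, Finset.card_singleton]
  · intro h
    obtain ⟨R, hR⟩ := C.exists_isTransversal
    rw [hR.betti_zero] at h
    obtain ⟨r, rfl⟩ := Finset.card_eq_one.1 h
    exact ⟨r, hR.mem r (by simp), by simpa using hR.exists_reach⟩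

lemma betti_zero_pos {C : PreAbstractSimplicialComplex V} (h : C.faces.Nonempty) :
    0 < C.betti 0 := by
  obtain ⟨R, hR⟩ := C.exists_isTransversal
  rw [hR.betti_zero, Finset.card_pos]
  obtain ⟨v, hv⟩ := verts_nonempty h
  obtain ⟨r, hr, -⟩ := hR.exists_reach v (mem_verts.1 hv)
  exact ⟨r, hr⟩

/-- In the plane χ = β_0 − β_1, and here β_0 = 1. -/
lemma IsConn.chi_le {C : PreAbstractSimplicialComplex V} (h : C.IsConn) (hC : C.Emb 2) :
    chi C.faces ≤ 1 := by
  rw [← hC.betti_of_two.2, isConn_iff.1 h]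
  simp

/-- A path through v enters and leaves it at vertices of the link, which can be joined inside the
connected link instead. -/
lemma IsConn.deletion {C : PreAbstractSimplicialComplex V} (h : C.IsConn) {v : V}
    (hL : (C.link v).IsConn) : (C.deletion v).IsConn := by
  have hlink : ∀ x, x ≠ v → {v, x} ∈ C.faces → {x} ∈ (C.link v).faces := fun x hx hvx =>
    ⟨Finset.singleton_nonempty x, by simpa using hx.symm, hvx⟩
  have hsub := C.link_faces_subset v
  obtain ⟨u, hu, hLr⟩ := hL
  have huv : u ≠ v := fun e => hu.2.1 (by simp [e])
  refine ⟨u, hsub hu, fun w hw => ?_⟩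
  have key : ∀ w, C.Reach u w → w ≠ v → (C.deletion v).Reach u w := by
    intro w hw
    suffices h : (w ≠ v → (C.deletion v).Reach u w) by exact h
    induction hw with
    | refl => exact fun _ => Reach.refl _
    | @tail c d _ h' ih =>
      intro hd
      by_cases hc : c = v
      · subst hc
        exact (hLr d (hlink d hd h')).mono hsub
      · refine (ih hc).trans (Reach.of_mem ⟨h', ?_⟩)
        simp [Ne.symm hc, Ne.symm hd]
  exact key w (h.reach (C.link_subset v hu) hw.1) fun e => hw.2 (by simp [e])

/-- The full subcomplex on a vertex and some components of its complement is connected. -/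
lemma IsConn.restrict_insert {C : PreAbstractSimplicialComplex V} (h : C.IsConn) {v : V}
    (hv : {v} ∈ C.faces) {S : Set V}
    (hS : ∀ a ∈ S, ∀ b, a ≠ v → b ≠ v → {a, b} ∈ C.faces → b ∈ S) :
    (C.restrict (insert v S)).IsConn := by
  refine ⟨v, ⟨hv, by simp⟩, fun w hw => Reach.symm ?_⟩
  have hwS : w ∈ insert v S := hw.2 (by simp)
  have hwv : C.Reach w v := h.reach hw.1 hv
  clear hw
  induction hwv using Relation.ReflTransGen.head_induction_on with
  | refl => exact Reach.refl _
  | @head a b hab _ ih =>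
    by_cases hav : a = v
    · rw [hav]
      exact Reach.refl _
    have hb : b ∈ insert v S := by
      by_cases hbv : b = v
      · exact Or.inl hbv
      · exact Or.inr (hS a (hwS.resolve_left hav) b hav hbv hab)
    have hmem : {a, b} ∈ (C.restrict (insert v S)).faces := by
      refine ⟨hab, fun x hx => ?_⟩
      simp only [Finset.coe_insert, Finset.coe_singleton, Set.mem_insert_iff,
        Set.mem_singleton_iff] at hx
      rcases hx with rfl | rfl
      · exact hwS
      · exact hb
    exact (Reach.of_mem hmem).trans (ih hb)

/-- The two pieces cover C and have only the face {v} in common. -/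
lemma chi_restrict_add {C : PreAbstractSimplicialComplex V} {v : V} (hv : {v} ∈ C.faces)
    {S T : Set V} (hST : Disjoint S T)
    (hcov : ∀ s ∈ C.faces, (s : Set V) ⊆ insert v S ∨ (s : Set V) ⊆ insert v T) :
    chi (C.restrict (insert v S)).faces + chi (C.restrict (insert v T)).faces =
      chi C.faces + 1 := by
  have h1 : (C.restrict (insert v T)).faces =
      insert {v} ((C.restrict (insert v T)).faces \ {{v}}) := by
    rw [Set.insert_sdiff_singleton]
    have hmem : {v} ∈ (C.restrict (insert v T)).faces := ⟨hv, by simp⟩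
    exact (Set.insert_eq_of_mem hmem).symm
  have h2 : C.faces = (C.restrict (insert v S)).faces ∪
      ((C.restrict (insert v T)).faces \ {{v}}) := by
    ext s
    constructor
    · intro hs
      by_cases hsv : s = {v}
      · exact Or.inl ⟨hs, by simp [hsv]⟩
      · exact (hcov s hs).imp (fun h => ⟨hs, h⟩) fun h => ⟨⟨hs, h⟩, hsv⟩
    · rintro (hs | hs)
      · exact hs.1
      · exact hs.1.1
  have h3 : Disjoint (C.restrict (insert v S)).faces
      ((C.restrict (insert v T)).faces \ {{v}}) := by
    rw [Set.disjoint_left]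
    rintro s ⟨hs, hs1⟩ ⟨⟨-, hs2⟩, hsv⟩
    refine hsv (Finset.eq_singleton_iff_nonempty_unique_mem.2 ⟨face_nonempty hs, fun x hx => ?_⟩)
    rcases hs1 hx with h | h
    · exact h
    rcases hs2 hx with h' | h'
    · exact h'
    exact (Set.disjoint_left.1 hST h h').elim
  have e1 := congrArg chi h1
  have e2 := congrArg chi h2
  rw [chi_insert (by simp)] at e1
  rw [chi_union h3] at e2
  rw [e1, e2]
  simp
  ring

/-- A planar acyclic complex has a vertex, different from a given one, with acyclic link. -/
lemma IsConn.exists_link {C : PreAbstractSimplicialComplex V} (hconn : C.IsConn) (hC : C.Emb 2)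
    (hchi : chi C.faces = 1) {r w : V} (hr : {r} ∈ C.faces) (hw : {w} ∈ C.faces) (hwr : w ≠ r) :
    ∃ v, v ≠ r ∧ {v} ∈ C.faces ∧ (C.link v).IsConn ∧ chi (C.link v).faces = 1 := by
  induction C using induction_verts generalizing r w with
  | h C ih =>
    obtain ⟨v, hvr, hv, hL⟩ := hC.exists_link_ne hwr hw
    have hrD : {r} ∈ (C.deletion v).faces := ⟨hr, by simpa using hvr⟩
    let T : Set V := {x | (C.deletion v).Reach r x}
    let S : Set V := {x | x ≠ v ∧ {x} ∈ C.faces ∧ x ∉ T}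
    have hDvert : ∀ x, {x} ∈ C.faces → x ≠ v → {x} ∈ (C.deletion v).faces := fun x hx hxv =>
      ⟨hx, by simpa using hxv.symm⟩
    have hedge : ∀ a b, a ≠ v → b ≠ v → {a, b} ∈ C.faces → (C.deletion v).Reach a b :=
      fun a b ha hb h => Reach.of_mem ⟨h, by simp [ha.symm, hb.symm]⟩
    rcases S.eq_empty_or_nonempty with hS | ⟨w', hw'⟩
    · have hD : (C.deletion v).IsConn := by
        refine ⟨r, hrD, fun x hx => ?_⟩
        by_contra hx'
        have : x ∈ S := ⟨fun e => hx.2 (by simp [e]), hx.1, hx'⟩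
        rw [hS] at this
        exact this
      -- From 1 = χ(C) = χ(D) + 1 − χ(L) and χ(D) ≤ 1 one gets χ(L) ≤ 1. As L embeds in a line, χ(L)
      -- = β_0(L), which is positive because a connected deletion forces L to be nonempty.
      have h1 := hD.chi_le (hC.deletion v)
      have h2 := chi_deletion_link hv
      have h3 := hL.betti_of_one.2
      have hne : (C.link v).faces.Nonempty := by
        by_contra he
        have := betti_zero_of_link_empty hv (finiteHomology _) (Set.not_nonempty_iff_eq_empty.1 he)
        rw [isConn_iff.1 hconn, isConn_iff.1 hD] at this
        omega
      have h4 := betti_zero_pos hne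
      refine ⟨v, hvr, hv, isConn_iff.2 ?_, ?_⟩ <;> omega
    · have hvT : v ∉ T := fun h => (h.vertex hrD).2 (by simp)
      have hST : Disjoint S T := Set.disjoint_left.2 fun x hx hx' => hx.2.2 hx'
      have hcov : ∀ s ∈ C.faces, (s : Set V) ⊆ insert v S ∨ (s : Set V) ⊆ insert v T := by
        intro s hs
        by_cases h : ∃ x ∈ s, x ∈ T
        · obtain ⟨x, hx, hxT⟩ := h
          refine Or.inr fun y hy => ?_
          by_cases hyv : y = v
          · exact Or.inl hyv
          · refine Or.inr (Reach.trans hxT (hedge x y (fun e => hvT (e ▸ hxT)) hyv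
              (face_mono hs ?_ (by simp))))
            simp [Finset.insert_subset_iff, hx, Finset.mem_coe.1 hy]
        · refine Or.inl fun y hy => ?_
          by_cases hyv : y = v
          · exact Or.inl hyv
          · exact Or.inr ⟨hyv, vertex_mem hs hy, fun hyT => h ⟨y, hy, hyT⟩⟩
      have hA : (C.restrict (insert v S)).IsConn := by
        refine hconn.restrict_insert hv fun a ha b hav hbv hab =>
          ⟨hbv, vertex_mem hab (by simp), fun hbT => ha.2.2 ?_⟩
        exact Reach.trans hbT (hedge a b hav hbv hab).symm
      have hA' : (C.restrict (insert v T)).IsConn := by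
        refine hconn.restrict_insert hv fun a ha b hav hbv hab => ?_
        exact Reach.trans ha (hedge a b hav hbv hab)
      -- Now v is a cut vertex. The Euler characteristics of the two connected pieces add up to 2
      -- and each is at most 1, so both equal 1.
      have hsum := chi_restrict_add hv hST hcov
      have h1 := hA.chi_le (hC.mono (C.restrict_faces_subset _))
      have h2 := hA'.chi_le (hC.mono (C.restrict_faces_subset _))
      have hrT : r ∈ T := Reach.refl r
      -- The induction runs on the piece avoiding r, with v as the forbidden vertex. The vertex u
      -- found there lies in S, and all faces containing it lie in that piece, so its link in C is
      -- the same. This is why one vertex has to be excluded in the statement.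
      obtain ⟨u, huv, hu, hLc, hLchi⟩ := ih (C.restrict (insert v S))
        (card_verts_lt (C.restrict_faces_subset _) hr fun h => by
          rcases h.2 (show r ∈ (({r} : Finset V) : Set V) by simp) with h' | h'
          · exact hvr h'.symm
          · exact h'.2.2 hrT) hA (hC.mono (C.restrict_faces_subset _)) (by omega)
        (r := v) (w := w') ⟨hv, by simp⟩ ⟨hw'.2.1, by simpa using Or.inr hw'⟩ hw'.1
      have huS : u ∈ S := (hu.2 (by simp : u ∈ (({u} : Finset V) : Set V))).resolve_left huv
      have hlink : ((C.restrict (insert v S)).link u) = C.link u := by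
        have : ((C.restrict (insert v S)).link u).faces = (C.link u).faces := by
          ext s
          refine ⟨fun hs => ⟨hs.1, hs.2.1, hs.2.2.1⟩, fun hs => ⟨hs.1, hs.2.1, hs.2.2, ?_⟩⟩
          refine (hcov _ hs.2.2).resolve_right fun h => ?_
          rcases h (show u ∈ ((insert u s : Finset V) : Set V) by simp) with h' | h'
          · exact huv h'
          · exact huS.2.2 h'
        exact PreAbstractSimplicialComplex.ext this
      rw [hlink] at hLc hLchi
      exact ⟨u, fun e => huS.2.2 (e ▸ hrT), hu.1, hLc, hLchi⟩

/-- A planar acyclic complex is non-evasive. -/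
lemma IsConn.nonEvasive {C : PreAbstractSimplicialComplex V} (hconn : C.IsConn) (hC : C.Emb 2)
    (hchi : chi C.faces = 1) : C.NonEvasive := by
  induction C using induction_verts with
  | h C ih =>
    obtain ⟨r, hr, -⟩ := id hconn
    by_cases h : ∃ w, {w} ∈ C.faces ∧ w ≠ r
    · obtain ⟨w, hw, hwr⟩ := h
      obtain ⟨v, -, hv, hL, hLchi⟩ := hconn.exists_link hC hchi hr hw hwr
      refine NonEvasive.step C v hv
        (ih _ (card_verts_link_lt hv) hL (hC.link v) hLchi)
        (ih _ (card_verts_deletion_lt hv) (hconn.deletion hL) (hC.deletion v) ?_)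
      have := chi_deletion_link hv
      omega
    · push Not at h
      refine NonEvasive.point C r (Set.eq_singleton_iff_unique_mem.2 ⟨hr, fun s hs => ?_⟩)
      exact Finset.eq_singleton_iff_nonempty_unique_mem.2
        ⟨face_nonempty hs, fun x hx => h x (vertex_mem hs hx)⟩

end PreAbstractSimplicialComplex

/-! ### The sweep of a tight complex -/

namespace PreAbstractSimplicialComplex

open SingularChain

variable {V : Type} [Fintype V] [DecidableEq V]

/-- A subcomplex whose inclusion is injective on homology. -/
def InjSub (D C : PreAbstractSimplicialComplex V) : Prop :=
  ∃ h : D.faces ⊆ C.faces, ∀ i, Function.Injective (hmap i (inc (realization_mono h)))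

/-- The inclusion of A in C factors through D, and the first factor of an injective composite is
injective. -/
lemma InjSub.of_subset {A D C : PreAbstractSimplicialComplex V} (h : InjSub A C)
    (hAD : A.faces ⊆ D.faces) (hDC : D.faces ⊆ C.faces) : InjSub A D := by
  obtain ⟨hAC, hinj⟩ := h
  refine ⟨hAD, fun i x y hxy => hinj i ?_⟩
  have e : (inc (realization_mono hAC)) =
      inc (realization_mono hAD) ≫ inc (realization_mono hDC) := rfl
  rw [e, hmap_comp, hmap_comp, hxy]

/-- The full subcomplexes above any level of a height function include injectively on homology. -/
def IsTight (C : PreAbstractSimplicialComplex V) (h : V → ℝ) : Prop :=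
  ∀ t, InjSub (C.restrict {w | t < h w}) C

section Lowest

variable {C : PreAbstractSimplicialComplex V} {h : V → ℝ} {v : V}

lemma restrict_deletion (hlow : ∀ w, w ≠ v → {w} ∈ C.faces → h v < h w) (t : ℝ) :
    (C.deletion v).restrict {w | t < h w} = C.restrict {w | max t (h v) < h w} := by
  refine PreAbstractSimplicialComplex.ext (Set.ext fun s => ⟨?_, ?_⟩)
  · rintro ⟨⟨hs, hv⟩, ht⟩
    exact ⟨hs, fun w hw => max_lt (ht hw) (hlow w (fun e => hv (e ▸ hw)) (vertex_mem hs hw))⟩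
  · rintro ⟨hs, ht⟩
    exact ⟨⟨hs, fun hv => lt_irrefl _ ((le_max_right t (h v)).trans_lt (ht hv))⟩,
      fun w hw => (le_max_left t (h v)).trans_lt (ht hw)⟩

/-- The superlevel subcomplexes of the deletion of the lowest vertex are those superlevel
subcomplexes of C whose level is at least that of v. -/
lemma IsTight.deletion (hC : C.IsTight h) (hlow : ∀ w, w ≠ v → {w} ∈ C.faces → h v < h w) :
    (C.deletion v).IsTight h := fun t => by
  refine InjSub.of_subset ?_ (restrict_faces_subset _ _) (C.deletion_faces_subset v)
  rw [restrict_deletion hlow]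
  exact hC _

lemma IsTight.delMap_injective (hC : C.IsTight h)
    (hlow : ∀ w, w ≠ v → {w} ∈ C.faces → h v < h w) (i : ℕ) :
    Function.Injective (C.delMap v i) := by
  have e : C.deletion v = C.restrict {w | h v < h w} := by
    refine PreAbstractSimplicialComplex.ext (Set.ext fun s => ⟨?_, ?_⟩)
    · rintro ⟨hs, hv⟩
      exact ⟨hs, fun w hw => hlow w (fun e => hv (e ▸ hw)) (vertex_mem hs hw)⟩
    · rintro ⟨hs, ht⟩
      exact ⟨hs, fun hv => lt_irrefl (h v) (ht hv)⟩
  have := hC (h v)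
  rw [← e] at this
  exact this.2 i

end Lowest

lemma Build.zero {K : Set (Finset V)} {c : ℕ → ℕ} (h : Build K c) : c 0 = 0 := by
  induction h with
  | empty => rfl
  | crit σ h hne hσ hb ih => simp [ih, hne.ne_empty]
  | pair σ x h hne hx hσ hxσ hb ih => exact ih

section Sweep

variable {C : PreAbstractSimplicialComplex V} {E : Type} [AddCommGroup E] [Module ℝ E]
  [Module.Finite ℝ E] {φ : V → E} {h : Module.Dual ℝ E}

/-- A tight complex in three-space has a perfect build-up. -/
lemma IsTight.exists_build (hE : Module.finrank ℝ E = 3) (hφ : Set.InjOn (lin φ) C.realization)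
    (hgen : ∀ v w, {v} ∈ C.faces → {w} ∈ C.faces → h (φ v) = h (φ w) → v = w)
    (hC : C.IsTight fun w => h (φ w)) : ∃ c, Build C.faces c ∧ ∀ i, c (i + 1) = C.betti i := by
  induction C using induction_verts with
  | h C ih =>
    rcases C.faces.eq_empty_or_nonempty with he | hne
    · exact ⟨0, he ▸ Build.empty, fun i => (betti_of_empty he i).symm⟩
    obtain ⟨v, hv, hlow⟩ := exists_isLeast (fun w => h (φ w)) hgen hne
    have hinj := hC.delMap_injective hlow
    have hL : (C.link v).Emb 2 := emb_link hE hφ h hlow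
    have hsub := C.deletion_faces_subset v
    obtain ⟨d, hd, hdb⟩ := ih _ (card_verts_deletion_lt hv) (hφ.mono (realization_mono hsub))
      (fun a b ha hb => hgen a b (hsub ha) (hsub hb)) (hC.deletion hlow)
    obtain ⟨m, hm, hmb⟩ := hL.exists_build
    have hfin := finiteHomology (V := V)
    rcases (C.link v).faces.eq_empty_or_nonempty with hLe | hLne
    · refine ⟨_, hd.of_link_empty hv hLe, fun i => ?_⟩
      cases i with
      | zero => simp [betti_zero_of_link_empty hv (hfin _) hLe, ← hdb]
      | succ i => simp [betti_succ_of_link_empty hv (hfin _) hLe, ← hdb]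
    · rcases hd.cone (fun σ hσ => hσ.2) hm (C.link_faces_subset v) with ⟨hLe, -⟩ | ⟨-, c, hc, hcd⟩
      · exact absurd hLe hLne.ne_empty
      · rw [coneSet_deletion_link hv] at hc
        refine ⟨c, hc, fun i => ?_⟩
        have hi := hcd i
        match i with
        | 0 =>
          rw [hm.zero, hdb] at hi
          simpa [betti_zero_eq hv hLne (hinj 0)] using hi
        | 1 =>
          -- The critical vertex of the link cancelled against v accounts for the same 1 as the
          -- passage to reduced homology.
          have := betti_one_add_one hv (hfin _) (hfin _) hLne (hinj 0) (hinj 1)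
          rw [hdb, hmb, if_pos rfl] at hi
          omega
        | i + 2 =>
          have := betti_succ_eq hv (hfin _) (hfin _) (hinj (i + 1)) (hinj (i + 2))
          rw [hdb, hmb, if_neg (by omega)] at hi
          omega

/-- A tight acyclic complex in three-space is non-evasive. -/
lemma IsTight.nonEvasive (hE : Module.finrank ℝ E = 3) (hφ : Set.InjOn (lin φ) C.realization)
    (hgen : ∀ v w, {v} ∈ C.faces → {w} ∈ C.faces → h (φ v) = h (φ w) → v = w)
    (hC : C.IsTight fun w => h (φ w)) (h0 : C.betti 0 = 1) (h1 : ∀ i, C.betti (i + 1) = 0) :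
    C.NonEvasive := by
  induction C using induction_verts with
  | h C ih =>
    have hne : C.faces.Nonempty := by
      by_contra he
      rw [betti_of_empty (Set.not_nonempty_iff_eq_empty.1 he)] at h0
      exact zero_ne_one h0
    obtain ⟨v, hv, hlow⟩ := exists_isLeast (fun w => h (φ w)) hgen hne
    have hinj := hC.delMap_injective hlow
    have hL : (C.link v).Emb 2 := emb_link hE hφ h hlow
    have hsub := C.deletion_faces_subset v
    have hfin := finiteHomology (V := V)
    rcases (C.link v).faces.eq_empty_or_nonempty with hLe | hLne
    -- An empty link makes v a component by itself, and β_0 = 1 leaves room for no other.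
    · have hD0 := betti_zero_of_link_empty hv (hfin _) hLe
      have hDe : (C.deletion v).faces = ∅ := by
        by_contra hDe
        have := betti_zero_pos (Set.nonempty_iff_ne_empty.2 hDe)
        omega
      refine NonEvasive.point C v ?_
      rw [← coneSet_deletion_link hv, hLe, hDe]
      simp [coneSet]
    · have e0 := betti_zero_eq hv hLne (hinj 0)
      have e1 := betti_one_add_one hv (hfin _) (hfin _) hLne (hinj 0) (hinj 1)
      have e2 := fun i => betti_succ_eq hv (hfin _) (hfin _) (hinj (i + 1)) (hinj (i + 2))
      have hpos := betti_zero_pos hLne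
      have h10 := h1 0
      rw [zero_add] at h10
      -- Here β_1(D) + β_0(L) = β_1(C) + 1 = 1 and β_0(L) is positive, which also gives β_1(D) = 0.
      have hL0 : (C.link v).betti 0 = 1 := by omega
      have hL1 : (C.link v).betti 1 = 0 := by
        have a1 : C.betti 2 = 0 := h1 1
        have a2 : C.betti 2 = (C.deletion v).betti 2 + (C.link v).betti 1 := e2 0
        omega
      have hLchi : chi (C.link v).faces = 1 := by
        rw [← hL.betti_of_two.2, hL0, hL1]
        simp
      refine NonEvasive.step C v hv ((isConn_iff.2 hL0).nonEvasive hL hLchi)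
        (ih _ (card_verts_deletion_lt hv) (hφ.mono (realization_mono hsub))
          (fun a b ha hb => hgen a b (hsub ha) (hsub hb)) (hC.deletion hlow) (by omega) ?_)
      intro i
      cases i with
      | zero =>
        rw [zero_add]
        omega
      | succ i =>
        have a1 : C.betti (i + 2) = 0 := h1 (i + 1)
        have a2 := e2 i
        change (C.deletion v).betti (i + 2) = 0
        omega

end Sweep

end PreAbstractSimplicialComplex

end

/-! ### The theorem in three-space -/

theorem theorem2p5 {V : Type} [Finite V] [DecidableEq V] (C : PreAbstractSimplicialComplex V)
    (φ : V → EuclideanSpace ℝ (Fin 3)) (hφ : C.IsLinearEmbedding φ)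
    (π : EuclideanSpace ℝ (Fin 3)) (hπ : π ≠ 0)
    (hgen : ∀ v w : V, {v} ∈ C.faces → {w} ∈ C.faces →
      inner ℝ π (φ v) = inner ℝ π (φ w) → v = w)
    (htight : IsPiTight π (C.polyhedron φ)) :
    (∃ f : C.faces → ℤ, C.IsPerfectMorse f) ∧ (C.HasTrivialHomology → C.NonEvasive) := by
  have := Fintype.ofFinite V
  have hE : Module.finrank ℝ (EuclideanSpace ℝ (Fin 3)) = 3 := by simp
  have hC : C.IsTight fun w => innerₛₗ ℝ π (φ w) := fun t =>
    ⟨C.restrict_faces_subset _, C.injective_of_isPiTight π hφ htight t⟩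
  refine ⟨?_, fun ⟨h0, h1⟩ => ?_⟩
  · obtain ⟨c, hc, hcb⟩ := hC.exists_build hE hφ.injOn hgen
    obtain ⟨f, hf, hcrit⟩ := hc.exists_isDiscreteMorse
    exact ⟨f, hf, fun i => by rw [hcrit, hcb]⟩
  · refine hC.nonEvasive hE hφ.injOn hgen h0 fun i => ?_
    have := h1 (i + 1) i.succ_pos
    exact Module.finrank_zero_of_subsingleton
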